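/- An edge coloring of a finite simple undirected graph $G$ is proper if distinct edges with a common endpoint receive distinct colors; the chromatic index $\chi'(G)$ is the smallest positive integer $k$ such that $G$ has a proper edge coloring with $k$ colors; $\Delta(G)$ is the maximum degree of $G$. A set $D$ of vertices is dominating if every vertex is in $D$ or adjacent to a vertex of $D$. For every constant $c \ge 0$ there are a randomized algorithm and polynomials $T, S$ such that the following holds. Given a graph $G$ with $n$ vertices and $m$ edges and a dominating set $D$ of $G$, the algorithm always halts, in time at most $T(n)\, 2^{m-n+|D|}$ and using space at most $S(n)$, whatever its random bits are, and its output satisfies: (one-sided error) the output is always equal to $\chi'(G)$, except that, when $\chi'(G)=\Delta(G)$, it may also be $\Delta(G)+1$; (high probability) the output equals $\chi'(G)$ with probability at least $1-(n+1)^{-c}$. Time and space are bit costs: the algorithm is a program for a random access machine with logarithmic cost that can read independent fair random bits. The input consists of $n$, the adjacency matrix of $G$ and the characteristic vector of $D$. -/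

import Mathlib

/-! ### Edge colouring and dominating sets -/

/-- An edge colouring is proper if distinct edges with a common endpoint get distinct colours. -/
def IsProperEdgeColoring {V K : Type*} (G : SimpleGraph V) (C : G.EdgeLabeling K) : Prop :=
  ∀ e f : G.edgeSet, e ≠ f → (∃ v : V, v ∈ (e : Sym2 V) ∧ v ∈ (f : Sym2 V)) → C e ≠ C f

/-- The chromatic index: the smallest positive `k` such that `G` has a proper edge colouring with
`k` colours. -/
noncomputable def chromaticIndex {V : Type*} (G : SimpleGraph V) : ℕ :=
  sInf {k : ℕ | 0 < k ∧ ∃ C : G.EdgeLabeling (Fin k), IsProperEdgeColoring G C}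

/-- Every vertex is in `D` or adjacent to a vertex of `D`. -/
def IsDominatingSet {V : Type*} (G : SimpleGraph V) (D : Finset V) : Prop :=
  ∀ v : V, v ∈ D ∨ ∃ u ∈ D, G.Adj v u

/-! ### The machine model: a probabilistic random access machine with logarithmic cost

The store consists of cells holding natural numbers. A cell has an address `(x, i)`: cell `i` of
array `x`. A program can name only finitely many arrays; indices are computed at run time. -/

namespace RAM

/-- The store; all but finitely many cells hold `0`. -/
abbrev Store := ℕ × ℕ →₀ ℕ

/-- The arithmetic, comparison and bitwise instructions. -/
inductive Op
  | add | sub | mul | div | mod | lt | eq | xor | and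

/-- Subtraction is truncated at `0`, and division is rounded down (`a / 0 = 0`, `a % 0 = a`).
Comparisons return `1` or `0`. -/
def Op.eval : Op → ℕ → ℕ → ℕ
  | .add, a, b => a + b
  | .sub, a, b => a - b
  | .mul, a, b => a * b
  | .div, a, b => a / b
  | .mod, a, b => a % b
  | .lt, a, b => if a < b then 1 else 0
  | .eq, a, b => if a = b then 1 else 0
  | .xor, a, b => a ^^^ b
  | .and, a, b => a &&& b

/-- Expressions: a constant, the content of cell `i` of array `x`, an operation. -/
inductive Expr
  | lit (k : ℕ)
  | get (x : ℕ) (i : Expr)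
  | op (o : Op) (a b : Expr)

/-- The value of an expression. -/
def Expr.eval (σ : Store) : Expr → ℕ
  | .lit k => k
  | .get x i => σ (x, i.eval σ)
  | .op o a b => o.eval (a.eval σ) (b.eval σ)

/-- The cost of evaluating an expression: every node is charged one unit plus the binary length of
the number it produces, so operands, results and computed addresses are all charged. -/
def Expr.cost (σ : Store) : Expr → ℕ
  | .lit k => 1 + k.size
  | .get x i => i.cost σ + (1 + (σ (x, i.eval σ)).size)
  | .op o a b => a.cost σ + b.cost σ + (1 + (o.eval (a.eval σ) (b.eval σ)).size)

/-- Programs. -/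
inductive Prog
  | skip
  /-- write the value of `e` into cell `i` of array `x` -/
  | set (x : ℕ) (i e : Expr)
  /-- write a fresh fair random bit into cell `0` of array `x` -/
  | flip (x : ℕ)
  | seq (p q : Prog)
  /-- run `p` if `e` is nonzero and `q` otherwise -/
  | ite (e : Expr) (p q : Prog)
  /-- repeat `p` as long as `e` is nonzero -/
  | while (e : Expr) (p : Prog)

/-- The space taken by a store: the total binary length of the addresses and the contents of all
nonzero cells. -/
def Store.space (σ : Store) : ℕ :=
  σ.sum fun c v => c.1.size + c.2.size + v.size

/-- A configuration: the store, and the number of random bits consumed so far. -/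
structure Config where
  store : Store
  coins : ℕ

/-- `Exec ω p s s' t m`: with the random bits `ω 0, ω 1, …` (each can be read once, in this order),
the program `p` started in configuration `s` halts in configuration `s'` after time `t`, and the
largest space that is in use at any moment is `m`. The work space of expression evaluation is
bounded by its cost and is counted. -/
inductive Exec (ω : ℕ → Bool) : Prog → Config → Config → ℕ → ℕ → Prop
  | skip (s : Config) : Exec ω .skip s s 1 s.store.space
  | set (s : Config) (x : ℕ) (i e : Expr) (σ' : Store)
      (hσ : σ' = s.store.update (x, i.eval s.store) (e.eval s.store)) :
      Exec ω (.set x i e) s ⟨σ', s.coins⟩ (1 + i.cost s.store + e.cost s.store)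
        (max (s.store.space + i.cost s.store + e.cost s.store) (Store.space σ'))
  | flip (s : Config) (x : ℕ) (σ' : Store)
      (hσ : σ' = s.store.update (x, 0) (ω s.coins).toNat) :
      Exec ω (.flip x) s ⟨σ', s.coins + 1⟩ 1 (max s.store.space (Store.space σ'))
  | seq {p q : Prog} {s₁ s₂ s₃ : Config} {t₁ t₂ m₁ m₂ : ℕ}
      (h₁ : Exec ω p s₁ s₂ t₁ m₁) (h₂ : Exec ω q s₂ s₃ t₂ m₂) :
      Exec ω (.seq p q) s₁ s₃ (t₁ + t₂) (max m₁ m₂)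
  | ite_true {e : Expr} {p q : Prog} {s s' : Config} {t m : ℕ}
      (he : e.eval s.store ≠ 0) (h : Exec ω p s s' t m) :
      Exec ω (.ite e p q) s s' (1 + e.cost s.store + t) (max (s.store.space + e.cost s.store) m)
  | ite_false {e : Expr} {p q : Prog} {s s' : Config} {t m : ℕ}
      (he : e.eval s.store = 0) (h : Exec ω q s s' t m) :
      Exec ω (.ite e p q) s s' (1 + e.cost s.store + t) (max (s.store.space + e.cost s.store) m)
  | while_false {e : Expr} {p : Prog} {s : Config} (he : e.eval s.store = 0) :
      Exec ω (.while e p) s s (1 + e.cost s.store) (s.store.space + e.cost s.store)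
  | while_true {e : Expr} {p : Prog} {s₁ s₂ s₃ : Config} {t₁ t₂ m₁ m₂ : ℕ}
      (he : e.eval s₁.store ≠ 0) (h₁ : Exec ω p s₁ s₂ t₁ m₁)
      (h₂ : Exec ω (.while e p) s₂ s₃ t₂ m₂) :
      Exec ω (.while e p) s₁ s₃ (1 + e.cost s₁.store + t₁ + t₂)
        (max (s₁.store.space + e.cost s₁.store) (max m₁ m₂))

/-- With the random bits fixed, the final configuration, the time and the space are determined. -/
theorem Exec.det {ω : ℕ → Bool} {p : Prog} {s s₁ s₂ : Config} {t₁ t₂ m₁ m₂ : ℕ}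
    (h₁ : Exec ω p s s₁ t₁ m₁) (h₂ : Exec ω p s s₂ t₂ m₂) : s₁ = s₂ ∧ t₁ = t₂ ∧ m₁ = m₂ := by
  induction h₁ generalizing s₂ t₂ m₂ with
  | skip s => cases h₂; simp
  | set s x i e σ' hσ => cases h₂; simp_all
  | flip s x σ' hσ => cases h₂; simp_all
  | seq _ _ ih₁ ih₂ =>
    cases h₂ with
    | seq a b =>
      obtain ⟨rfl, rfl, rfl⟩ := ih₁ a
      obtain ⟨rfl, rfl, rfl⟩ := ih₂ b
      simp
  | ite_true he _ ih =>
    cases h₂ with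
    | ite_true _ a => obtain ⟨rfl, rfl, rfl⟩ := ih a; simp
    | ite_false he' _ => exact absurd he' he
  | ite_false he _ ih =>
    cases h₂ with
    | ite_true he' _ => exact absurd he he'
    | ite_false _ a => obtain ⟨rfl, rfl, rfl⟩ := ih a; simp
  | while_false he =>
    cases h₂ with
    | while_false _ => simp
    | while_true he' _ _ => exact absurd he he'
  | while_true he _ _ ih₁ ih₂ =>
    cases h₂ with
    | while_false he' => exact absurd he' he
    | while_true _ a b =>
      obtain ⟨rfl, rfl, rfl⟩ := ih₁ a
      obtain ⟨rfl, rfl, rfl⟩ := ih₂ b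
      simp

/-- The input: cell `0` of array `0` holds the number `n` of vertices, array `1` holds the adjacency
matrix of `G` row by row, array `2` holds the characteristic vector of `D`. -/
noncomputable def input {n : ℕ} (G : SimpleGraph (Fin n)) [DecidableRel G.Adj]
    (D : Finset (Fin n)) : Config where
  store := Finsupp.single (0, 0) n
    + ∑ i : Fin n, ∑ j : Fin n,
        (if G.Adj i j then Finsupp.single (1, n * (i : ℕ) + (j : ℕ)) 1 else 0)
    + ∑ i ∈ D, Finsupp.single (2, (i : ℕ)) 1
  coins := 0

/-- The output: the number in cell `0` of array `0` at the end. -/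
def Config.output (s : Config) : ℕ := s.store (0, 0)

/-- `Computes ω p s y t m`: with the random bits `ω`, the program `p` started in `s` halts with
output `y`, in time `t` and space `m`. -/
def Computes (ω : ℕ → Bool) (p : Prog) (s : Config) (y t m : ℕ) : Prop :=
  ∃ s' : Config, Exec ω p s s' t m ∧ s'.output = y

/-- The law of an infinite sequence of independent fair random bits. -/
noncomputable def coinMeasure : MeasureTheory.Measure (ℕ → Bool) :=
  MeasureTheory.Measure.infinitePi fun _ => (PMF.uniformOfFintype Bool).toMeasure

end RAM

/-!
Let `k` be the maximum degree of `G`. By Vizing's theorem the chromatic index is `k` or `k + 1` (and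
`1` if `k = 0`), so the algorithm only has to recognize the existence of a proper edge colouring
with `k` colours. It does so by testing whether a certain polynomial vanishes at a random point; as
the zero polynomial vanishes everywhere, the error is one-sided.

*Reduction to the sieved edges.* Choose for every vertex outside the dominating set `D` a neighbour
inside it. The `n - |D|` chosen edges are left out, and the other `r = m - n + |D|` edges are
sieved. Suppose that sets of edges `M t`, one matching for each colour `t`, use every sieved edge at
least once, and that every vertex `v` lies on exactly `deg v` edges of these matchings in total,
counted with multiplicity. If every sieved edge is used exactly once, then so is every other edge:
at a vertex outside `D` all edges but the chosen one are sieved, so the degree condition determines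
the multiplicity of the chosen one (`IsCover.exists_properOn`). Conversely a proper colouring gives
such a family of matchings (`ProperOn.exists_isCover`).

*Matchings as determinants.* The degree condition is expressed in a blow-up of `G` that has a copy
of `G` for every colour, and `k - deg v` dummy vertices for each `v` that absorb the copies of `v`
left unmatched. In characteristic two the determinant of a symmetric matrix with unit diagonal and
off-diagonal entries `y s(p, q) * X ^ w` is the sum of the weights of all matchings
(`Matrix.IsSymm.det_eq_sum_involutions`). Summing over all `2 ^ r` sets of sieved edges cancels the
matchings that avoid some sieved edge (`sum_range_testBit`), and the exponents of `X` count the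
sieved and the other edges in a matching; in one block of coefficients exactly the matchings remain
that correspond to colourings (`exists_coeff_ne_zero_iff`). This block is the value of a multilinear
polynomial `coverPoly` in the weights `y`, which is nonzero precisely if there is a colouring. If
the weights are polynomials over `ZMod 2` with random coefficients, then by the Schwartz–Zippel
lemma a nonzero polynomial vanishes with small probability (`coinMeasure_eval_eq_zero_le`).

*Arithmetic.* The determinants are computed modulo a power of `X` by Gaussian elimination over power
series: all matrices are the identity modulo `X`, so every pivot is a unit and no pivoting is needed
(`prod_gaussIter_eq_det`). A power series modulo `X ^ n` is stored as one number, its coefficients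
being the digits in a large power of two; then addition is a bitwise exclusive or, and
multiplication is one multiplication of numbers followed by a mask that reduces the digits modulo
two (`enc_add`, `enc_mul`).

*Machine.* `Runs E p n Q s` is a total correctness statement with a bound on the number of steps;
with `Runs.seq` and `Runs.for` it is established for each part of the program in turn, ending with
`runs_mainProg`. As all numbers have polynomially many bits and all indices are polynomially
bounded, a bound on the number of steps gives the bounds on the bit costs.
-/
/-! ### Vizing's theorem -/

section Vizing

variable {V K : Type*}

/-- The colouring `c` of all pairs of vertices is proper on the edges of `H`. Colouring pairs rather
than edges lets `H` grow while the colouring is kept. -/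
def ProperOn (H : SimpleGraph V) (c : Sym2 V → K) : Prop :=
  ∀ ⦃u v w : V⦄, H.Adj u v → H.Adj u w → c s(u, v) = c s(u, w) → v = w

/-- No edge of `H` at `v` has colour `a`. -/
def Misses (H : SimpleGraph V) (c : Sym2 V → K) (v : V) (a : K) : Prop :=
  ∀ w, H.Adj v w → c s(v, w) ≠ a

/-- A Vizing fan at `x`: distinct vertices `y 0, …, y k` such that `y 1, …, y k` are neighbours of
`x` and the colour of the edge from `x` to `y (i + 1)` is missing at `y i`. -/
structure IsFan (H : SimpleGraph V) (c : Sym2 V → K) (x : V) (y : ℕ → V) (k : ℕ) : Prop where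
  inj : ∀ i ≤ k, ∀ j ≤ k, y i = y j → i = j
  adj : ∀ i < k, H.Adj x (y (i + 1))
  miss : ∀ i < k, Misses H c (y i) (c s(x, y (i + 1)))

/-- An edge `xy`, coloured or not, may receive any colour that is missing at both of its ends. -/
theorem ProperOn.recolor [DecidableEq V] {H H' : SimpleGraph V} {c : Sym2 V → K} {x y : V} {a : K}
    (hc : ProperOn H c) (hx : Misses H c x a) (hy : Misses H c y a)
    (hH : ∀ u v, H'.Adj u v → H.Adj u v ∨ s(u, v) = s(x, y)) :
    ProperOn H' (Function.update c s(x, y) a) := by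
  intro u v w huv huw h
  have key : ∀ u v, s(u, v) = s(x, y) → ∀ w, H.Adj u w → c s(u, w) ≠ a := by
    intro u v he w hw
    rcases Sym2.eq_iff.1 he with ⟨rfl, rfl⟩ | ⟨rfl, rfl⟩
    · exact hx w hw
    · exact hy w hw
  by_cases h1 : s(u, v) = s(x, y) <;> by_cases h2 : s(u, w) = s(x, y)
  · exact Sym2.congr_right.1 (h1.trans h2.symm)
  · rw [h1, Function.update_self, Function.update_of_ne h2] at h
    exact absurd h.symm (key u v h1 w ((hH _ _ huw).resolve_right h2))
  · rw [h2, Function.update_self, Function.update_of_ne h1] at h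
    exact absurd h (key u w h2 v ((hH _ _ huv).resolve_right h1))
  · rw [Function.update_of_ne h1, Function.update_of_ne h2] at h
    exact hc ((hH _ _ huv).resolve_right h1) ((hH _ _ huw).resolve_right h2) h

/-- If a colour is missing both at the centre and at the last vertex of a fan, shifting the colours
along the fan frees a colour for the uncoloured edge `x y₀`. -/
theorem IsFan.rotate [DecidableEq V] {H : SimpleGraph V} {x : V} {y : ℕ → V} (hx : x ≠ y 0)
    (k : ℕ) :
    ∀ (c : Sym2 V → K) (a : K), ProperOn H c → IsFan H c x y k → Misses H c x a →
      Misses H c (y k) a →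
      ∃ c' : Sym2 V → K, ProperOn (H ⊔ SimpleGraph.edge x (y 0)) c' := by
  induction k with
  | zero =>
    intro c a hc _ hxa hya
    refine ⟨_, hc.recolor hxa hya fun u v h => ?_⟩
    rw [SimpleGraph.sup_adj, SimpleGraph.edge_adj] at h
    rcases h with h | h
    · exact .inl h
    · exact .inr (by rw [Sym2.eq_iff]; tauto)
  | succ k ih =>
    intro c a hc hf hxa hya
    have hadj := hf.adj k (Nat.lt_succ_self k)
    have hne : ∀ i ≤ k, y i ≠ y (k + 1) := fun i hi h => by
      have := hf.inj i (by omega) (k + 1) le_rfl h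
      omega
    have hxy : ∀ i ≤ k, y i ≠ x := by
      intro i hi
      cases i with
      | zero => exact hx.symm
      | succ i => exact (hf.adj i (by omega)).ne'
    have hupd : ∀ i ≤ k, ∀ w, Function.update c s(x, y (k + 1)) a s(y i, w) = c s(y i, w) := by
      intro i hi w
      refine Function.update_of_ne ?_ _ _
      intro h
      rcases Sym2.eq_iff.1 h with h | h
      · exact hxy i hi h.1
      · exact hne i hi h.1
    have hmiss : ∀ i ≤ k, ∀ b, Misses H c (y i) b →
        Misses H (Function.update c s(x, y (k + 1)) a) (y i) b := by
      intro i hi b h w hw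
      rw [hupd i hi]
      exact h w hw
    -- Recolour the last edge of the fan with `a`; its old colour becomes missing at `x`, and it is
    -- missing at `y k`, so the shorter fan can be rotated.
    refine ih (Function.update c s(x, y (k + 1)) a) (c s(x, y (k + 1))) (hc.recolor hxa hya ?_)
      ⟨fun i hi j hj => hf.inj i (by omega) j (by omega), fun i hi => hf.adj i (by omega), ?_⟩ ?_ ?_
    · exact fun u v h => .inl h
    · intro i hi
      have : Function.update c s(x, y (k + 1)) a s(x, y (i + 1)) = c s(x, y (i + 1)) := by
        rw [Sym2.eq_swap (a := x) (b := y (i + 1)), hupd (i + 1) hi]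
      rw [this]
      exact hmiss i (by omega) _ (hf.miss i (by omega))
    · intro w hw
      by_cases hwk : w = y (k + 1)
      · subst hwk
        rw [Function.update_self]
        exact (hxa _ hadj).symm
      · rw [Function.update_of_ne fun h => hwk (Sym2.congr_right.1 h)]
        exact fun h => hwk (hc hw hadj h)
    · exact hmiss k le_rfl _ (hf.miss k (Nat.lt_succ_self k))

/-- The edges of `H` coloured `α` or `β`. -/
def kempe (H : SimpleGraph V) (c : Sym2 V → K) (α β : K) : SimpleGraph V where
  Adj u v := H.Adj u v ∧ (c s(u, v) = α ∨ c s(u, v) = β)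
  symm := ⟨fun u v h => ⟨h.1.symm, by rw [Sym2.eq_swap]; exact h.2⟩⟩
  loopless := ⟨fun u h => h.1.ne rfl⟩

open Classical in
/-- Exchange `α` and `β` on the Kempe chain of `r`. -/
noncomputable def kempeSwap (H : SimpleGraph V) (c : Sym2 V → K) (α β : K) (r : V) :
    Sym2 V → K :=
  fun e => if ∃ u ∈ e, (kempe H c α β).Reachable r u then Equiv.swap α β (c e) else c e

open Classical in
theorem kempeSwap_adj [DecidableEq K] {H : SimpleGraph V} {c : Sym2 V → K} {α β : K} {r u v : V}
    (h : H.Adj u v) : kempeSwap H c α β r s(u, v) =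
      if (kempe H c α β).Reachable r u then Equiv.swap α β (c s(u, v)) else c s(u, v) := by
  have hsw : ∀ e, kempeSwap H c α β r e =
      if ∃ u ∈ e, (kempe H c α β).Reachable r u then Equiv.swap α β (c e) else c e := by
    intro e
    unfold kempeSwap
    congr!
  rw [hsw]
  by_cases hu : (kempe H c α β).Reachable r u
  · rw [if_pos hu, if_pos ⟨u, Sym2.mem_mk_left u v, hu⟩]
  · rw [if_neg hu]
    split_ifs with hex
    · obtain ⟨w, hw, hwr⟩ := hex
      rcases Sym2.mem_iff.1 hw with rfl | rfl
      · exact absurd hwr hu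
      · refine Equiv.swap_apply_of_ne_of_ne (fun hα => hu ?_) (fun hβ => hu ?_)
        · exact hwr.trans (SimpleGraph.Adj.reachable (G := kempe H c α β) ⟨h, .inl hα⟩).symm
        · exact hwr.trans (SimpleGraph.Adj.reachable (G := kempe H c α β) ⟨h, .inr hβ⟩).symm
    · rfl

theorem ProperOn.swap_chain {H : SimpleGraph V} {c : Sym2 V → K} (hc : ProperOn H c) (α β : K)
    (r : V) : ProperOn H (kempeSwap H c α β r) := by
  classical
  intro u v w huv huw h
  rw [kempeSwap_adj huv, kempeSwap_adj huw] at h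
  split_ifs at h with hr
  · exact hc huv huw ((Equiv.swap α β).injective h)
  · exact hc huv huw h

theorem misses_kempeSwap_of_not {H : SimpleGraph V} {c : Sym2 V → K} {α β a : K} {r v : V}
    (hr : ¬ (kempe H c α β).Reachable r v) :
    Misses H (kempeSwap H c α β r) v a ↔ Misses H c v a := by
  classical
  refine forall₂_congr fun w hw => ?_
  rw [kempeSwap_adj hw, if_neg hr]

theorem misses_kempeSwap_of_reachable [DecidableEq K] {H : SimpleGraph V} {c : Sym2 V → K}
    {α β a : K} {r v : V}
    (hr : (kempe H c α β).Reachable r v) :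
    Misses H (kempeSwap H c α β r) v a ↔ Misses H c v (Equiv.swap α β a) := by
  refine forall₂_congr fun w hw => ?_
  rw [kempeSwap_adj hw, if_pos hr, Ne, Ne, Equiv.swap_apply_eq_iff]

/-- A Kempe chain has maximum degree two, so it is a path or a cycle and has at most two vertices
that miss one of its two colours. -/
theorem ProperOn.not_reachable [Finite V] {H : SimpleGraph V} {c : Sym2 V → K}
    (hc : ProperOn H c) {α β : K} {x y z : V} (hxy : x ≠ y) (hxz : x ≠ z) (hyz : y ≠ z)
    (hx : Misses H c x α) (hy : Misses H c y β) (hz : Misses H c z β)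
    (hry : (kempe H c α β).Reachable x y) : ¬ (kempe H c α β).Reachable x z := by
  classical
  cases nonempty_fintype V
  intro hrz
  set C := (kempe H c α β).connectedComponentMk x
  have hconn : C.toSimpleGraph.Connected := C.connected_toSimpleGraph
  have hle := hconn.card_vert_le_card_edgeSet_add_one
  have hsum := C.toSimpleGraph.sum_degrees_eq_twice_card_edges
  -- A connected graph on `n` vertices has at least `n - 1` edges, hence degree sum at least
  -- `2 n - 2`; with three vertices of degree at most one the sum is at most `2 n - 3`.
  have hdeg : ∀ (v : C) (S : Finset K), (∀ w, (kempe H c α β).Adj v w → c s(↑v, w) ∈ S) →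
      C.toSimpleGraph.degree v ≤ S.card := by
    intro v S hS
    rw [← SimpleGraph.card_neighborFinset_eq_degree]
    refine Finset.card_le_card_of_injOn (fun w => c s(↑v, ↑w)) ?_ ?_
    · intro w hw
      have hw' : C.toSimpleGraph.Adj v w := by simpa using hw
      exact hS _ hw'
    · intro w hw w' hw' h
      have h1 : C.toSimpleGraph.Adj v w := by simpa using hw
      have h2 : C.toSimpleGraph.Adj v w' := by simpa using hw'
      have h1' : (kempe H c α β).Adj v w := h1
      have h2' : (kempe H c α β).Adj v w' := h2
      exact Subtype.ext (hc h1'.1 h2'.1 h)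
  have hdeg2 : ∀ v : C, C.toSimpleGraph.degree v ≤ 2 := fun v =>
    (hdeg v {α, β} fun w hw => by simpa using hw.2).trans Finset.card_le_two
  have hdα : ∀ v : C, Misses H c v α → C.toSimpleGraph.degree v ≤ 1 := fun v hv =>
    (hdeg v {β} fun w hw => by simpa using hw.2.resolve_left (hv w hw.1)).trans
      (Finset.card_singleton β).le
  have hdβ : ∀ v : C, Misses H c v β → C.toSimpleGraph.degree v ≤ 1 := fun v hv =>
    (hdeg v {α} fun w hw => by simpa using hw.2.resolve_right (hv w hw.1)).trans
      (Finset.card_singleton α).le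
  have hxC : x ∈ C := SimpleGraph.ConnectedComponent.connectedComponentMk_mem
  have hyC : y ∈ C := SimpleGraph.ConnectedComponent.sound hry.symm
  have hzC : z ∈ C := SimpleGraph.ConnectedComponent.sound hrz.symm
  set T : Finset C := {⟨x, hxC⟩, ⟨y, hyC⟩, ⟨z, hzC⟩}
  have hT : T.card = 3 := Finset.card_eq_three.2
    ⟨_, _, _, by simpa using hxy, by simpa using hxz, by simpa using hyz, rfl⟩
  have h1 : ∑ v ∈ T, C.toSimpleGraph.degree v ≤ 3 := by
    refine (Finset.sum_le_card_nsmul T _ 1 ?_).trans (by simp [hT])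
    intro v hv
    simp only [T, Finset.mem_insert, Finset.mem_singleton] at hv
    rcases hv with rfl | rfl | rfl
    · exact hdα _ hx
    · exact hdβ _ hy
    · exact hdβ _ hz
  have h2 : ∑ v ∈ Tᶜ, C.toSimpleGraph.degree v ≤ Tᶜ.card * 2 := by
    simpa using Finset.sum_le_card_nsmul Tᶜ _ 2 fun v _ => hdeg2 v
  have h3 := Finset.sum_add_sum_compl T fun v => C.toSimpleGraph.degree v
  have h4 := Finset.card_add_card_compl T
  have h5 : Nat.card C.toSimpleGraph.edgeSet = C.toSimpleGraph.edgeFinset.card := by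
    rw [Nat.card_eq_fintype_card, SimpleGraph.edgeFinset_card]
  have h6 : Nat.card C = Fintype.card C := Nat.card_eq_fintype_card
  change Nat.card C ≤ _ at hle
  omega

theorem exists_misses [Finite V] [Fintype K] {H : SimpleGraph V} (c : Sym2 V → K) (v : V)
    (hd : (H.neighborSet v).ncard < Fintype.card K) : ∃ a, Misses H c v a := by
  classical
  by_contra! h
  simp only [Misses, not_forall, not_not] at h
  choose w hw hc using h
  have : (Set.univ : Set K).ncard ≤ (H.neighborSet v).ncard := by
    refine Set.ncard_le_ncard_of_injOn w (fun a _ => hw a) (fun a _ b _ hab => ?_)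
      (Set.toFinite _)
    rw [← hc a, ← hc b, hab]
  rw [Set.ncard_univ, Nat.card_eq_fintype_card] at this
  omega

/-- Vizing's extension step: a proper colouring with more colours than every degree extends to one
more edge. -/
theorem ProperOn.exists_extend [Finite V] [Fintype K] {H : SimpleGraph V} {c : Sym2 V → K}
    (hc : ProperOn H c) (hd : ∀ v, (H.neighborSet v).ncard < Fintype.card K) {x y₀ : V}
    (hxy : x ≠ y₀) (hn : ¬ H.Adj x y₀) :
    ∃ c' : Sym2 V → K, ProperOn (H ⊔ SimpleGraph.edge x y₀) c' := by
  classical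
  cases nonempty_fintype V
  by_contra hno
  obtain ⟨α, hα⟩ := exists_misses c x (hd x)
  -- Without an extension every fan could be prolonged, beyond the number of vertices.
  have hfan : ∀ k, ∃ y : ℕ → V, y 0 = y₀ ∧ IsFan H c x y k := by
    intro k
    induction k with
    | zero =>
      exact ⟨fun _ => y₀, rfl, fun i hi j hj _ => by omega, fun i hi => by omega,
        fun i hi => by omega⟩
    | succ k ih =>
      obtain ⟨y, hy0, hf⟩ := ih
      have hx0 : x ≠ y 0 := hy0 ▸ hxy
      have hrot : ∀ j c' a, ProperOn H c' → IsFan H c' x y j → Misses H c' x a →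
          ¬ Misses H c' (y j) a := fun j c' a h1 h2 h3 h4 =>
        hno (hy0 ▸ IsFan.rotate hx0 j c' a h1 h2 h3 h4)
      obtain ⟨β, hβ⟩ := exists_misses c (y k) (hd (y k))
      have hxβ : ¬ Misses H c x β := fun h => hrot k c β hc hf h hβ
      have hαβ : α ≠ β := fun h => hxβ (h ▸ hα)
      simp only [Misses, not_forall, not_not] at hxβ
      obtain ⟨z, hxz, hzβ⟩ := hxβ
      by_cases hz : ∃ j ≤ k, z = y j
      · exfalso
        obtain ⟨j, hj, rfl⟩ := hz
        obtain ⟨i, rfl⟩ : ∃ i, j = i + 1 := by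
          cases j with
          | zero => exact absurd (hy0 ▸ hxz) hn
          | succ i => exact ⟨i, rfl⟩
        have hiβ : Misses H c (y i) β := hzβ ▸ hf.miss i (by omega)
        have hne : ∀ l ≤ k, x ≠ y l := by
          intro l hl
          cases l with
          | zero => exact hx0
          | succ l => exact (hf.adj l (by omega)).ne
        -- Links of the fan with colours other than `α`, `β` survive every Kempe change away
        -- from `x`.
        have hcol : ∀ l < k, c s(x, y (l + 1)) ≠ α := fun l hl => hα _ (hf.adj l hl)
        have hcolβ : ∀ l < k, l ≠ i → c s(x, y (l + 1)) ≠ β := by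
          intro l hl hli h
          have := hf.inj (l + 1) (by omega) (i + 1) (by omega)
            (hc (hf.adj l hl) hxz (h.trans hzβ.symm))
          omega
        have hkeep : ∀ (r : V), ¬ (kempe H c α β).Reachable r x → ∀ j ≤ k,
            (∀ l < j, l = i → ¬ (kempe H c α β).Reachable r (y l)) →
            IsFan H (kempeSwap H c α β r) x y j := by
          intro r hr j hj hl
          refine ⟨fun a ha b hb => hf.inj a (by omega) b (by omega),
            fun l hl => hf.adj l (by omega), fun l hlj => ?_⟩
          rw [kempeSwap_adj (hf.adj l (by omega)), if_neg hr]
          by_cases hrl : (kempe H c α β).Reachable r (y l)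
          · rw [misses_kempeSwap_of_reachable hrl, Equiv.swap_apply_of_ne_of_ne
              (hcol l (by omega)) (hcolβ l (by omega) fun h => hl l hlj h hrl)]
            exact hf.miss l (by omega)
          · rw [misses_kempeSwap_of_not hrl]
            exact hf.miss l (by omega)
        have hend : ∀ (j : ℕ), Misses H c (y j) β →
            Misses H (kempeSwap H c α β (y j)) (y j) α := by
          intro j h
          rw [misses_kempeSwap_of_reachable (SimpleGraph.Reachable.refl _),
            Equiv.swap_apply_left]
          exact h
        by_cases hri : (kempe H c α β).Reachable x (y i)
        -- The chain of `x` ends at `y i` and so avoids `y k`: swap the chain of `y k`. It contains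
        -- neither `x` nor `y i`, and the whole fan survives.
        · have hik : y i ≠ y k := fun h => by
            have := hf.inj i (by omega) k le_rfl h
            omega
          have hrk := hc.not_reachable (hne i (by omega)) (hne k le_rfl) hik hα hiβ hβ hri
          refine hrot k _ α (hc.swap_chain α β (y k))
            (hkeep (y k) (fun h => hrk h.symm) k le_rfl ?_) ?_ (hend k hβ)
          · rintro l - rfl h
            exact hrk (hri.trans h.symm)
          · rwa [misses_kempeSwap_of_not fun h => hrk h.symm]
        -- The chain of `y i` avoids `x`: swap it; the fan survives up to `y i`.
        · refine hrot i _ α (hc.swap_chain α β (y i))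
            (hkeep (y i) (fun h => hri h.symm) i (by omega) (by omega)) ?_ (hend i hiβ)
          rwa [misses_kempeSwap_of_not fun h => hri h.symm]
      · push Not at hz
        refine ⟨fun l => if l ≤ k then y l else z, by simpa using hy0, ?_, ?_, ?_⟩
        · intro a ha b hb hab
          split_ifs at hab with h1 h2 h2
          · exact hf.inj a h1 b h2 hab
          · exact absurd hab.symm (hz a h1)
          · exact absurd hab (hz b h2)
          · omega
        · intro l hl
          split_ifs with h
          · exact hf.adj l (by omega)
          · exact hxz
        · intro l hl
          rw [if_pos (show l ≤ k by omega)]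
          split_ifs with h
          · exact hf.miss l (by omega)
          · have : l = k := by omega
            rw [hzβ, this]
            exact hβ
  obtain ⟨y, -, hf⟩ := hfan (Fintype.card V)
  have := Fintype.card_le_of_injective (fun i : Fin (Fintype.card V + 1) => y i)
    fun i j hij => Fin.ext (hf.inj i (by omega) j (by omega) hij)
  simp at this

/-- **Vizing's theorem**: more colours than the maximum degree suffice. -/
theorem exists_properOn [Finite V] [Fintype K] (G : SimpleGraph V)
    (hd : ∀ v, (G.neighborSet v).ncard < Fintype.card K) :
    ∃ c : Sym2 V → K, ProperOn G c := by
  classical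
  cases nonempty_fintype V
  have key : ∀ (m : ℕ) (H : SimpleGraph V), H.edgeSet.ncard = m →
      (∀ v, (H.neighborSet v).ncard < Fintype.card K) → ∃ c : Sym2 V → K, ProperOn H c := by
    intro m
    induction m with
    | zero =>
      intro H hH hd
      have hbot : H = ⊥ := by
        rw [← SimpleGraph.edgeSet_eq_empty]
        exact (Set.ncard_eq_zero (Set.toFinite _)).1 hH
      subst hbot
      cases isEmpty_or_nonempty V with
      | inl h => exact ⟨fun e => isEmptyElim e, fun u => h.elim u⟩
      | inr h =>
        have : 0 < Fintype.card K := (Nat.zero_le _).trans_lt (hd h.some)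
        have := Fintype.card_pos_iff.1 this
        exact ⟨fun _ => this.some, fun u v w h => absurd h (by simp)⟩
    | succ m ih =>
      intro H hH hd
      obtain ⟨e, he⟩ : H.edgeSet.Nonempty := Set.nonempty_of_ncard_ne_zero (by omega)
      induction e using Sym2.ind with
      | _ x y =>
      have hadj : H.Adj x y := he
      have hle : H.deleteEdges {s(x, y)} ≤ H := SimpleGraph.deleteEdges_le _
      have hd' : ∀ v, ((H.deleteEdges {s(x, y)}).neighborSet v).ncard < Fintype.card K :=
        fun v => (Set.ncard_le_ncard (fun w hw => hle hw) (Set.toFinite _)).trans_lt (hd v)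
      obtain ⟨c, hc⟩ := ih (H.deleteEdges {s(x, y)}) (by
        rw [SimpleGraph.edgeSet_deleteEdges, Set.ncard_sdiff_singleton_of_mem he, hH]
        rfl) hd'
      obtain ⟨c', hc'⟩ := hc.exists_extend hd' hadj.ne (by simp)
      refine ⟨c', fun u v w huv huw h => hc' ?_ ?_ h⟩
      all_goals
        rw [SimpleGraph.sup_adj, SimpleGraph.deleteEdges_adj, SimpleGraph.edge_adj]
        simp only [Set.mem_singleton_iff, Sym2.eq_iff]
      · have := huv.ne
        tauto
      · have := huw.ne
        tauto
  exact key _ G rfl hd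

end Vizing

/-! ### The chromatic index -/

section ChromaticIndex

variable {V : Type*}

theorem exists_isProperEdgeColoring_iff {K : Type*} (G : SimpleGraph V) [Nonempty K] :
    (∃ C : G.EdgeLabeling K, IsProperEdgeColoring G C) ↔ ∃ c : Sym2 V → K, ProperOn G c := by
  classical
  constructor
  · rintro ⟨C, hC⟩
    refine ⟨fun e => if h : e ∈ G.edgeSet then C ⟨e, h⟩ else Classical.arbitrary K,
      fun u v w huv huw h => ?_⟩
    beta_reduce at h
    rw [dif_pos (show s(u, v) ∈ G.edgeSet from huv),
      dif_pos (show s(u, w) ∈ G.edgeSet from huw)] at h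
    by_contra hvw
    refine hC _ _ (fun he => hvw ?_) ⟨u, Sym2.mem_mk_left u v, Sym2.mem_mk_left u w⟩ h
    exact Sym2.congr_right.1 (congrArg Subtype.val he)
  · rintro ⟨c, hc⟩
    refine ⟨fun e => c e, ?_⟩
    rintro ⟨e, he⟩ ⟨f, hf⟩ hne ⟨v, hve, hvf⟩ h
    obtain ⟨a, rfl⟩ := Sym2.mem_iff_exists.1 hve
    obtain ⟨b, rfl⟩ := Sym2.mem_iff_exists.1 hvf
    exact hne (Subtype.ext (congrArg (fun x => s(v, x)) (hc he hf h)))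

variable [Fintype V] (G : SimpleGraph V) [DecidableRel G.Adj]

theorem maxDegree_le_of_isProperEdgeColoring {k : ℕ} (C : G.EdgeLabeling (Fin k))
    (hC : IsProperEdgeColoring G C) : G.maxDegree ≤ k := by
  refine G.maxDegree_le_of_forall_degree_le k fun v => ?_
  rw [← G.card_neighborSet_eq_degree v]
  refine (Fintype.card_le_of_injective (fun w : G.neighborSet v => C ⟨s(v, ↑w), w.2⟩)
    fun w w' h => ?_).trans (Fintype.card_fin k).le
  by_contra hne
  refine hC _ _ (fun he => hne ?_) ⟨v, Sym2.mem_mk_left _ _, Sym2.mem_mk_left _ _⟩ h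
  exact Subtype.ext (Sym2.congr_right.1 (congrArg Subtype.val he))

theorem chromaticIndex_eq_one_of_maxDegree_eq_zero (h : G.maxDegree = 0) :
    chromaticIndex G = 1 := by
  have hG : ∀ u v, ¬ G.Adj u v := fun u v huv => by
    have h1 := (G.degree_pos_iff_exists_adj u).2 ⟨v, huv⟩
    have h2 := G.degree_le_maxDegree u
    omega
  refine le_antisymm (Nat.sInf_le ⟨one_pos, fun _ => 0, ?_⟩) (le_csInf ?_ fun k hk => hk.1)
  · rintro ⟨e, he⟩
    induction e using Sym2.ind with
    | _ x y => exact absurd he (hG x y)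
  · refine ⟨1, one_pos, fun _ => 0, ?_⟩
    rintro ⟨e, he⟩
    induction e using Sym2.ind with
    | _ x y => exact absurd he (hG x y)

theorem chromaticIndex_eq_maxDegree (h : 0 < G.maxDegree)
    (hc : ∃ c : Sym2 V → Fin G.maxDegree, ProperOn G c) : chromaticIndex G = G.maxDegree := by
  have : Nonempty (Fin G.maxDegree) := ⟨⟨0, h⟩⟩
  have hmem := (exists_isProperEdgeColoring_iff (K := Fin G.maxDegree) G).2 hc
  refine le_antisymm (Nat.sInf_le ⟨h, hmem⟩) (le_csInf ⟨_, h, hmem⟩ ?_)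
  rintro k ⟨-, C, hC⟩
  exact maxDegree_le_of_isProperEdgeColoring G C hC

theorem chromaticIndex_eq_maxDegree_add_one
    (hc : ¬ ∃ c : Sym2 V → Fin G.maxDegree, ProperOn G c) (h : 0 < G.maxDegree) :
    chromaticIndex G = G.maxDegree + 1 := by
  have hmem : ∃ C : G.EdgeLabeling (Fin (G.maxDegree + 1)), IsProperEdgeColoring G C := by
    refine (exists_isProperEdgeColoring_iff G).2 (exists_properOn G fun v => ?_)
    rw [Set.ncard_eq_toFinset_card', Set.toFinset_card, G.card_neighborSet_eq_degree,
      Fintype.card_fin]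
    exact Nat.lt_succ_of_le (G.degree_le_maxDegree v)
  refine le_antisymm (Nat.sInf_le ⟨Nat.succ_pos _, hmem⟩)
    (le_csInf ⟨_, Nat.succ_pos _, hmem⟩ ?_)
  rintro k ⟨-, C, hC⟩
  rcases (maxDegree_le_of_isProperEdgeColoring G C hC).lt_or_eq with hlt | rfl
  · exact hlt
  · have : Nonempty (Fin G.maxDegree) := ⟨⟨0, h⟩⟩
    exact absurd ((exists_isProperEdgeColoring_iff G).1 ⟨C, hC⟩) hc

end ChromaticIndex

/-! ### Symmetric determinants in characteristic two -/

section CharTwo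

variable {R : Type*} [CommRing R] [CharP R 2]

/-- In characteristic two the permutations `σ` and `σ⁻¹` contribute the same term to the determinant
of a symmetric matrix, so only the involutions, that is the matchings, survive. -/
theorem Matrix.IsSymm.det_eq_sum_involutions {I : Type*} [Fintype I] [DecidableEq I]
    {M : Matrix I I R} (hM : M.IsSymm) :
    M.det = ∑ σ : Equiv.Perm I with σ * σ = 1, ∏ i, M i (σ i) := by
  have hneg : ∀ x : R, x + x = 0 := CharTwo.add_self_eq_zero
  have hsign : ∀ (σ : Equiv.Perm I) (x : R), Equiv.Perm.sign σ • x = x := by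
    intro σ x
    rcases Int.units_eq_one_or (Equiv.Perm.sign σ) with h | h
    · simp [h]
    · rw [h, Units.neg_smul, one_smul, neg_eq_iff_add_eq_zero]
      exact hneg x
  have hdet : M.det = ∑ σ : Equiv.Perm I, ∏ i, M i (σ i) := by
    rw [Matrix.det_apply]
    refine Finset.sum_congr rfl fun σ _ => ?_
    rw [hsign]
    exact Finset.prod_congr rfl fun i _ => hM.apply _ _
  rw [hdet, ← Finset.sum_filter_add_sum_filter_not Finset.univ (fun σ => σ * σ = 1), add_eq_left]
  refine Finset.sum_involution (fun σ _ => σ⁻¹) ?_ ?_ ?_ ?_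
  · intro σ _
    have : ∏ i, M i (σ⁻¹ i) = ∏ i, M i (σ i) := by
      rw [← Equiv.prod_comp σ]
      refine Finset.prod_congr rfl fun i _ => ?_
      rw [Equiv.Perm.inv_def, Equiv.symm_apply_apply]
      exact hM.apply _ _
    rw [this]
    exact hneg _
  · intro σ hσ _ h
    rw [Finset.mem_filter] at hσ
    exact hσ.2 (by rw [← eq_inv_iff_mul_eq_one, h])
  · intro σ hσ
    rw [Finset.mem_filter] at hσ ⊢
    refine ⟨Finset.mem_univ _, fun h => hσ.2 ?_⟩
    simpa using congrArg (·⁻¹) h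
  · intro σ _
    exact inv_inv σ

open Classical in
/-- The number of `a < 2 ^ r` whose binary expansion contains `J` is odd only if `J` contains every
position below `r`: this is the inclusion–exclusion step. -/
theorem sum_range_testBit (r : ℕ) (J : Set ℕ) :
    ∑ a ∈ Finset.range (2 ^ r), (if ∀ j ∈ J, j < r → a.testBit j then (1 : R) else 0) =
      if ∀ j < r, j ∈ J then 1 else 0 := by
  split_ifs with hall
  · rw [Finset.sum_eq_single (2 ^ r - 1)]
    · rw [if_pos]
      intro j _ hj
      simp [Nat.testBit_two_pow_sub_one, hj]
    · intro a ha hne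
      rw [if_neg]
      intro h
      apply hne
      refine Nat.eq_of_testBit_eq fun j => ?_
      rw [Nat.testBit_two_pow_sub_one]
      by_cases hj : j < r
      · simp [hj, h j (hall j hj) hj]
      · rw [Nat.testBit_eq_false_of_lt]
        · simp [hj]
        · exact (Finset.mem_range.1 ha).trans_le (Nat.pow_le_pow_right two_pos (by omega))
    · intro h
      exact absurd (Finset.mem_range.2 (Nat.sub_lt (by positivity) one_pos)) h
  · push Not at hall
    obtain ⟨j, hj, hjJ⟩ := hall
    have hbit : ∀ a i, i ≠ j → (a ^^^ 2 ^ j).testBit i = a.testBit i := by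
      intro a i hi
      rw [Nat.testBit_xor, Nat.testBit_two_pow_of_ne hi.symm, Bool.xor_false]
    refine Finset.sum_involution (fun a _ => a ^^^ 2 ^ j) ?_ ?_ ?_ ?_
    · intro a _
      have : (∀ i ∈ J, i < r → (a ^^^ 2 ^ j).testBit i = true) ↔
          ∀ i ∈ J, i < r → a.testBit i = true := by
        refine forall₂_congr fun i hi => ?_
        rw [hbit a i fun h => hjJ (h ▸ hi)]
      simp only [this]
      exact CharTwo.add_self_eq_zero _
    · intro a _ _ h
      have := congrArg (fun x => x.testBit j) h
      simp [Nat.testBit_xor, Nat.testBit_two_pow_self] at this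
    · intro a ha
      rw [Finset.mem_range] at ha ⊢
      exact Nat.xor_lt_two_pow ha (Nat.pow_lt_pow_right one_lt_two hj)
    · intro a _
      rw [Nat.xor_assoc, Nat.xor_self, Nat.xor_zero]

end CharTwo

/-! ### The matching polynomial of the coloured blow-up -/

section Blowup

open Polynomial

variable {V : Type*} [Fintype V] [DecidableEq V] (G : SimpleGraph V) [DecidableRel G.Adj]

/-- The index set of the blow-up: a copy `inl (t, v)` of every vertex `v` for every colour `t`, and
`k` dummies `inr (j, v)` for every vertex `v`, of which those with `j + deg v < k` are used. -/
abbrev Idx (k : ℕ) (V : Type*) := (Fin k × V) ⊕ (Fin k × V)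

/-- Adjacency in the blow-up: each colour class carries a copy of `G`, and the active dummies of `v`
are joined to all copies of `v`. A perfect matching of the active indices
therefore uses exactly `deg v` edges at `v` in total. -/
def link {k : ℕ} : Idx k V → Idx k V → Prop
  | .inl (t, u), .inl (s, v) => t = s ∧ G.Adj u v
  | .inl (_, u), .inr (j, v) => u = v ∧ (j : ℕ) + G.degree u < k
  | .inr (j, v), .inl (_, u) => u = v ∧ (j : ℕ) + G.degree u < k
  | .inr _, .inr _ => False

/-- The links that are copies of edges from the sieved set `S`. -/
def sieveLink {k : ℕ} (S : V → V → Prop) : Idx k V → Idx k V → Prop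
  | .inl (t, u), .inl (s, v) => t = s ∧ S u v
  | _, _ => False

/-- The vertex of `G` underlying an index. -/
def Idx.vertex {k : ℕ} : Idx k V → V
  | .inl (_, v) => v
  | .inr (_, v) => v

omit [Fintype V] [DecidableEq V] [DecidableRel G.Adj] in
theorem sieveLink_symm {k : ℕ} {S : V → V → Prop} (hS : ∀ u v, S u v → S v u) {p q : Idx k V}
    (h : sieveLink S p q) : sieveLink S q p := by
  rcases p with ⟨t, u⟩ | ⟨t, u⟩ <;> rcases q with ⟨s, v⟩ | ⟨s, v⟩ <;>
    simp only [sieveLink] at h ⊢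
  exact ⟨h.1.symm, hS _ _ h.2⟩

omit [DecidableEq V] in
theorem link_symm {k : ℕ} {p q : Idx k V} (h : link G p q) : link G q p := by
  rcases p with ⟨t, u⟩ | ⟨t, u⟩ <;> rcases q with ⟨s, v⟩ | ⟨s, v⟩ <;>
    simp only [link] at h ⊢
  · exact ⟨h.1.symm, h.2.symm⟩
  · exact h
  · exact h

open Classical in
/-- The exponent of a link, in units of `L`: `Z + 1` for sieved links and `1` for the others. -/
noncomputable def linkWeight {k : ℕ} (S : V → V → Prop) (Z : ℕ) (p q : Idx k V) : ℕ :=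
  if sieveLink S p q then Z + 1 else 1

open Classical in
/-- The weighted adjacency matrix of the blow-up with unit diagonal, restricted to the sieved edges
`uv` for which bit `e u v` of `a` is set. -/
noncomputable def blowupMatrix {k : ℕ} (S : V → V → Prop) (e : V → V → ℕ) (Z L : ℕ)
    (y : Sym2 (Idx k V) → (ZMod 2)[X]) (a : ℕ) : Matrix (Idx k V) (Idx k V) (ZMod 2)[X] :=
  fun p q => if p = q then 1 else
    if link G p q ∧ (sieveLink S p q → a.testBit (e p.vertex q.vertex)) then
      y s(p, q) * X ^ (L * linkWeight S Z p q) else 0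

/-- Matchings of the blow-up, as involutions, that use every sieved edge at least once. -/
structure IsCover {k : ℕ} (S : V → V → Prop) (e : V → V → ℕ) (r : ℕ)
    (σ : Equiv.Perm (Idx k V)) : Prop where
  invol : σ * σ = 1
  links : ∀ i, σ i ≠ i → link G i (σ i)
  covers : ∀ j < r, ∃ i, sieveLink S i (σ i) ∧ e i.vertex (σ i).vertex = j

open Classical in
/-- The total exponent of a matching, each edge being counted from both ends. -/
noncomputable def coverWeight {k : ℕ} (S : V → V → Prop) (Z : ℕ) (σ : Equiv.Perm (Idx k V)) : ℕ :=
  ∑ i with σ i ≠ i, linkWeight S Z i (σ i)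

variable {G}

theorem blowupMatrix_isSymm {k : ℕ} {S : V → V → Prop} {e : V → V → ℕ} {Z L : ℕ}
    (hS : ∀ u v, S u v → S v u) (he : ∀ u v, e u v = e v u)
    (y : Sym2 (Idx k V) → (ZMod 2)[X]) (a : ℕ) : (blowupMatrix G S e Z L y a).IsSymm := by
  refine Matrix.IsSymm.ext fun p q => ?_
  have h1 : sieveLink S q p ↔ sieveLink S p q := ⟨sieveLink_symm hS, sieveLink_symm hS⟩
  have h2 : link G q p ↔ link G p q := ⟨link_symm G, link_symm G⟩
  unfold blowupMatrix linkWeight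
  rw [propext h1, propext h2, he q.vertex, Sym2.eq_swap (a := q)]
  simp only [eq_comm (a := q)]

open Classical in
/-- The sieve: summing over all subsets of the sieved edges leaves the matchings that use all of
them. -/
theorem sum_det_blowupMatrix {k : ℕ} {S : V → V → Prop} {e : V → V → ℕ} {r Z L : ℕ}
    (hS : ∀ u v, S u v → S v u) (he : ∀ u v, e u v = e v u) (her : ∀ u v, S u v → e u v < r)
    (hSG : ∀ u v, S u v → G.Adj u v)
    (y : Sym2 (Idx k V) → (ZMod 2)[X]) :
    ∑ a ∈ Finset.range (2 ^ r), (blowupMatrix G S e Z L y a).det =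
      ∑ σ : Equiv.Perm (Idx k V) with IsCover G S e r σ,
        (∏ i with σ i ≠ i, y s(i, σ i)) * X ^ (L * coverWeight S Z σ) := by
  have hne : ∀ i j : Idx k V, sieveLink S i j → j ≠ i := by
    rintro i j h rfl
    rcases j with ⟨t, u⟩ | ⟨t, u⟩
    · exact (hSG _ _ h.2).ne rfl
    · exact h
  have hlt : ∀ i j : Idx k V, sieveLink S i j → e i.vertex j.vertex < r := by
    rintro (⟨t, u⟩ | ⟨t, u⟩) (⟨s, v⟩ | ⟨s, v⟩) h
    · exact her _ _ h.2
    all_goals exact h.elim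
  simp only [(blowupMatrix_isSymm hS he y _).det_eq_sum_involutions]
  rw [Finset.sum_comm]
  have hprod : ∀ σ : Equiv.Perm (Idx k V), ∀ a, ∏ i, blowupMatrix G S e Z L y a i (σ i) =
      if ∀ i, σ i ≠ i → link G i (σ i) then
        (if ∀ j ∈ {j | ∃ i, sieveLink S i (σ i) ∧ e i.vertex (σ i).vertex = j}, j < r →
          a.testBit j then 1 else 0) *
        ((∏ i with σ i ≠ i, y s(i, σ i)) * X ^ (L * coverWeight S Z σ)) else 0 := by
    intro σ a
    by_cases h : (∀ i, σ i ≠ i → link G i (σ i)) ∧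
        ∀ i, sieveLink S i (σ i) → a.testBit (e i.vertex (σ i).vertex)
    · rw [if_pos h.1, if_pos, one_mul, coverWeight, Finset.mul_sum, ← Finset.prod_pow_eq_pow_sum,
        ← Finset.prod_mul_distrib, Finset.prod_filter]
      · refine Finset.prod_congr rfl fun i _ => ?_
        rw [blowupMatrix]
        by_cases hi : σ i = i
        · simp [hi]
        · rw [if_neg fun h => hi h.symm, if_pos ⟨h.1 i hi, h.2 i⟩, if_pos hi]
      · rintro _ ⟨i, hi, rfl⟩ -
        exact h.2 i hi
    · have hz : ∏ i, blowupMatrix G S e Z L y a i (σ i) = 0 := by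
        rw [not_and_or] at h
        push Not at h
        rcases h with ⟨i, hi, hl⟩ | ⟨i, hi, hb⟩
        · refine Finset.prod_eq_zero (Finset.mem_univ i) ?_
          rw [blowupMatrix, if_neg hi.symm, if_neg fun h => hl h.1]
        · refine Finset.prod_eq_zero (Finset.mem_univ i) ?_
          rw [blowupMatrix, if_neg (hne _ _ hi).symm, if_neg fun h => hb (h.2 hi)]
      rw [hz]
      split_ifs with h1 h2
      · exact absurd ⟨h1, fun i hi => h2 _ ⟨i, hi, rfl⟩ (hlt _ _ hi)⟩ h
      · rw [zero_mul]
      · rfl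
  rw [Finset.sum_filter, Finset.sum_filter]
  refine Finset.sum_congr rfl fun σ _ => ?_
  by_cases h1 : σ * σ = 1
  · rw [if_pos h1]
    simp only [hprod]
    by_cases h2 : ∀ i, σ i ≠ i → link G i (σ i)
    · simp only [if_pos h2]
      rw [← Finset.sum_mul, sum_range_testBit]
      by_cases h3 : ∀ j < r, j ∈ {j | ∃ i, sieveLink S i (σ i) ∧ e i.vertex (σ i).vertex = j}
      · rw [if_pos h3, if_pos ⟨h1, h2, h3⟩, one_mul]
      · rw [if_neg h3, if_neg fun h => h3 h.covers, zero_mul]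
    · simp only [if_neg h2]
      rw [if_neg fun h => h2 h.links, Finset.sum_const_zero]
  · rw [if_neg h1, if_neg fun h => h1 h.invol]

open Classical in
/-- The matchings of weight `T` as a multilinear polynomial with one variable for each pair of
indices. -/
noncomputable def coverPoly (G : SimpleGraph V) [DecidableRel G.Adj] (k : ℕ) (S : V → V → Prop)
    (e : V → V → ℕ) (r Z T : ℕ) : MvPolynomial (Sym2 (Idx k V)) (ZMod 2)[X] :=
  ∑ σ : Equiv.Perm (Idx k V) with IsCover G S e r σ ∧ coverWeight S Z σ = T,
    ∏ i with σ i ≠ i, MvPolynomial.X s(i, σ i)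

open Classical in
/-- The monomial of a matching determines the matching, so there is no cancellation. -/
theorem coverPoly_ne_zero {k : ℕ} {S : V → V → Prop} {e : V → V → ℕ} {r Z T : ℕ}
    {σ : Equiv.Perm (Idx k V)} (hσ : IsCover G S e r σ) (hT : coverWeight S Z σ = T) :
    coverPoly G k S e r Z T ≠ 0 := by
  let mon : Equiv.Perm (Idx k V) → (Sym2 (Idx k V) →₀ ℕ) := fun σ =>
    ∑ i with σ i ≠ i, Finsupp.single s(i, σ i) 1
  have hmem : ∀ (σ : Equiv.Perm (Idx k V)) (x : Sym2 (Idx k V)),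
      mon σ x ≠ 0 ↔ ∃ i, σ i ≠ i ∧ s(i, σ i) = x := by
    intro σ x
    simp only [mon, Finsupp.finsetSum_apply, ne_eq, Finset.sum_eq_zero_iff, Finsupp.single_apply,
      Finset.mem_filter, Finset.mem_univ, true_and, ite_eq_right_iff, one_ne_zero, imp_false,
      not_forall, not_not, exists_prop]
  have hinv : ∀ τ : Equiv.Perm (Idx k V), τ * τ = 1 → ∀ i, τ (τ i) = i := by
    intro τ h i
    rw [← Equiv.Perm.mul_apply, h, Equiv.Perm.one_apply]
  have hle : ∀ σ τ : Equiv.Perm (Idx k V), τ * τ = 1 → mon σ = mon τ →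
      ∀ i, σ i ≠ i → τ i = σ i := by
    intro σ τ hτ h i hi
    have h1 := (hmem σ s(i, σ i)).2 ⟨i, hi, rfl⟩
    rw [h] at h1
    obtain ⟨j, -, hjx⟩ := (hmem τ _).1 h1
    rcases Sym2.eq_iff.1 hjx with ⟨rfl, h2⟩ | ⟨rfl, h2⟩
    · exact h2
    · have h3 := congrArg τ h2
      rw [hinv τ hτ] at h3
      exact h3.symm
  have hinj : ∀ σ τ : Equiv.Perm (Idx k V), σ * σ = 1 → τ * τ = 1 → mon σ = mon τ → σ = τ := by
    intro σ τ hσ hτ h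
    refine Equiv.ext fun i => ?_
    by_cases h1 : σ i = i
    · by_cases h2 : τ i = i
      · rw [h1, h2]
      · exact hle τ σ hσ h.symm i h2
    · exact (hle σ τ hτ h i h1).symm
  have hmon : ∀ σ : Equiv.Perm (Idx k V), (∏ i with σ i ≠ i, MvPolynomial.X s(i, σ i) :
      MvPolynomial (Sym2 (Idx k V)) (ZMod 2)[X]) = MvPolynomial.monomial (mon σ) 1 := by
    intro σ
    simp only [mon]
    rw [MvPolynomial.monomial_sum_one]
    rfl
  intro h0
  have hc := congrArg (MvPolynomial.coeff (mon σ)) h0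
  rw [coverPoly, MvPolynomial.coeff_sum, Finset.sum_eq_single σ] at hc
  · simp [hmon] at hc
  · intro τ hτ hne
    rw [hmon, MvPolynomial.coeff_monomial, if_neg]
    exact fun h => hne (hinj _ _ (Finset.mem_filter.1 hτ).2.1.invol hσ.invol h)
  · exact fun h => absurd (Finset.mem_filter.2 ⟨Finset.mem_univ _, hσ, hT⟩) h

theorem totalDegree_coverPoly_le (k : ℕ) (S : V → V → Prop) (e : V → V → ℕ) (r Z T : ℕ) :
    (coverPoly G k S e r Z T).totalDegree ≤ Fintype.card (Idx k V) := by
  classical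
  refine MvPolynomial.totalDegree_finsetSum_le fun σ _ => ?_
  refine (MvPolynomial.totalDegree_finsetProd _ _).trans ?_
  refine (Finset.sum_le_card_nsmul _ _ 1 fun i _ => ?_).trans ?_
  · rw [MvPolynomial.totalDegree_X]
  · simpa using Finset.card_le_univ (Finset.univ.filter fun i => σ i ≠ i)

open Classical in
/-- As the weights have degree below `b`, the matchings of weight `T` occupy the window
`[L * T, L * T + L)` of the coefficients of the sieved sum, separated from all other matchings. -/
theorem exists_coeff_ne_zero_iff {k : ℕ} {S : V → V → Prop} {e : V → V → ℕ} {r Z L b : ℕ} (T : ℕ)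
    (hS : ∀ u v, S u v → S v u) (he : ∀ u v, e u v = e v u) (her : ∀ u v, S u v → e u v < r)
    (hSG : ∀ u v, S u v → G.Adj u v) (y : Sym2 (Idx k V) → (ZMod 2)[X])
    (hy : ∀ x, (y x).natDegree ≤ b) (hL : Fintype.card (Idx k V) * b < L) :
    (∃ j < L, (∑ a ∈ Finset.range (2 ^ r), (blowupMatrix G S e Z L y a).det).coeff (L * T + j) ≠ 0)
      ↔ MvPolynomial.eval y (coverPoly G k S e r Z T) ≠ 0 := by
  have hdeg : ∀ σ : Equiv.Perm (Idx k V), (∏ i with σ i ≠ i, y s(i, σ i)).natDegree < L := by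
    intro σ
    refine lt_of_le_of_lt ((Polynomial.natDegree_prod_le _ _).trans
      (Finset.sum_le_card_nsmul _ _ b fun i _ => hy _)) (lt_of_le_of_lt ?_ hL)
    exact Nat.mul_le_mul_right b (Finset.card_le_univ _)
  have heval : MvPolynomial.eval y (coverPoly G k S e r Z T) =
      ∑ σ : Equiv.Perm (Idx k V) with IsCover G S e r σ ∧ coverWeight S Z σ = T,
        ∏ i with σ i ≠ i, y s(i, σ i) := by
    simp [coverPoly, map_sum, map_prod]
  have hQ : (MvPolynomial.eval y (coverPoly G k S e r Z T)).degree < L := by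
    rw [heval]
    refine lt_of_le_of_lt (Polynomial.degree_sum_le _ _) ?_
    refine (Finset.sup_lt_iff (WithBot.bot_lt_coe L)).2 fun σ _ => ?_
    exact Polynomial.degree_le_natDegree.trans_lt (Nat.cast_lt.2 (hdeg σ))
  -- A matching of weight `w` contributes only to the coefficients from `L * w` to
  -- `L * w + L - 1`, and these windows are disjoint for different weights.
  have hcoeff : ∀ j < L,
      (∑ a ∈ Finset.range (2 ^ r), (blowupMatrix G S e Z L y a).det).coeff (L * T + j) =
        (MvPolynomial.eval y (coverPoly G k S e r Z T)).coeff j := by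
    intro j hj
    rw [sum_det_blowupMatrix hS he her hSG, heval, Polynomial.finsetSum_coeff,
      Polynomial.finsetSum_coeff, Finset.sum_filter, Finset.sum_filter]
    refine Finset.sum_congr rfl fun σ _ => ?_
    by_cases hσ : IsCover G S e r σ
    · rw [if_pos hσ, Polynomial.coeff_mul_X_pow']
      rcases lt_trichotomy (coverWeight S Z σ) T with h | h | h
      · have h1 : L * (coverWeight S Z σ + 1) ≤ L * T := Nat.mul_le_mul_left L h
        rw [mul_add, mul_one] at h1
        rw [if_pos (by omega), if_neg fun hh => h.ne hh.2]
        exact Polynomial.coeff_eq_zero_of_natDegree_lt ((hdeg σ).trans_le (by omega))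
      · rw [h, if_pos (Nat.le_add_right _ _), if_pos ⟨hσ, rfl⟩, Nat.add_sub_cancel_left]
      · have h1 : L * (T + 1) ≤ L * coverWeight S Z σ := Nat.mul_le_mul_left L h
        rw [mul_add, mul_one] at h1
        rw [if_neg (by omega), if_neg fun hh => h.ne' hh.2]
    · rw [if_neg hσ, if_neg fun h => hσ h.1]
  constructor
  · rintro ⟨j, hj, h⟩ h0
    rw [hcoeff j hj, h0] at h
    exact h (Polynomial.coeff_zero j)
  · intro h
    refine ⟨(MvPolynomial.eval y (coverPoly G k S e r Z T)).natDegree, ?_, ?_⟩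
    · exact (Polynomial.natDegree_lt_iff_degree_lt h).2 hQ
    · rw [hcoeff _ ((Polynomial.natDegree_lt_iff_degree_lt h).2 hQ)]
      exact Polynomial.leadingCoeff_ne_zero.2 h

end Blowup

/-! ### Matchings of the blow-up and edge colourings -/

section Blowup

variable {V : Type*} [Fintype V] [DecidableEq V] {G : SimpleGraph V} [DecidableRel G.Adj]

open Classical in
/-- The colours in which the matching `σ` uses the edge `uv`. -/
noncomputable def usedColors {k : ℕ} (σ : Equiv.Perm (Idx k V)) (u v : V) : Finset (Fin k) :=
  {t | σ (.inl (t, u)) = .inl (t, v)}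

open Classical in
/-- The indices that take part in the blow-up: all copies of vertices, and the active dummies. -/
noncomputable def activeIdx (G : SimpleGraph V) [DecidableRel G.Adj] (k : ℕ) :
    Finset (Idx k V) :=
  {p | match p with
    | .inl _ => True
    | .inr (j, v) => (j : ℕ) + G.degree v < k}

theorem card_filter_add_lt {k d : ℕ} : (Finset.univ.filter fun j : Fin k => (j : ℕ) + d < k).card =
    k - d := by
  rw [Finset.card_filter, Fin.sum_univ_eq_sum_range (fun j => if j + d < k then 1 else 0) k,
    ← Finset.card_filter]
  have : (Finset.range k).filter (fun j => j + d < k) = Finset.range (k - d) := by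
    ext j
    simp only [Finset.mem_filter, Finset.mem_range]
    omega
  rw [this, Finset.card_range]

omit [DecidableEq V] in
/-- There are `k` copies of each vertex `v` and `k - deg v` dummies. -/
theorem card_activeIdx {k : ℕ} (hk : ∀ v, G.degree v ≤ k) :
    (activeIdx G k).card + ∑ v, G.degree v = 2 * (k * Fintype.card V) := by
  classical
  have h1 : (activeIdx G k).card = k * Fintype.card V + ∑ v, (k - G.degree v) := by
    rw [activeIdx, Finset.card_filter, Fintype.sum_sum_type, Fintype.sum_prod_type_right,
      Fintype.sum_prod_type_right]
    congr 1
    · simp [mul_comm]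
    · refine Finset.sum_congr rfl fun v _ => ?_
      rw [← card_filter_add_lt, Finset.card_filter]
      refine Finset.sum_congr rfl fun j _ => ?_
      congr
  have h2 : ∑ v, (k - G.degree v) + ∑ v, G.degree v = k * Fintype.card V := by
    rw [← Finset.sum_add_distrib]
    simp [Nat.sub_add_cancel (hk _), mul_comm]
  omega

open Classical in
/-- Both sides count the uses of sieved edges by the matching `σ`, once per orientation. -/
theorem card_sieveLink {k : ℕ} {S : V → V → Prop} (σ : Equiv.Perm (Idx k V)) :
    (Finset.univ.filter fun i => sieveLink S i (σ i)).card =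
      ∑ x : V × V with S x.1 x.2, (usedColors σ x.1 x.2).card := by
  rw [Finset.card_eq_sum_card_fiberwise (f := fun i => (i.vertex, (σ i).vertex))
    (t := Finset.univ.filter fun x : V × V => S x.1 x.2)]
  · refine Finset.sum_congr rfl ?_
    rintro ⟨u, v⟩ huv
    have hS : S u v := (Finset.mem_filter.1 huv).2
    symm
    refine Finset.card_bij (fun t _ => Sum.inl (t, u)) ?_ ?_ ?_
    · intro t ht
      have ht' : σ (.inl (t, u)) = .inl (t, v) := (Finset.mem_filter.1 ht).2
      refine Finset.mem_filter.2 ⟨Finset.mem_filter.2 ⟨Finset.mem_univ _, ?_⟩, ?_⟩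
      · rw [ht']
        exact ⟨rfl, hS⟩
      · rw [ht']
        rfl
    · intro a _ b _ h
      simpa using h
    · rintro (⟨t, u'⟩ | ⟨t, u'⟩) hi
      · rw [Finset.mem_filter, Finset.mem_filter] at hi
        obtain ⟨⟨-, hs⟩, hv⟩ := hi
        rcases hσ : σ (.inl (t, u')) with ⟨s, v'⟩ | ⟨s, v'⟩
        · rw [hσ] at hs hv
          simp only [Idx.vertex, Prod.mk.injEq] at hv
          obtain ⟨rfl, rfl⟩ := hv
          obtain ⟨rfl, -⟩ := hs
          exact ⟨t, Finset.mem_filter.2 ⟨Finset.mem_univ _, hσ⟩, rfl⟩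
        · rw [hσ] at hs
          exact hs.elim
      · rw [Finset.mem_filter, Finset.mem_filter] at hi
        exact hi.1.2.elim
  · intro i hi
    have hi' : sieveLink S i (σ i) := by simpa using hi
    rcases i with ⟨t, u⟩ | ⟨t, u⟩
    · rcases hσ : σ (.inl (t, u)) with ⟨s, v⟩ | ⟨s, v⟩
      · rw [hσ] at hi'
        simpa [hσ, Idx.vertex] using hi'.2
      · rw [hσ] at hi'
        exact hi'.elim
    · exact hi'.elim

omit [DecidableRel G.Adj] in
open Classical in
/-- Every moved index has weight one, and `Z` more if its link is sieved. -/
theorem coverWeight_eq {k : ℕ} {S : V → V → Prop} (hSG : ∀ u v, S u v → G.Adj u v) (Z : ℕ)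
    (σ : Equiv.Perm (Idx k V)) :
    coverWeight S Z σ = Z * (∑ x : V × V with S x.1 x.2, (usedColors σ x.1 x.2).card) +
      (Finset.univ.filter fun i => σ i ≠ i).card := by
  rw [← card_sieveLink, coverWeight, Finset.card_eq_sum_ones, Finset.card_filter, Finset.mul_sum,
    Finset.sum_filter, Finset.sum_filter, ← Finset.sum_add_distrib]
  refine Finset.sum_congr rfl fun i _ => ?_
  have : sieveLink S i (σ i) → σ i ≠ i := by
    intro h hi
    rw [hi] at h
    rcases i with ⟨t, u⟩ | ⟨t, u⟩
    · exact (hSG _ _ h.2).ne rfl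
    · exact h
  unfold linkWeight
  by_cases h1 : sieveLink S i (σ i)
  · simp [h1, this h1]
  · simp [h1]

omit [DecidableEq V] in
theorem IsCover.apply_apply {k r : ℕ} {S : V → V → Prop} {e : V → V → ℕ}
    {σ : Equiv.Perm (Idx k V)} (h : IsCover G S e r σ) (i : Idx k V) : σ (σ i) = i := by
  rw [← Equiv.Perm.mul_apply, h.invol, Equiv.Perm.one_apply]

omit [DecidableEq V] in
theorem IsCover.moved_subset {k r : ℕ} {S : V → V → Prop} {e : V → V → ℕ}
    {σ : Equiv.Perm (Idx k V)} (h : IsCover G S e r σ) {i : Idx k V} (hi : σ i ≠ i) :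
    i ∈ activeIdx G k := by
  classical
  rw [activeIdx, Finset.mem_filter]
  refine ⟨Finset.mem_univ _, ?_⟩
  have hl := h.links i hi
  rcases i with ⟨t, u⟩ | ⟨t, u⟩
  · trivial
  · rcases hσ : σ (.inr (t, u)) with ⟨s, v⟩ | ⟨s, v⟩
    · rw [hσ] at hl
      obtain ⟨rfl, h2⟩ := hl
      exact h2
    · rw [hσ] at hl
      exact hl.elim

/-- If each vertex is used in all colours and only `k - deg v` dummies are available to it, then the
matching uses at least `deg v` edges at `v`, with multiplicity. -/
theorem IsCover.degree_le_sum {k r : ℕ} {S : V → V → Prop} {e : V → V → ℕ}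
    {σ : Equiv.Perm (Idx k V)} (h : IsCover G S e r σ) (hk : ∀ v, G.degree v ≤ k) (u : V)
    (hmoved : ∀ t : Fin k, σ (.inl (t, u)) ≠ .inl (t, u)) :
    G.degree u ≤ ∑ v ∈ G.neighborFinset u, (usedColors σ u v).card := by
  classical
  set A : Finset (Fin k) := (G.neighborFinset u).biUnion fun v => usedColors σ u v
  have hA : A.card ≤ ∑ v ∈ G.neighborFinset u, (usedColors σ u v).card := Finset.card_biUnion_le
  have hAc : Aᶜ.card ≤ k - G.degree u := by
    rw [← card_filter_add_lt (k := k) (d := G.degree u)]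
    have hd : ∀ t ∈ Aᶜ, ∃ j : Fin k, σ (.inl (t, u)) = .inr (j, u) ∧ (j : ℕ) + G.degree u < k := by
      intro t ht
      have hl := h.links _ (hmoved t)
      rcases hσ : σ (.inl (t, u)) with ⟨s, v⟩ | ⟨s, v⟩
      · rw [hσ] at hl
        obtain ⟨rfl, h2⟩ := hl
        refine absurd ?_ (Finset.mem_compl.1 ht)
        exact Finset.mem_biUnion.2 ⟨v, by simpa using h2, by simpa [usedColors] using hσ⟩
      · rw [hσ] at hl
        obtain ⟨rfl, h2⟩ := hl
        exact ⟨s, rfl, h2⟩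
    choose! f hf using hd
    refine Finset.card_le_card_of_injOn f ?_ ?_
    · intro t ht
      simpa using (hf t ht).2
    · intro a ha b hb hab
      have := (hf a ha).1
      rw [hab, ← (hf b hb).1] at this
      simpa using σ.injective this
  have := Finset.card_add_card_compl A
  rw [Fintype.card_fin] at this
  have := hk u
  omega

theorem IsCover.usedColors_symm {k r : ℕ} {S : V → V → Prop} {e : V → V → ℕ}
    {σ : Equiv.Perm (Idx k V)} (h : IsCover G S e r σ) (u v : V) :
    usedColors σ u v = usedColors σ v u := by
  classical
  ext t
  simp only [usedColors, Finset.mem_filter, Finset.mem_univ, true_and]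
  constructor <;>
  · intro ht
    rw [← ht, h.apply_apply]

open Classical in
/-- A matching of the critical weight yields an edge colouring. The weight forces every sieved edge
to be used exactly once and every active index to be matched. If all other edges at `v` are sieved,
the remaining edge at `v` must then be used as well, because `deg v` edges are used at `v`. -/
theorem IsCover.exists_properOn {k r Z : ℕ} {S : V → V → Prop} {e : V → V → ℕ}
    {σ : Equiv.Perm (Idx k V)} (h : IsCover G S e r σ) (hk : ∀ v, G.degree v ≤ k) (hk0 : 0 < k)
    (hSG : ∀ u v, S u v → G.Adj u v) (her : ∀ u v, S u v → e u v < r)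
    (hinj : ∀ u v u' v', S u v → S u' v' → e u v = e u' v' → s(u, v) = s(u', v'))
    (hcard : (Finset.univ.filter fun x : V × V => S x.1 x.2).card = 2 * r)
    (hstar : ∀ u v, G.Adj u v → ¬ S u v →
      (∀ w, G.Adj v w → w ≠ u → S v w) ∨ (∀ w, G.Adj u w → w ≠ v → S u w))
    (hZ : 2 * (k * Fintype.card V) < Z)
    (hw : coverWeight S Z σ + ∑ v, G.degree v = 2 * Z * r + 2 * (k * Fintype.card V)) :
    ∃ c : Sym2 V → Fin k, ProperOn G c := by
  have hact := card_activeIdx hk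
  have hmle : (Finset.univ.filter fun i => σ i ≠ i).card ≤ (activeIdx G k).card :=
    Finset.card_le_card fun i hi => h.moved_subset (Finset.mem_filter.1 hi).2
  have hone : ∀ x ∈ Finset.univ.filter (fun x : V × V => S x.1 x.2),
      1 ≤ (usedColors σ x.1 x.2).card := by
    rintro ⟨u, v⟩ huv
    have hSuv : S u v := (Finset.mem_filter.1 huv).2
    obtain ⟨i, hi, hie⟩ := h.covers _ (her u v hSuv)
    rcases i with ⟨t, u'⟩ | ⟨t, u'⟩
    · rcases hσ : σ (.inl (t, u')) with ⟨s, v'⟩ | ⟨s, v'⟩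
      · rw [hσ] at hi hie
        obtain ⟨rfl, h2⟩ := hi
        refine Finset.card_pos.2 ⟨t, ?_⟩
        rcases Sym2.eq_iff.1 (hinj _ _ _ _ h2 hSuv hie) with ⟨rfl, rfl⟩ | ⟨rfl, rfl⟩
        · simpa [usedColors] using hσ
        · rw [h.usedColors_symm]
          simpa [usedColors] using hσ
      · rw [hσ] at hi
        exact hi.elim
    · exact hi.elim
  rw [coverWeight_eq hSG] at hw
  have hge := Finset.sum_le_sum hone
  rw [Finset.sum_const, hcard, smul_eq_mul, mul_one] at hge
  -- `Z` exceeds the number of moved indices, so the multiple of `Z` in the weight determines how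
  -- often sieved edges are used.
  have hsum : ∑ x : V × V with S x.1 x.2, (usedColors σ x.1 x.2).card = 2 * r := by
    refine le_antisymm ?_ hge
    by_contra! hlt
    have : Z * (2 * r + 1) ≤ Z * ∑ x : V × V with S x.1 x.2, (usedColors σ x.1 x.2).card :=
      Nat.mul_le_mul_left Z hlt
    have h2 : Z * (2 * r + 1) = 2 * Z * r + Z := by ring
    omega
  have hexact : ∀ u v, S u v → (usedColors σ u v).card = 1 := by
    intro u v huv
    refine ((Finset.sum_eq_sum_iff_of_le hone).1 ?_ (u, v) (by simpa using huv)).symm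
    rw [hsum, Finset.sum_const, hcard, smul_eq_mul, mul_one]
  have hmoved : ∀ i ∈ activeIdx G k, σ i ≠ i := by
    have heq : (Finset.univ.filter fun i => σ i ≠ i) = activeIdx G k := by
      refine Finset.eq_of_subset_of_card_le
        (fun i hi => h.moved_subset (Finset.mem_filter.1 hi).2) ?_
      rw [hsum] at hw
      have : Z * (2 * r) = 2 * Z * r := by ring
      omega
    intro i hi
    rw [← heq] at hi
    exact (Finset.mem_filter.1 hi).2
  have hdeg := fun u => h.degree_le_sum hk u fun t => hmoved _ (by simp [activeIdx])
  -- If `vu` were unused, at most `deg v - 1` copies of `v` would be linked along edges.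
  have hkey : ∀ u v, G.Adj v u → (∀ w, G.Adj v w → w ≠ u → S v w) →
      (usedColors σ v u).Nonempty := by
    intro u v hvu hw
    by_contra hne
    rw [Finset.not_nonempty_iff_eq_empty] at hne
    have hle := hdeg v
    rw [← Finset.add_sum_erase _ _ ((G.mem_neighborFinset v u).2 hvu), hne, Finset.card_empty,
      zero_add] at hle
    have hle2 : ∑ w ∈ (G.neighborFinset v).erase u, (usedColors σ v w).card ≤
        ((G.neighborFinset v).erase u).card * 1 := by
      refine Finset.sum_le_card_nsmul _ _ 1 fun w hwm => ?_
      rw [Finset.mem_erase, G.mem_neighborFinset] at hwm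
      exact (hexact v w (hw w hwm.2 hwm.1)).le
    rw [Finset.card_erase_of_mem ((G.mem_neighborFinset v u).2 hvu),
      G.card_neighborFinset_eq_degree] at hle2
    have : 0 < G.degree v := (G.degree_pos_iff_exists_adj v).2 ⟨u, hvu⟩
    omega
  have hused : ∀ u v, G.Adj u v → (usedColors σ u v).Nonempty := by
    intro u v huv
    by_cases hs : S u v
    · exact Finset.card_pos.1 (by rw [hexact u v hs]; exact one_pos)
    · rcases hstar u v huv hs with hv | hu
      · rw [h.usedColors_symm]
        exact hkey u v huv.symm hv
      · exact hkey v u huv hu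
  have : Nonempty (Fin k) := ⟨⟨0, hk0⟩⟩
  have hcol : ∀ x : Sym2 V, ∃ t : Fin k, ∀ u v, x = s(u, v) → G.Adj u v → t ∈ usedColors σ u v := by
    intro x
    induction x using Sym2.ind with
    | _ u v =>
    by_cases huv : G.Adj u v
    · obtain ⟨t, ht⟩ := hused u v huv
      refine ⟨t, fun u' v' hx _ => ?_⟩
      rcases Sym2.eq_iff.1 hx with ⟨rfl, rfl⟩ | ⟨rfl, rfl⟩
      · exact ht
      · rwa [h.usedColors_symm]
    · refine ⟨Classical.arbitrary _, fun u' v' hx hadj => absurd ?_ huv⟩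
      rcases Sym2.eq_iff.1 hx with ⟨rfl, rfl⟩ | ⟨rfl, rfl⟩
      · exact hadj
      · exact hadj.symm
  choose c hc using hcol
  refine ⟨c, fun u v w huv huw hcc => ?_⟩
  have h1 := hc _ u v rfl huv
  have h2 := hc _ u w rfl huw
  rw [hcc] at h1
  simp only [usedColors, Finset.mem_filter, Finset.mem_univ, true_and] at h1 h2
  rw [h1] at h2
  simpa using h2

omit [DecidableEq V] in
open Classical in
/-- The missing colours at `u` are as many as its active dummies. -/
theorem exists_missing_equiv {k : ℕ} {c : Sym2 V → Fin k}
    (hc : ProperOn G c) (u : V) :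
    Nonempty ({t : Fin k // ∀ v, G.Adj u v → c s(u, v) ≠ t} ≃
      {j : Fin k // (j : ℕ) + G.degree u < k}) := by
  refine ⟨Fintype.equivOfCardEq ?_⟩
  rw [Fintype.card_subtype, Fintype.card_subtype, card_filter_add_lt]
  have h1 : (Finset.univ.filter fun t : Fin k => ∀ v, G.Adj u v → c s(u, v) ≠ t) =
      ((G.neighborFinset u).image fun v => c s(u, v))ᶜ := by
    ext t
    simp
  rw [h1, Finset.card_compl, Finset.card_image_of_injOn, G.card_neighborFinset_eq_degree,
    Fintype.card_fin]
  intro v hv w hw hvw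
  exact hc (by simpa using hv) (by simpa using hw) hvw

open Classical in
/-- Conversely an edge colouring gives a matching of the critical weight: a copy `(t, u)` goes to
`(t, v)` if `uv` has colour `t`, and to a dummy if `t` is missing at `u`. -/
theorem ProperOn.exists_isCover {k r Z : ℕ} {S : V → V → Prop} {e : V → V → ℕ}
    {c : Sym2 V → Fin k} (hc : ProperOn G c) (hk : ∀ v, G.degree v ≤ k)
    (hSG : ∀ u v, S u v → G.Adj u v)
    (hsurj : ∀ j < r, ∃ u v, S u v ∧ e u v = j)
    (hcard : (Finset.univ.filter fun x : V × V => S x.1 x.2).card = 2 * r) :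
    ∃ σ : Equiv.Perm (Idx k V), IsCover G S e r σ ∧
      coverWeight S Z σ + ∑ v, G.degree v = 2 * Z * r + 2 * (k * Fintype.card V) := by
  let f := fun u => (exists_missing_equiv hc u).some
  -- The matching, as an involution; `f u` pairs the colours missing at `u` with the dummies of `u`.
  let F : Idx k V → Idx k V := fun p => match p with
    | .inl (t, u) => if h : ∃ v, G.Adj u v ∧ c s(u, v) = t then .inl (t, h.choose) else
        .inr ((f u ⟨t, fun v h1 h2 => h ⟨v, h1, h2⟩⟩).1, u)
    | .inr (j, u) => if h : (j : ℕ) + G.degree u < k then .inl (((f u).symm ⟨j, h⟩).1, u) else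
        .inr (j, u)
  have hF1 : ∀ u v, G.Adj u v → F (.inl (c s(u, v), u)) = .inl (c s(u, v), v) := by
    intro u v huv
    have h : ∃ w, G.Adj u w ∧ c s(u, w) = c s(u, v) := ⟨v, huv, rfl⟩
    simp only [F]
    rw [dif_pos h, hc h.choose_spec.1 huv h.choose_spec.2]
  have hF2 : ∀ u t (h : ∀ v, G.Adj u v → c s(u, v) ≠ t),
      F (.inl (t, u)) = .inr ((f u ⟨t, h⟩).1, u) := by
    intro u t h
    simp only [F]
    rw [dif_neg]
    rintro ⟨v, h1, h2⟩
    exact h v h1 h2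
  have hF3 : ∀ u (j : Fin k) (h : (j : ℕ) + G.degree u < k),
      F (.inr (j, u)) = .inl (((f u).symm ⟨j, h⟩).1, u) := by
    intro u j h
    simp only [F]
    rw [dif_pos h]
  have hF4 : ∀ u (j : Fin k), ¬ (j : ℕ) + G.degree u < k → F (.inr (j, u)) = .inr (j, u) := by
    intro u j h
    simp only [F]
    rw [dif_neg h]
  have hcases : ∀ (t : Fin k) u, (∃ v, G.Adj u v ∧ c s(u, v) = t) ∨
      (∀ v, G.Adj u v → c s(u, v) ≠ t) := by
    intro t u
    by_cases h : ∃ v, G.Adj u v ∧ c s(u, v) = t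
    · exact .inl h
    · exact .inr fun v h1 h2 => h ⟨v, h1, h2⟩
  have hinv : Function.Involutive F := by
    rintro (⟨t, u⟩ | ⟨j, u⟩)
    · rcases hcases t u with ⟨v, huv, rfl⟩ | h
      · rw [hF1 u v huv, Sym2.eq_swap, hF1 v u huv.symm]
      · rw [hF2 u t h, hF3 u _ (f u ⟨t, h⟩).2]
        simp
    · by_cases h : (j : ℕ) + G.degree u < k
      · rw [hF3 u j h, hF2 u _ ((f u).symm ⟨j, h⟩).2]
        simp
      · rw [hF4 u j h, hF4 u j h]
  obtain ⟨σ, hσ⟩ : ∃ σ : Equiv.Perm (Idx k V), ∀ i, σ i = F i := ⟨hinv.toPerm, fun _ => rfl⟩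
  have hused : ∀ u v, S u v → (usedColors σ u v).card = 1 := by
    intro u v huv
    refine Finset.card_eq_one.2 ⟨c s(u, v), ?_⟩
    ext t
    simp only [usedColors, Finset.mem_filter, Finset.mem_univ, true_and, Finset.mem_singleton, hσ]
    constructor
    · intro h
      rcases hcases t u with ⟨w, huw, rfl⟩ | h'
      · rw [hF1 u w huw] at h
        have : w = v := by simpa using h
        rw [this]
      · rw [hF2 u t h'] at h
        simp at h
    · rintro rfl
      exact hF1 u v (hSG u v huv)
  have hcover : IsCover G S e r σ := by
    refine ⟨?_, ?_, ?_⟩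
    · refine Equiv.ext fun i => ?_
      rw [Equiv.Perm.mul_apply, Equiv.Perm.one_apply, hσ, hσ]
      exact hinv i
    · rintro (⟨t, u⟩ | ⟨j, u⟩) hi <;> rw [hσ] at hi ⊢
      · rcases hcases t u with ⟨v, huv, rfl⟩ | h
        · rw [hF1 u v huv]
          exact ⟨rfl, huv⟩
        · rw [hF2 u t h]
          exact ⟨rfl, (f u ⟨t, h⟩).2⟩
      · by_cases h : (j : ℕ) + G.degree u < k
        · rw [hF3 u j h]
          exact ⟨rfl, h⟩
        · exact absurd (hF4 u j h) hi
    · intro j hj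
      obtain ⟨u, v, huv, rfl⟩ := hsurj j hj
      refine ⟨.inl (c s(u, v), u), ?_⟩
      rw [hσ, hF1 u v (hSG u v huv)]
      exact ⟨⟨rfl, huv⟩, rfl⟩
  refine ⟨σ, hcover, ?_⟩
  have hmoved : (Finset.univ.filter fun i => σ i ≠ i) = activeIdx G k := by
    refine Finset.Subset.antisymm (fun i hi => hcover.moved_subset (Finset.mem_filter.1 hi).2) ?_
    intro i hi
    rw [Finset.mem_filter, hσ]
    refine ⟨Finset.mem_univ _, ?_⟩
    rcases i with ⟨t, u⟩ | ⟨j, u⟩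
    · rcases hcases t u with ⟨v, huv, rfl⟩ | h
      · rw [hF1 u v huv]
        simpa using huv.ne'
      · rw [hF2 u t h]
        simp
    · have h : (j : ℕ) + G.degree u < k := (Finset.mem_filter.1 hi).2
      rw [hF3 u j h]
      simp
  have hsum : ∑ x : V × V with S x.1 x.2, (usedColors σ x.1 x.2).card = 2 * r := by
    rw [← hcard, Finset.card_eq_sum_ones]
    exact Finset.sum_congr rfl fun x hx => hused _ _ (Finset.mem_filter.1 hx).2
  rw [coverWeight_eq hSG, hsum, hmoved]
  have := card_activeIdx hk
  have h2 : Z * (2 * r) = 2 * Z * r := by ring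
  omega

end Blowup

/-! ### Polynomials over the field with two elements as natural numbers -/

section Encoding

/-- The number with digits `c 0, c 1, …, c (n - 1)` in base `2 ^ W`. -/
def ofDigitFn (W n : ℕ) (c : ℕ → ℕ) : ℕ := ∑ i ∈ Finset.range n, c i * 2 ^ (W * i)

theorem ofDigitFn_congr {W n : ℕ} {c d : ℕ → ℕ} (h : ∀ i < n, c i = d i) :
    ofDigitFn W n c = ofDigitFn W n d :=
  Finset.sum_congr rfl fun i hi => by rw [h i (Finset.mem_range.1 hi)]

theorem ofDigitFn_lt {W : ℕ} {c : ℕ → ℕ} (hc : ∀ i, c i < 2 ^ W) (n : ℕ) :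
    ofDigitFn W n c < 2 ^ (W * n) := by
  induction n with
  | zero => simp [ofDigitFn]
  | succ n ih =>
    rw [ofDigitFn, Finset.sum_range_succ, ← ofDigitFn, mul_add, mul_one, pow_add]
    have := Nat.mul_le_mul_right (2 ^ (W * n)) (Nat.succ_le_of_lt (hc n))
    rw [Nat.succ_mul, mul_comm (2 ^ W)] at this
    omega

theorem testBit_ofDigitFn {W : ℕ} {c : ℕ → ℕ} (hc : ∀ i, c i < 2 ^ W) (n q t : ℕ) (ht : t < W) :
    (ofDigitFn W n c).testBit (W * q + t) = (decide (q < n) && (c q).testBit t) := by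
  induction n with
  | zero => simp [ofDigitFn]
  | succ n ih =>
    rw [ofDigitFn, Finset.sum_range_succ, ← ofDigitFn, add_comm, mul_comm (c n),
      Nat.testBit_two_pow_mul_add _ (ofDigitFn_lt hc n)]
    rcases lt_trichotomy q n with h | h | h
    · have : W * (q + 1) ≤ W * n := Nat.mul_le_mul_left W h
      rw [mul_add, mul_one] at this
      rw [if_pos (by omega), ih]
      simp [h, h.trans (Nat.lt_succ_self n)]
    · subst h
      rw [if_neg (by omega), Nat.add_sub_cancel_left]
      simp
    · have : W * (n + 1) ≤ W * q := Nat.mul_le_mul_left W h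
      rw [mul_add, mul_one] at this
      rw [if_neg (by omega), Nat.testBit_eq_false_of_lt]
      · simp [show ¬ q < n + 1 by omega]
      · exact (hc n).trans_le (Nat.pow_le_pow_right two_pos (by omega))

theorem eq_of_testBit_digits {W a b : ℕ} (hW : 0 < W)
    (h : ∀ q t, t < W → a.testBit (W * q + t) = b.testBit (W * q + t)) : a = b := by
  refine Nat.eq_of_testBit_eq fun j => ?_
  rw [← Nat.div_add_mod j W]
  exact h _ _ (Nat.mod_lt _ hW)

/-- The number with `n` digits `1` in base `2 ^ W`. -/
def digitMask (W n : ℕ) : ℕ := ofDigitFn W n fun _ => 1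

theorem digitMask_eq {W : ℕ} (hW : 0 < W) (n : ℕ) :
    digitMask W n = ((2 ^ W) ^ n - 1) / (2 ^ W - 1) := by
  rw [← Nat.geomSum_eq (Nat.pow_le_pow_right two_pos hW : 2 ^ 1 ≤ 2 ^ W)]
  simp [digitMask, ofDigitFn, pow_mul]

/-- Masking reduces every digit modulo two and truncates. -/
theorem ofDigitFn_and_digitMask {W : ℕ} (hW : 0 < W) {c : ℕ → ℕ} (hc : ∀ i, c i < 2 ^ W)
    {m n : ℕ} (hn : n ≤ m) :
    ofDigitFn W m c &&& digitMask W n = ofDigitFn W n fun i => c i % 2 := by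
  have h2 : 2 ^ 1 ≤ 2 ^ W := Nat.pow_le_pow_right two_pos hW
  refine eq_of_testBit_digits hW fun q t ht => ?_
  rw [Nat.testBit_and, testBit_ofDigitFn hc _ _ _ ht, digitMask,
    testBit_ofDigitFn (fun _ => by omega) _ _ _ ht, testBit_ofDigitFn (fun _ => by omega) _ _ _ ht]
  have h3 : (c q % 2).testBit t = ((c q).testBit t && Nat.testBit 1 t) := by
    rw [← Nat.testBit_and, Nat.and_one_is_mod]
  rw [h3]
  by_cases hq : q < n
  · simp [hq, hq.trans_le hn]
  · simp [hq]

open PowerSeries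

/-- The first `n` coefficients of a power series over the field with two elements, as the digits of
a number in base `2 ^ W`. -/
noncomputable def enc (W n : ℕ) (f : (ZMod 2)⟦X⟧) : ℕ := ofDigitFn W n fun i => (coeff i f).val

variable {W n : ℕ}

theorem zmodVal_lt (hW : 0 < W) (x : ZMod 2) : x.val < 2 ^ W :=
  (ZMod.val_lt x).trans_le (Nat.pow_le_pow_right two_pos hW : 2 ^ 1 ≤ 2 ^ W)

theorem enc_lt (hW : 0 < W) (n : ℕ) (f : (ZMod 2)⟦X⟧) : enc W n f < 2 ^ (W * n) :=
  ofDigitFn_lt (fun _ => zmodVal_lt hW _) n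

theorem digitMask_lt (hW : 0 < W) (n : ℕ) : digitMask W n < 2 ^ (W * n) :=
  ofDigitFn_lt (fun _ => Nat.one_lt_two_pow hW.ne') n

theorem enc_congr {f g : (ZMod 2)⟦X⟧} (h : ∀ i < n, coeff i f = coeff i g) :
    enc W n f = enc W n g :=
  ofDigitFn_congr fun i hi => by rw [h i hi]

theorem enc_zero : enc W n 0 = 0 := by simp [enc, ofDigitFn]

theorem enc_one (hn : 0 < n) : enc W n 1 = 1 := by
  rw [enc, ofDigitFn, Finset.sum_eq_single 0]
  · simp only [PowerSeries.coeff_zero_one, mul_zero, pow_zero, mul_one]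
    rfl
  · intro i _ hi
    simp [PowerSeries.coeff_one, hi]
  · intro h
    exact absurd (Finset.mem_range.2 hn) h

/-- Over `ZMod 2` the coefficients add by exclusive or, digit by digit. -/
theorem enc_add (hW : 0 < W) (f g : (ZMod 2)⟦X⟧) :
    enc W n (f + g) = enc W n f ^^^ enc W n g := by
  refine eq_of_testBit_digits hW fun q t ht => ?_
  rw [Nat.testBit_xor, enc, enc, enc, testBit_ofDigitFn (fun _ => zmodVal_lt hW _) _ _ _ ht,
    testBit_ofDigitFn (fun _ => zmodVal_lt hW _) _ _ _ ht,
    testBit_ofDigitFn (fun _ => zmodVal_lt hW _) _ _ _ ht, map_add]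
  have : ∀ x y : ZMod 2, (x + y).val = x.val ^^^ y.val := by decide
  rw [this, Nat.testBit_xor]
  cases decide (q < n) <;> simp

/-- The product of two encodings has the coefficients of the integer product as its digits: each is
a sum of at most `n < 2 ^ W` terms, none larger than one, so no carry occurs. The mask reduces the
digits modulo two and drops those from `n` on. -/
theorem enc_mul (hW : 0 < W) (hn : n < 2 ^ W) (f g : (ZMod 2)⟦X⟧) :
    enc W n (f * g) = enc W n f * enc W n g &&& digitMask W n := by
  set a : ℕ → ℕ := fun i => (coeff i f).val
  set b : ℕ → ℕ := fun i => (coeff i g).val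
  set c : ℕ → ℕ := fun s => ∑ x ∈ Finset.range n ×ˢ Finset.range n with x.1 + x.2 = s, a x.1 * b x.2
  have hle1 : ∀ x : ZMod 2, x.val ≤ 1 := by decide
  have hc : ∀ s, c s < 2 ^ W := by
    intro s
    refine lt_of_le_of_lt ?_ hn
    refine (Finset.sum_le_card_nsmul _ _ 1 fun x _ => ?_).trans ?_
    · exact (Nat.mul_le_mul (hle1 _) (hle1 _)).trans (by norm_num)
    · rw [smul_eq_mul, mul_one]
      refine (Finset.card_le_card_of_injOn Prod.fst (t := Finset.range n) ?_ ?_).trans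
        (Finset.card_range n).le
      · intro x hx
        have := Finset.mem_product.1 (Finset.mem_filter.1 hx).1
        exact this.1
      · intro x hx y hy hxy
        have h1 := (Finset.mem_filter.1 hx).2
        have h2 := (Finset.mem_filter.1 hy).2
        exact Prod.ext hxy (by omega)
  have hprod : enc W n f * enc W n g = ofDigitFn W (2 * n) c := by
    rw [enc, enc, ofDigitFn, ofDigitFn, ofDigitFn, Finset.sum_mul_sum, ← Finset.sum_product',
      ← Finset.sum_fiberwise_of_maps_to (g := fun x : ℕ × ℕ => x.1 + x.2)
        (t := Finset.range (2 * n))]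
    · refine Finset.sum_congr rfl fun s _ => ?_
      rw [Finset.sum_mul]
      refine Finset.sum_congr rfl fun x hx => ?_
      rw [← (Finset.mem_filter.1 hx).2, mul_add, pow_add]
      simp only [a, b]
      ring
    · intro x hx
      simp only [Finset.mem_product, Finset.mem_range] at hx ⊢
      omega
  rw [hprod, ofDigitFn_and_digitMask hW hc (by omega), enc]
  refine ofDigitFn_congr fun s hs => ?_
  have hcs : ((c s : ℕ) : ZMod 2) = coeff s (f * g) := by
    rw [PowerSeries.coeff_mul, Nat.cast_sum]
    refine (Finset.sum_subset_zero_on_sdiff ?_ ?_ ?_).symm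
    · intro x hx
      rw [Finset.HasAntidiagonal.mem_antidiagonal] at hx
      simp only [Finset.mem_filter, Finset.mem_product, Finset.mem_range]
      omega
    · intro x hx
      rw [Finset.mem_sdiff, Finset.HasAntidiagonal.mem_antidiagonal] at hx
      exact absurd (Finset.mem_filter.1 hx.1).2 hx.2
    · intro x _
      simp [a, b]
  rw [← hcs, ZMod.val_natCast]

theorem enc_mul_X_pow (hW : 0 < W) (f : (ZMod 2)⟦X⟧) (j : ℕ) :
    enc W n (f * X ^ j) = enc W n f * 2 ^ (W * j) &&& digitMask W n := by
  set c : ℕ → ℕ := fun i => if j ≤ i ∧ i - j < n then (coeff (i - j) f).val else 0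
  have hc : ∀ i, c i < 2 ^ W := by
    intro i
    simp only [c]
    split_ifs
    · exact zmodVal_lt hW _
    · positivity
  have h : enc W n f * 2 ^ (W * j) = ofDigitFn W (j + n) c := by
    have h0 : ∑ i ∈ Finset.range j, c i * 2 ^ (W * i) = 0 := by
      refine Finset.sum_eq_zero fun i hi => ?_
      have hi' := Finset.mem_range.1 hi
      simp only [c]
      rw [if_neg (by omega), zero_mul]
    rw [enc, ofDigitFn, ofDigitFn, Finset.sum_range_add, h0, zero_add, Finset.sum_mul]
    · refine Finset.sum_congr rfl fun i hi => ?_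
      have hi' := Finset.mem_range.1 hi
      simp only [c]
      rw [if_pos ⟨by omega, by omega⟩, Nat.add_sub_cancel_left, mul_add, pow_add]
      ring
  rw [h, ofDigitFn_and_digitMask hW hc (by omega), enc]
  refine ofDigitFn_congr fun i hi => ?_
  rw [PowerSeries.coeff_mul_X_pow']
  simp only [c]
  by_cases hj : j ≤ i
  · rw [if_pos hj, if_pos ⟨hj, by omega⟩, Nat.mod_eq_of_lt (ZMod.val_lt _)]
  · rw [if_neg hj, if_neg fun h => hj h.1]
    simp

/-- Comparing the low part of the encoding with a power of two tests a window of coefficients. -/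
theorem enc_mod_lt_iff (hW : 0 < W) (f : (ZMod 2)⟦X⟧) {s l : ℕ} (hn : s + l ≤ n) :
    enc W n f % 2 ^ (W * (s + l)) < 2 ^ (W * s) ↔ ∀ j < l, coeff (s + j) f = 0 := by
  constructor
  · intro h j hj
    have hb := Nat.testBit_lt_two_pow (h.trans_le (Nat.pow_le_pow_right two_pos
      (show W * s ≤ W * (s + j) + 0 from Nat.mul_le_mul_left W (by omega))))
    have hlt : W * (s + j) + 0 < W * (s + l) := Nat.mul_lt_mul_of_pos_left (by omega) hW
    rw [Nat.testBit_mod_two_pow, enc,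
      testBit_ofDigitFn (fun _ => zmodVal_lt hW _) _ _ _ hW] at hb
    have hsj : s + j < n := by omega
    simp only [hlt, hsj, decide_true, Bool.true_and] at hb
    have : ∀ x : ZMod 2, x.val.testBit 0 = false → x = 0 := by decide
    exact this _ hb
  · intro h
    refine Nat.lt_pow_two_of_testBit _ fun i hi => ?_
    rw [Nat.testBit_mod_two_pow]
    by_cases hlt : i < W * (s + l)
    · rw [← Nat.div_add_mod i W, enc,
        testBit_ofDigitFn (fun _ => zmodVal_lt hW _) _ _ _ (Nat.mod_lt _ hW)]
      have h1 : s ≤ i / W := (Nat.le_div_iff_mul_le hW).2 (by rw [mul_comm]; exact hi)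
      have h2 : i / W < s + l := Nat.div_lt_of_lt_mul hlt
      have h3 := h (i / W - s) (by omega)
      rw [Nat.add_sub_cancel' h1] at h3
      simp [h3]
    · simp [hlt]

open Polynomial in
/-- The polynomial whose coefficients, from the highest down, are `b` given bits. -/
noncomputable def bitPoly (b : ℕ) (w : ℕ → Bool) : (ZMod 2)[X] :=
  ∑ i ∈ Finset.range b, Polynomial.monomial i (if w (b - 1 - i) then 1 else 0)

theorem coeff_bitPoly (b : ℕ) (w : ℕ → Bool) (i : ℕ) :
    (bitPoly b w).coeff i = if i < b ∧ w (b - 1 - i) then 1 else 0 := by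
  rw [bitPoly, Polynomial.finsetSum_coeff]
  simp only [Polynomial.coeff_monomial, Finset.sum_ite_eq', Finset.mem_range]
  by_cases h : i < b <;> simp [h]

theorem natDegree_bitPoly_le (b : ℕ) (w : ℕ → Bool) : (bitPoly b w).natDegree ≤ b := by
  refine Polynomial.natDegree_le_iff_coeff_eq_zero.2 fun i hi => ?_
  rw [coeff_bitPoly, if_neg fun h => by omega]

/-- Reading bits one by one, as the digits of a number in base `2 ^ W`. -/
def hornerBits (W : ℕ) (w : ℕ → Bool) : ℕ → ℕ
  | 0 => 0
  | b + 1 => hornerBits W w b * 2 ^ W + (w b).toNat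

theorem hornerBits_eq_enc {b : ℕ} (hb : b ≤ n) (w : ℕ → Bool) :
    hornerBits W w b = enc W n ((bitPoly b w : Polynomial (ZMod 2)) : (ZMod 2)⟦X⟧) := by
  have h1 : ∀ b, hornerBits W w b = ∑ i ∈ Finset.range b, (w (b - 1 - i)).toNat * 2 ^ (W * i) := by
    intro b
    induction b with
    | zero => simp [hornerBits]
    | succ b ih =>
      rw [hornerBits, ih, Finset.sum_range_succ', Finset.sum_mul]
      congr 1
      · refine Finset.sum_congr rfl fun i _ => ?_
        rw [show b + 1 - 1 - (i + 1) = b - 1 - i by omega, mul_add, pow_add, mul_one, mul_assoc]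
      · simp
  rw [h1, enc, ofDigitFn, ← Finset.sum_subset (Finset.range_mono hb)]
  · refine Finset.sum_congr rfl fun i hi => ?_
    rw [Polynomial.coeff_coe, coeff_bitPoly]
    have hi' := Finset.mem_range.1 hi
    cases w (b - 1 - i) <;> simp [hi']
    rfl
  · intro i _ hi
    rw [Finset.mem_range] at hi
    rw [Polynomial.coeff_coe, coeff_bitPoly, if_neg fun h => hi h.1]
    simp

theorem hornerBits_lt (hW : 0 < W) (w : ℕ → Bool) (b : ℕ) : hornerBits W w b < 2 ^ (W * b) := by
  rw [hornerBits_eq_enc le_rfl]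
  exact enc_lt hW b _

end Encoding

/-! ### Gaussian elimination over power series -/

section Gauss

open PowerSeries

theorem powerSeries_add_self (f : (ZMod 2)⟦X⟧) : f + f = 0 := by
  ext i
  rw [map_add, CharTwo.add_self_eq_zero, map_zero]

/-- One elimination step in characteristic two, acting on the rows and columns after `i`. -/
noncomputable def gaussStep (i : ℕ) (B : ℕ → ℕ → (ZMod 2)⟦X⟧) : ℕ → ℕ → (ZMod 2)⟦X⟧ :=
  fun j l => if i < j ∧ i < l then B j l + B j i * (B i i)⁻¹ * B i l else B j l

/-- The matrix after `i` elimination steps. -/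
noncomputable def gaussIter (B : ℕ → ℕ → (ZMod 2)⟦X⟧) : ℕ → ℕ → ℕ → (ZMod 2)⟦X⟧
  | 0 => B
  | i + 1 => gaussStep i (gaussIter B i)

/-- `B` is the identity matrix modulo `X`. -/
def IsUnipotentMod (N : ℕ) (B : ℕ → ℕ → (ZMod 2)⟦X⟧) : Prop :=
  ∀ j < N, ∀ l < N, constantCoeff (B j l) = if j = l then 1 else 0

theorem IsUnipotentMod.gaussStep {N i : ℕ} {B : ℕ → ℕ → (ZMod 2)⟦X⟧} (hB : IsUnipotentMod N B)
    (hi : i < N) : IsUnipotentMod N (gaussStep i B) := by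
  intro j hj l hl
  unfold _root_.gaussStep
  split_ifs with h1 h2 h2
  · subst h2
    rw [map_add, map_mul, hB i hi j hj, hB j hj j hj, if_neg h1.1.ne]
    simp
  · rw [map_add, map_mul, hB i hi l hl, hB j hj l hl, if_neg h1.2.ne, if_neg h2]
    simp
  · rw [hB j hj l hl, if_pos h2]
  · rw [hB j hj l hl, if_neg h2]

theorem IsUnipotentMod.gaussIter {N : ℕ} {B : ℕ → ℕ → (ZMod 2)⟦X⟧} (hB : IsUnipotentMod N B)
    {i : ℕ} (hi : i ≤ N) : IsUnipotentMod N (gaussIter B i) := by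
  induction i with
  | zero => exact hB
  | succ i ih => exact (ih (by omega)).gaussStep hi

theorem gaussIter_succ_succ (B : ℕ → ℕ → (ZMod 2)⟦X⟧) (i j l : ℕ) :
    gaussIter B (i + 1) (j + 1) (l + 1) =
      gaussIter (fun j l => gaussStep 0 B (j + 1) (l + 1)) i j l := by
  induction i generalizing j l with
  | zero => rfl
  | succ i ih =>
    rw [gaussIter, gaussStep, ih, ih, ih, ih]
    conv_rhs => rw [gaussIter, gaussStep]
    simp only [Nat.add_lt_add_iff_right]

/-- Elimination without pivoting is possible because the diagonal entries are units, and the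
determinant is the product of the pivots. -/
theorem prod_gaussIter_eq_det {N : ℕ} : ∀ {B : ℕ → ℕ → (ZMod 2)⟦X⟧}, IsUnipotentMod N B →
    ∏ i ∈ Finset.range N, gaussIter B i i i = (Matrix.of fun j l : Fin N => B j l).det := by
  induction N with
  | zero =>
    intro B _
    simp
  | succ N ih =>
    intro B hB
    have h0 : constantCoeff (B 0 0) ≠ 0 := by
      rw [hB 0 (by omega) 0 (by omega)]
      simp
    have hB' : IsUnipotentMod N fun j l => gaussStep 0 B (j + 1) (l + 1) := by
      intro j hj l hl
      have := hB.gaussStep (Nat.succ_pos N) (j + 1) (by omega) (l + 1) (by omega)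
      simpa using this
    rw [Finset.prod_range_succ']
    simp only [gaussIter_succ_succ]
    rw [ih hB']
    let A : Matrix (Fin (N + 1)) (Fin (N + 1)) (ZMod 2)⟦X⟧ := Matrix.of fun j l =>
      B j l + (if j = 0 then 0 else B j 0 * (B 0 0)⁻¹) * B 0 l
    have hA : A.det = (Matrix.of fun j l : Fin (N + 1) => B j l).det := by
      refine Matrix.det_eq_of_forall_row_eq_smul_add_const
        (fun j => if j = 0 then 0 else B j 0 * (B 0 0)⁻¹) 0 (by simp) fun j l => ?_
      simp [A]
    rw [← hA, Matrix.det_succ_column_zero, Fin.sum_univ_succ, Finset.sum_eq_zero]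
    · simp only [A, gaussIter, Fin.val_zero, pow_zero, one_mul, Matrix.of_apply, if_true, zero_mul,
        add_zero]
      rw [mul_comm]
      congr 2
    · intro j _
      have hz : A j.succ 0 = 0 := by
        simp only [A, Matrix.of_apply, Fin.succ_ne_zero, if_false, Fin.val_zero]
        rw [mul_assoc, PowerSeries.inv_mul_cancel _ h0, mul_one]
        exact powerSeries_add_self _
      rw [hz, mul_zero, zero_mul]

/-- Iterates converging to the inverse of a power series with constant coefficient `1`: the partial
sums of the geometric series of `f + 1`. -/
noncomputable def invIter (f : (ZMod 2)⟦X⟧) : ℕ → (ZMod 2)⟦X⟧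
  | 0 => 1
  | j + 1 => 1 + (f + 1) * invIter f j

/-- Since `f + 1` is divisible by `X`, the `j`-th iterate agrees with `f⁻¹` up to `X ^ j`. -/
theorem coeff_invIter {f : (ZMod 2)⟦X⟧} (hf : constantCoeff f = 1) {i j : ℕ} (hij : i ≤ j) :
    coeff i (invIter f j) = coeff i f⁻¹ := by
  have hf0 : constantCoeff f ≠ 0 := by
    rw [hf]
    exact one_ne_zero
  have h : ∀ j, f * invIter f j = 1 + (f + 1) ^ (j + 1) := by
    intro j
    have h2 : f + f = 0 := powerSeries_add_self f
    induction j with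
    | zero =>
      simp only [invIter]
      linear_combination -powerSeries_add_self (1 : (ZMod 2)⟦X⟧)
    | succ j ih =>
      simp only [invIter]
      linear_combination (f + 1) * ih + h2
  have hX : X ∣ f + 1 := by
    rw [PowerSeries.X_dvd_iff, map_add, hf, map_one]
    rfl
  have hd : X ^ (i + 1) ∣ f⁻¹ * (f + 1) ^ (j + 1) :=
    ((pow_dvd_pow X (by omega)).trans (pow_dvd_pow_of_dvd hX (j + 1))).mul_left _
  have hz := PowerSeries.X_pow_dvd_iff.1 hd i (Nat.lt_succ_self i)
  have : invIter f j = f⁻¹ + f⁻¹ * (f + 1) ^ (j + 1) := by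
    calc invIter f j = f⁻¹ * (f * invIter f j) := by
          rw [← mul_assoc, PowerSeries.inv_mul_cancel _ hf0, one_mul]
      _ = _ := by rw [h, mul_add, mul_one]
  rw [this, map_add, hz, add_zero]

end Gauss

/-! ### The probability that a random evaluation vanishes -/

section Probability

open MeasureTheory

instance : IsProbabilityMeasure RAM.coinMeasure := by
  unfold RAM.coinMeasure
  infer_instance

/-- Finitely many distinct coins show a given pattern with probability `2 ^ (-number of coins)`. -/
theorem coinMeasure_cylinder {J : Type*} [Fintype J] {φ : J → ℕ} (hφ : Function.Injective φ)
    (g : J → Bool) :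
    RAM.coinMeasure.real {ω | ∀ j, ω (φ j) = g j} = (1 / 2 : ℝ) ^ Fintype.card J := by
  classical
  have hset : {ω : ℕ → Bool | ∀ j, ω (φ j) = g j} =
      Set.pi (Finset.univ.map ⟨φ, hφ⟩ : Finset ℕ)
        fun i => {Function.extend φ g (fun _ => false) i} := by
    ext ω
    simp [Set.mem_pi, hφ.extend_apply]
  have hone : ∀ x : Bool, (PMF.uniformOfFintype Bool).toMeasure {x} = 2⁻¹ := by
    intro x
    rw [PMF.toMeasure_apply_singleton _ _ (measurableSet_singleton x)]
    simp
  rw [measureReal_def, RAM.coinMeasure, hset, Measure.infinitePi_pi _ fun _ _ => by measurability]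
  simp only [hone, Finset.prod_const, Finset.card_map, Finset.card_univ]
  simp

theorem bitPoly_injective {b : ℕ} {w w' : ℕ → Bool} (h : bitPoly b w = bitPoly b w') {i : ℕ}
    (hi : i < b) : w i = w' i := by
  have h1 := congrArg (fun p => p.coeff (b - 1 - i)) h
  simp only [coeff_bitPoly] at h1
  rw [show b - 1 - (b - 1 - i) = i by omega] at h1
  have h2 : b - 1 - i < b := by omega
  cases hw : w i <;> cases hw' : w' i <;> simp [hw, hw', h2] at h1 ⊢

/-- `bitPoly` of exactly `b` given bits. -/
noncomputable def finBitPoly {b : ℕ} (g : Fin b → Bool) : Polynomial (ZMod 2) :=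
  bitPoly b fun i => if h : i < b then g ⟨i, h⟩ else false

theorem finBitPoly_injective (b : ℕ) : Function.Injective (finBitPoly (b := b)) := by
  intro g g' h
  funext i
  have := bitPoly_injective h i.2
  simpa using this

/-- The Schwartz–Zippel lemma for coin tosses: each variable is a polynomial with `b` random bits as
coefficients, the bits of different variables being disjoint. -/
theorem coinMeasure_eval_eq_zero_le {ι : Type*} [Fintype ι] {d b : ℕ}
    {Q : MvPolynomial ι (Polynomial (ZMod 2))} (hQ : Q ≠ 0) (hd : Q.totalDegree ≤ d)
    {code : ι → ℕ} (hcode : Function.Injective code) :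
    RAM.coinMeasure.real {ω | MvPolynomial.eval
      (fun x => bitPoly b fun i => ω (b * code x + i)) Q = 0} ≤ d / 2 ^ b := by
  classical
  let φ : ι × Fin b → ℕ := fun j => b * code j.1 + j.2
  have hφ : Function.Injective φ := by
    rintro ⟨x, i⟩ ⟨x', i'⟩ h
    have hb : 0 < b := i.pos
    have h1 : code x = code x' := by
      have := congrArg (· / b) h
      simpa [φ, Nat.mul_add_div hb, Nat.div_eq_of_lt i.2, Nat.div_eq_of_lt i'.2] using this
    have h2 : (i : ℕ) = i' := by
      have := congrArg (· % b) h
      simpa [φ, Nat.mul_add_mod, Nat.mod_eq_of_lt i.2, Nat.mod_eq_of_lt i'.2] using this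
    exact Prod.ext (hcode h1) (Fin.ext h2)
  let S : Finset (Polynomial (ZMod 2)) := Finset.univ.image (finBitPoly (b := b))
  have hS : S.card = 2 ^ b := by
    rw [Finset.card_image_of_injective _ (finBitPoly_injective b)]
    simp
  let bad : Finset (ι × Fin b → Bool) :=
    {g | MvPolynomial.eval (fun x => finBitPoly fun i => g (x, i)) Q = 0}
  have hsub : {ω : ℕ → Bool | MvPolynomial.eval
      (fun x => bitPoly b fun i => ω (b * code x + i)) Q = 0} ⊆
      ⋃ g ∈ bad, {ω : ℕ → Bool | ∀ j, ω (φ j) = g j} := by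
    intro ω hω
    simp only [Set.mem_iUnion]
    refine ⟨fun j => ω (φ j), ?_, fun j => rfl⟩
    have heq : (fun x => finBitPoly fun i => ω (φ (x, i))) =
        fun x => bitPoly b fun i => ω (b * code x + i) := by
      funext x
      ext i : 1
      simp only [finBitPoly, coeff_bitPoly]
      by_cases hi : i < b
      · simp [hi, show b - 1 - i < b by omega, φ]
      · simp [hi]
    simp only [bad, Finset.mem_filter, Finset.mem_univ, true_and]
    rw [heq]
    exact hω
  -- Only finitely many coins matter, and the bad patterns correspond to zeros of `Q` on a grid.
  have hbad : (bad.card : ℝ) ≤ d / 2 ^ b * (2 ^ b) ^ Fintype.card ι := by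
    let E := Fintype.equivFin ι
    let Q' := MvPolynomial.rename E Q
    have hQ' : Q' ≠ 0 := fun h =>
      hQ (MvPolynomial.rename_injective _ E.injective (by simpa using h))
    have hz := MvPolynomial.schwartz_zippel_totalDegree hQ' S
    have hle : bad.card ≤ (Finset.filter (fun f => MvPolynomial.eval f Q' = 0)
        (Fintype.piFinset fun _ => S)).card := by
      refine Finset.card_le_card_of_injOn (fun g x => finBitPoly fun i => g (E.symm x, i)) ?_ ?_
      · intro g hg
        have hg' := (Finset.mem_filter.1 hg).2
        refine Finset.mem_filter.2 ⟨Fintype.mem_piFinset.2 fun x =>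
          Finset.mem_image_of_mem _ (Finset.mem_univ _), ?_⟩
        rw [MvPolynomial.eval_rename]
        rw [← hg']
        congr 2
        funext x
        simp
      · intro g _ g' _ h
        funext ⟨x, i⟩
        have h0 : finBitPoly (fun i => g (E.symm (E x), i)) =
            finBitPoly fun i => g' (E.symm (E x), i) := congrFun h (E x)
        have h1 := (finBitPoly_injective b) h0
        simpa using congrFun h1 i
    have hdeg : Q'.totalDegree ≤ d := (MvPolynomial.totalDegree_rename_le _ _).trans hd
    have hz' : ((Finset.filter (fun f => MvPolynomial.eval f Q' = 0)
        (Fintype.piFinset fun _ => S)).card : ℝ) / ((2 : ℝ) ^ b) ^ Fintype.card ι ≤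
        Q'.totalDegree / (2 : ℝ) ^ b := by
      rw [hS] at hz
      have := (NNRat.cast_le (K := ℝ)).2 hz
      push_cast at this
      exact this
    rw [div_le_iff₀ (by positivity)] at hz'
    calc (bad.card : ℝ) ≤ _ := by exact_mod_cast hle
      _ ≤ _ := hz'
      _ ≤ _ := by
        gcongr
  calc _ ≤ RAM.coinMeasure.real (⋃ g ∈ bad, {ω : ℕ → Bool | ∀ j, ω (φ j) = g j}) :=
        measureReal_mono hsub (measure_ne_top _ _)
    _ ≤ ∑ g ∈ bad, RAM.coinMeasure.real {ω : ℕ → Bool | ∀ j, ω (φ j) = g j} :=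
        measureReal_biUnion_finset_le _ _
    _ = bad.card * (1 / 2 : ℝ) ^ (Fintype.card ι * b) := by
        rw [Finset.sum_congr rfl fun g _ => coinMeasure_cylinder hφ g]
        simp
    _ ≤ d / 2 ^ b * (2 ^ b) ^ Fintype.card ι * (1 / 2 : ℝ) ^ (Fintype.card ι * b) := by
        gcongr
    _ = d / 2 ^ b := by
        rw [mul_assoc, ← pow_mul, mul_comm b, ← mul_pow]
        norm_num

end Probability

/-! ### Reasoning about programs of the random access machine -/

namespace RAM

section Framework

/-- A factor `f` such that the value has at most `f * M` bits if all cells have at most `M` bits. -/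
def Expr.sizeFactor : Expr → ℕ
  | .lit k => k.size + 1
  | .get _ _ => 1
  | .op _ a b => a.sizeFactor + b.sizeFactor + 1

/-- A factor `f` such that the evaluation costs at most `f * M` if all cells have at most `M`
bits. -/
def Expr.costFactor : Expr → ℕ
  | .lit k => 1 + k.size
  | .get _ i => i.costFactor + 2
  | .op _ a b => a.costFactor + b.costFactor + (a.sizeFactor + b.sizeFactor + 2)

/-- A factor `f` such that each single step of the program costs at most `f * M`. -/
def Prog.costFactor : Prog → ℕ
  | .skip => 1
  | .set _ i e => 1 + i.costFactor + e.costFactor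
  | .flip _ => 1
  | .seq p q => p.costFactor + q.costFactor
  | .ite e p q => 1 + e.costFactor + p.costFactor + q.costFactor
  | .while e p => 1 + e.costFactor + p.costFactor

/-- Only the first `A` arrays, with indices below `M` and contents below `2 ^ M`, are in use. -/
def Store.Bounded (A M : ℕ) (σ : Store) : Prop :=
  ∀ x i, σ (x, i) ≠ 0 → x < A ∧ i < M ∧ σ (x, i) < 2 ^ M

theorem Store.Bounded.lt {A M : ℕ} {σ : Store} (h : σ.Bounded A M) (x i : ℕ) :
    σ (x, i) < 2 ^ M := by
  by_cases h0 : σ (x, i) = 0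
  · rw [h0]
    positivity
  · exact (h x i h0).2.2

theorem Op.size_eval_le (o : Op) (a b : ℕ) : (o.eval a b).size ≤ a.size + b.size + 1 := by
  have ha := Nat.lt_size_self a
  have hb := Nat.lt_size_self b
  have hpow : ∀ {x y : ℕ}, x ≤ y → 2 ^ x ≤ 2 ^ y := Nat.pow_le_pow_right two_pos
  have hle : ∀ {x : ℕ}, x ≤ a → x.size ≤ a.size + b.size + 1 := fun h =>
    (Nat.size_le_size h).trans (by omega)
  have hone : ∀ {x : ℕ}, x ≤ 1 → x.size ≤ a.size + b.size + 1 := fun h =>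
    (Nat.size_le_size h).trans (by simp)
  cases o with
  | add =>
    refine Nat.size_le.2 ?_
    have h1 := hpow (show a.size ≤ a.size + b.size by omega)
    have h2 := hpow (show b.size ≤ a.size + b.size by omega)
    simp only [Op.eval, pow_succ]
    omega
  | sub => exact hle (Nat.sub_le a b)
  | mul =>
    refine Nat.size_le.2 ?_
    refine (Nat.mul_lt_mul'' ha hb).trans_le ?_
    rw [← pow_add]
    exact hpow (by omega)
  | div => exact hle (Nat.div_le_self a b)
  | mod => exact hle (Nat.mod_le a b)
  | lt =>
    refine hone ?_
    simp only [Op.eval]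
    split_ifs <;> omega
  | eq =>
    refine hone ?_
    simp only [Op.eval]
    split_ifs <;> omega
  | xor =>
    refine Nat.size_le.2 (Nat.xor_lt_two_pow (ha.trans_le (hpow (by omega)))
      (hb.trans_le (hpow (by omega))))
  | and => exact hle Nat.and_le_left

theorem Expr.size_eval_le {A M : ℕ} (hM : 0 < M) {σ : Store} (hσ : σ.Bounded A M) (e : Expr) :
    (e.eval σ).size ≤ e.sizeFactor * M := by
  induction e with
  | lit k =>
    simp only [Expr.eval, Expr.sizeFactor]
    exact (Nat.le_succ _).trans (Nat.le_mul_of_pos_right _ hM)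
  | get x i _ =>
    simp only [Expr.eval, Expr.sizeFactor, one_mul]
    exact Nat.size_le.2 (hσ.lt _ _)
  | op o a b iha ihb =>
    simp only [Expr.eval, Expr.sizeFactor]
    refine (Op.size_eval_le _ _ _).trans ?_
    rw [add_mul, add_mul, one_mul]
    omega

theorem Expr.cost_le {A M : ℕ} (hM : 0 < M) {σ : Store} (hσ : σ.Bounded A M) (e : Expr) :
    e.cost σ ≤ e.costFactor * M := by
  induction e with
  | lit k =>
    simp only [Expr.cost, Expr.costFactor]
    exact Nat.le_mul_of_pos_right _ hM
  | get x i ih =>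
    simp only [Expr.cost, Expr.costFactor]
    have := Nat.size_le.2 (hσ.lt x (i.eval σ))
    rw [add_mul]
    omega
  | op o a b iha ihb =>
    simp only [Expr.cost, Expr.costFactor]
    have h1 := Op.size_eval_le o (a.eval σ) (b.eval σ)
    have h2 := a.size_eval_le hM hσ
    have h3 := b.size_eval_le hM hσ
    simp only [add_mul]
    omega

theorem Store.Bounded.space_le {A M : ℕ} {σ : Store} (h : σ.Bounded A M) :
    σ.space ≤ A * M * (A + 2 * M) := by
  have hsub : σ.support ⊆ Finset.range A ×ˢ Finset.range M := by
    rintro ⟨x, i⟩ hx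
    have := h x i (Finsupp.mem_support_iff.1 hx)
    simp [this.1, this.2.1]
  have hcard := Finset.card_le_card hsub
  rw [Finset.card_product, Finset.card_range, Finset.card_range] at hcard
  refine (Finset.sum_le_card_nsmul _ _ (A + 2 * M) ?_).trans ?_
  · rintro ⟨x, i⟩ hx
    have hx' := h x i (Finsupp.mem_support_iff.1 hx)
    have h1 : x.size ≤ x := Nat.size_le.2 Nat.lt_two_pow_self
    have h2 : i.size ≤ i := Nat.size_le.2 Nat.lt_two_pow_self
    have h3 := Nat.size_le.2 hx'.2.2
    simp only
    omega
  · rw [smul_eq_mul]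
    exact Nat.mul_le_mul_right _ hcard

/-- Write `v` into cell `i` of array `x`. -/
noncomputable def Config.upd (s : Config) (x i v : ℕ) : Config :=
  ⟨s.store.update (x, i) v, s.coins⟩

@[simp] theorem Config.upd_coins (s : Config) (x i v : ℕ) : (s.upd x i v).coins = s.coins := rfl

@[simp] theorem Config.upd_store (s : Config) (x i v y j : ℕ) :
    (s.upd x i v).store (y, j) = if y = x ∧ j = i then v else s.store (y, j) := by
  classical
  simp [Config.upd, Finsupp.coe_update, Function.update_apply]

theorem Store.Bounded.upd {A M : ℕ} {s : Config} (h : s.store.Bounded A M) {x i v : ℕ}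
    (hx : x < A) (hi : i < M) (hv : v < 2 ^ M) : (s.upd x i v).store.Bounded A M := by
  intro y j
  rw [Config.upd_store]
  split_ifs with hc
  · obtain ⟨rfl, rfl⟩ := hc
    exact fun _ => ⟨hx, hi, hv⟩
  · exact h y j

/-- The resources in terms of which programs are analysed: a bound `K` on the cost factors, the
number `A` of arrays, the bound `M` on indices and on bit lengths, and the random bits. -/
structure Env where
  K : ℕ
  A : ℕ
  M : ℕ
  bits : ℕ → Bool

/-- Total correctness within `n` steps: started in the bounded configuration `s`, the program halts
in a bounded configuration satisfying `Q`. -/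
def Runs (E : Env) (p : Prog) (n : ℕ) (Q : Config → Prop) (s : Config) : Prop :=
  p.costFactor ≤ E.K → s.store.Bounded E.A E.M → ∃ s' t m, Exec E.bits p s s' t m ∧
    t ≤ n * (E.K * E.M) ∧ m ≤ E.A * E.M * (E.A + 2 * E.M) + E.K * E.M ∧
    s'.store.Bounded E.A E.M ∧ Q s'

variable {E : Env} {Q : Config → Prop} {s : Config}

theorem Runs.mono {p : Prog} {n n' : ℕ} {Q' : Config → Prop} (h : Runs E p n Q s) (hn : n ≤ n')
    (hQ : ∀ s', Q s' → Q' s') : Runs E p n' Q' s := by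
  intro hK hs
  obtain ⟨s', t, m, he, ht, hm, hb, hq⟩ := h hK hs
  exact ⟨s', t, m, he, ht.trans (Nat.mul_le_mul_right _ hn), hm, hb, hQ _ hq⟩

theorem Runs.seq {p q : Prog} {n₁ n₂ : ℕ} (h : Runs E p n₁ (Runs E q n₂ Q) s) :
    Runs E (.seq p q) (n₁ + n₂) Q s := by
  intro hK hs
  have hK' : p.costFactor + q.costFactor ≤ E.K := hK
  obtain ⟨s₁, t₁, m₁, he₁, ht₁, hm₁, hb₁, h₁⟩ := h (by omega) hs
  obtain ⟨s₂, t₂, m₂, he₂, ht₂, hm₂, hb₂, h₂⟩ := h₁ (by omega) hb₁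
  refine ⟨s₂, _, _, .seq he₁ he₂, ?_, max_le hm₁ hm₂, hb₂, h₂⟩
  rw [add_mul]
  exact add_le_add ht₁ ht₂

theorem Runs.set (hM : 0 < E.M) {x : ℕ} {i e : Expr} (hx : x < E.A) (hi : i.eval s.store < E.M)
    (he : e.eval s.store < 2 ^ E.M) (hQ : Q (s.upd x (i.eval s.store) (e.eval s.store))) :
    Runs E (.set x i e) 1 Q s := by
  intro hK hs
  have hb := Store.Bounded.upd hs hx hi he
  have hi' := i.cost_le hM hs
  have he' := e.cost_le hM hs
  have hK' := Nat.mul_le_mul_right E.M hK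
  simp only [Prog.costFactor, add_mul, one_mul] at hK'
  have h1 := hs.space_le
  refine ⟨_, _, _, .set s x i e _ rfl, by omega, max_le (by omega) ?_, hb, hQ⟩
  exact hb.space_le.trans (by omega)

theorem Runs.set_eq (hM : 0 < E.M) {x i₀ v : ℕ} {i e : Expr} (hx : x < E.A)
    (hi : i.eval s.store = i₀) (he : e.eval s.store = v) (hi₀ : i₀ < E.M) (hv : v < 2 ^ E.M)
    (hQ : Q (s.upd x i₀ v)) : Runs E (.set x i e) 1 Q s := by
  subst hi he
  exact Runs.set hM hx hi₀ hv hQ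

theorem Runs.flip (hM : 0 < E.M) {x : ℕ} (hx : x < E.A)
    (hQ : Q ⟨(s.upd x 0 (E.bits s.coins).toNat).store, s.coins + 1⟩) :
    Runs E (.flip x) 1 Q s := by
  intro hK hs
  have hv : (E.bits s.coins).toNat < 2 ^ E.M := by
    have : 2 ^ 1 ≤ 2 ^ E.M := Nat.pow_le_pow_right two_pos hM
    have := (E.bits s.coins).toNat_le
    omega
  have hb := Store.Bounded.upd hs hx hM hv
  have hK' := Nat.mul_le_mul hK hM
  simp only [Prog.costFactor, one_mul] at hK'
  refine ⟨_, _, _, .flip s x _ rfl, by omega, max_le ?_ ?_, hb, hQ⟩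
  · exact hs.space_le.trans (by omega)
  · exact hb.space_le.trans (by omega)

/-- Content of cell `0` of array `x`: the arrays whose cell `0` only is used play the role of
variables. -/
abbrev Expr.var (x : ℕ) : Expr := .get x (.lit 0)

/-- `for i := 0, …, e - 1 do p`. -/
def forLoop (i : ℕ) (e : Expr) (p : Prog) : Prog :=
  .seq (.set i (.lit 0) (.lit 0)) (.while (.op .lt (.var i) e)
    (.seq p (.set i (.lit 0) (.op .add (.var i) (.lit 1)))))

/-- The loop rule: `I j` holds when the loop variable `i` has the value `j`. -/
theorem Runs.for (hM : 0 < E.M) {i : ℕ} {e : Expr} {p : Prog} {n N : ℕ} (I : ℕ → Config → Prop)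
    (hi : i < E.A) (hN : N < 2 ^ E.M) (h0 : I 0 (s.upd i 0 0))
    (hcount : ∀ j ≤ N, ∀ s', I j s' → s'.store (i, 0) = j ∧ e.eval s'.store = N)
    (hbody : ∀ j < N, ∀ s', I j s' →
      Runs E p n (fun s'' => s''.store (i, 0) = j ∧ I (j + 1) (s''.upd i 0 (j + 1))) s')
    (hQ : ∀ s', I N s' → Q s') : Runs E (forLoop i e p) (N * (n + 2) + 2) Q s := by
  have hbody' : ∀ j < N, ∀ s', I j s' →
      Runs E (.seq p (.set i (.lit 0) (.op .add (.var i) (.lit 1)))) (n + 1) (I (j + 1)) s' := by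
    intro j hj s' hs'
    refine Runs.seq ((hbody j hj s' hs').mono le_rfl fun s'' h => ?_)
    refine Runs.set hM hi (by simpa [Expr.eval] using hM) ?_ ?_
    · simp only [Expr.eval, Op.eval, h.1]
      omega
    · simpa only [Expr.eval, Op.eval, h.1] using h.2
  have hwhile : ∀ l j s', j + l = N → I j s' →
      Runs E (.while (.op .lt (.var i) e) (.seq p (.set i (.lit 0) (.op .add (.var i) (.lit 1)))))
        (l * (n + 2) + 1) Q s' := by
    intro l
    induction l with
    | zero =>
      intro j s' hj hI hK hs
      obtain rfl : j = N := by omega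
      have hc := hcount j le_rfl s' hI
      have hcost := (Expr.op .lt (.var i) e).cost_le hM hs
      have hK' := Nat.mul_le_mul_right E.M hK
      rw [Prog.costFactor, add_mul, add_mul, one_mul] at hK'
      refine ⟨s', _, _, .while_false ?_, by omega, ?_, hs, hQ s' hI⟩
      · simp [Expr.eval, Op.eval, hc.1, hc.2]
      · exact add_le_add hs.space_le (by omega)
    | succ l ih =>
      intro j s' hj hI hK hs
      have hc := hcount j (by omega) s' hI
      have hcost := (Expr.op .lt (.var i) e).cost_le hM hs
      have hK' := Nat.mul_le_mul_right E.M hK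
      have hK₁ := hK
      rw [Prog.costFactor] at hK₁
      rw [Prog.costFactor, add_mul, add_mul, one_mul] at hK'
      obtain ⟨s₁, t₁, m₁, he₁, ht₁, hm₁, hb₁, hI₁⟩ :=
        hbody' j (by omega) s' hI (by omega) hs
      obtain ⟨s₂, t₂, m₂, he₂, ht₂, hm₂, hb₂, hq⟩ := ih (j + 1) s₁ (by omega) hI₁ hK hb₁
      refine ⟨s₂, _, _, .while_true ?_ he₁ he₂, ?_, max_le ?_ (max_le hm₁ hm₂), hb₂, hq⟩
      · simp [Expr.eval, Op.eval, hc.1, hc.2, show j < N by omega]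
      · have : ((l + 1) * (n + 2) + 1) * (E.K * E.M) =
            (n + 1) * (E.K * E.M) + (l * (n + 2) + 1) * (E.K * E.M) + E.K * E.M := by ring
        omega
      · exact add_le_add hs.space_le (by omega)
  have : N * (n + 2) + 2 = 1 + (N * (n + 2) + 1) := by ring
  rw [this]
  refine Runs.seq (Runs.set hM hi (by simpa [Expr.eval] using hM) ?_ ?_)
  · simp [Expr.eval]
  · exact hwhile N 0 _ (by omega) h0

/-- Outside the arrays in `S` the configurations agree, and no random bits are consumed. -/
def Agree (S : List ℕ) (s s' : Config) : Prop :=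
  s'.coins = s.coins ∧ ∀ x, x ∉ S → ∀ i, s'.store (x, i) = s.store (x, i)

theorem Agree.upd {S : List ℕ} {s s' : Config} (h : Agree S s s') {x : ℕ} (hx : x ∈ S)
    (i v : ℕ) : Agree S s (s'.upd x i v) := by
  refine ⟨h.1, fun y hy j => ?_⟩
  rw [Config.upd_store, if_neg, h.2 y hy j]
  rintro ⟨rfl, -⟩
  exact hy hx

theorem Agree.refl (S : List ℕ) (s : Config) : Agree S s s := ⟨rfl, fun _ _ _ => rfl⟩

theorem Agree.mono {S S' : List ℕ} {s s' : Config} (h : Agree S s s') (hS : S ⊆ S') :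
    Agree S' s s' :=
  ⟨h.1, fun x hx => h.2 x fun h' => hx (hS h')⟩

theorem Agree.trans {S : List ℕ} {s₁ s₂ s₃ : Config} (h : Agree S s₁ s₂)
    (h' : Agree S s₂ s₃) : Agree S s₁ s₃ :=
  ⟨h'.1.trans h.1, fun x hx i => (h'.2 x hx i).trans (h.2 x hx i)⟩

theorem lt_two_pow_of_le {v M : ℕ} (h : v ≤ M) : v < 2 ^ M := h.trans_lt Nat.lt_two_pow_self

instance : Add Expr := ⟨.op .add⟩
instance : Sub Expr := ⟨.op .sub⟩
instance : Mul Expr := ⟨.op .mul⟩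
instance : Div Expr := ⟨.op .div⟩
instance : Mod Expr := ⟨.op .mod⟩
instance : XorOp Expr := ⟨.op .xor⟩
instance : AndOp Expr := ⟨.op .and⟩
instance (k : ℕ) [OfNat ℕ k] : OfNat Expr k := ⟨.lit (OfNat.ofNat k)⟩

/-- `1` if `a < b` and `0` otherwise. -/
abbrev Expr.lt (a b : Expr) : Expr := .op .lt a b
/-- `1` if `a = b` and `0` otherwise. -/
abbrev Expr.eq (a b : Expr) : Expr := .op .eq a b

section Eval

variable (σ : Store) (a b : Expr)

@[simp] theorem Expr.eval_lit (k : ℕ) : (Expr.lit k).eval σ = k := rfl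
@[simp] theorem Expr.eval_zero : (0 : Expr).eval σ = 0 := rfl
@[simp] theorem Expr.eval_one : (1 : Expr).eval σ = 1 := rfl
@[simp] theorem Expr.eval_two : (2 : Expr).eval σ = 2 := rfl
@[simp] theorem Expr.eval_get (x : ℕ) : (Expr.get x a).eval σ = σ (x, a.eval σ) := rfl
@[simp] theorem Expr.eval_add : (a + b).eval σ = a.eval σ + b.eval σ := rfl
@[simp] theorem Expr.eval_sub : (a - b).eval σ = a.eval σ - b.eval σ := rfl
@[simp] theorem Expr.eval_mul : (a * b).eval σ = a.eval σ * b.eval σ := rfl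
@[simp] theorem Expr.eval_div : (a / b).eval σ = a.eval σ / b.eval σ := rfl
@[simp] theorem Expr.eval_mod : (a % b).eval σ = a.eval σ % b.eval σ := rfl
@[simp] theorem Expr.eval_xor : (a ^^^ b).eval σ = a.eval σ ^^^ b.eval σ := rfl
@[simp] theorem Expr.eval_and : (a &&& b).eval σ = a.eval σ &&& b.eval σ := rfl
@[simp] theorem Expr.eval_lt : (Expr.lt a b).eval σ = if a.eval σ < b.eval σ then 1 else 0 := rfl
@[simp] theorem Expr.eval_eq : (Expr.eq a b).eval σ = if a.eval σ = b.eval σ then 1 else 0 := rfl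

end Eval

end Framework

end RAM

/-! ### The program: reading the graph

The arrays of the program have names, which are notations for their numbers. The input is in `aN`
(the number of vertices), `aAdj` (the adjacency matrix, row by row) and `aDom` (the characteristic
vector of the dominating set). The other arrays hold
* degrees, maximum degree, degree sum: `aDeg`, `aMax`, `aSum`;
* the chosen neighbours: `aPar`; the masks of the sieved edges: `aSel`; the number `r` of sieved
  edges, and `2 ^ r`: `aCnt`, `aPow`;
* the last coin, and the random polynomials: `aCoin`, `aY`;
* the parameters `N`, `b`, `L`, `Z`, `T`, `Nt` of `Params`: `aSize`, `aBits`, `aL`, `aZ`, `aT`,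
  `aNt`;
* the powers of two that encode `X`, `X ^ L`, `X ^ (L * (Z + 1))` and `X ^ (L * T)`, and the digit
  mask: `aW`, `aXL`, `aXZ`, `aP`, `aMask`;
* the weights of the links, and the masks of their edges: `aWt`, `aSb`;
* the matrix, the inverse of the pivot, the determinant, the sum of the determinants: `aB`, `aInv`,
  `aDet`, `aAcc`;
* loop variables: `aI` for all inner loops, `aA` for the sets of sieved edges, `aG` for the pivots.
-/

namespace RAM

notation "aN" => (0 : ℕ)
notation "aAdj" => (1 : ℕ)
notation "aDom" => (2 : ℕ)
notation "aDeg" => (3 : ℕ)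
notation "aMax" => (4 : ℕ)
notation "aSum" => (5 : ℕ)
notation "aPar" => (6 : ℕ)
notation "aSel" => (7 : ℕ)
notation "aCnt" => (8 : ℕ)
notation "aPow" => (9 : ℕ)
notation "aCoin" => (10 : ℕ)
notation "aY" => (11 : ℕ)
notation "aW" => (12 : ℕ)
notation "aXL" => (13 : ℕ)
notation "aXZ" => (14 : ℕ)
notation "aP" => (15 : ℕ)
notation "aMask" => (16 : ℕ)
notation "aWt" => (17 : ℕ)
notation "aSb" => (18 : ℕ)
notation "aB" => (19 : ℕ)
notation "aInv" => (20 : ℕ)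
notation "aDet" => (21 : ℕ)
notation "aAcc" => (22 : ℕ)
notation "aSize" => (23 : ℕ)
notation "aBits" => (24 : ℕ)
notation "aL" => (25 : ℕ)
notation "aZ" => (26 : ℕ)
notation "aT" => (27 : ℕ)
notation "aNt" => (28 : ℕ)
notation "aI" => (29 : ℕ)
notation "aA" => (30 : ℕ)
notation "aG" => (31 : ℕ)

open RAM.Expr

/-- Degrees, and their sum. -/
def degProg : Prog :=
  forLoop aI (var aN * var aN) (.seq
    (.set aDeg (var aI / var aN) (get aDeg (var aI / var aN) + get aAdj (var aI)))
    (.set aSum 0 (var aSum + get aAdj (var aI))))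

/-- The maximum degree. -/
def maxProg : Prog :=
  forLoop aI (var aN) (.set aMax 0 (var aMax + (get aDeg (var aI) - var aMax)))

/-- `1` if index `i = v * n + u` belongs to an edge `vu` with `v` outside and `u` inside the
dominating set. -/
def parCond : Expr :=
  get aAdj (var aI) * get aDom (var aI % var aN) * (1 - get aDom (var aI / var aN))

/-- For each `v` outside the dominating set, one plus a neighbour of `v` inside it. -/
def parProg : Prog :=
  forLoop aI (var aN * var aN) (.set aPar (var aI / var aN)
    (parCond * (var aI % var aN + 1) + (1 - parCond) * get aPar (var aI / var aN)))

/-- `1` if index `i = u * n + v` with `u < v` belongs to an edge to be sieved. -/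
def selCond : Expr :=
  get aAdj (var aI) * lt (var aI / var aN) (var aI % var aN) *
    (1 - (eq (get aPar (var aI / var aN)) (var aI % var aN + 1) +
      eq (get aPar (var aI % var aN)) (var aI / var aN + 1)))

/-- Enumerate the sieved edges: the `j`-th one receives the mask `2 ^ j`. -/
def selProg : Prog :=
  .seq (.set aPow 0 1) (forLoop aI (var aN * var aN) (.seq
    (.set aSel (var aI) (selCond * var aPow)) (.seq
    (.set aPow 0 (var aPow + selCond * var aPow))
    (.set aCnt 0 (var aCnt + selCond)))))

variable {E : Env} {s : Config}

theorem runs_degProg {n : ℕ} {a : ℕ → ℕ} (hA : 32 ≤ E.A) (hM : n * n + n + 2 ≤ E.M)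
    (hn : s.store (aN, 0) = n) (ha : ∀ i, s.store (aAdj, i) = a i) (ha1 : ∀ i, a i ≤ 1)
    (hd : ∀ i, s.store (aDeg, i) = 0) (hs : s.store (aSum, 0) = 0) :
    Runs E degProg (n * n * 4 + 2) (fun s' => Agree [aI, aDeg, aSum] s s' ∧
      (∀ v, s'.store (aDeg, v) = ∑ i ∈ Finset.range (n * n), if i / n = v then a i else 0) ∧
      s'.store (aSum, 0) = ∑ i ∈ Finset.range (n * n), a i) s := by
  have hle : ∀ j ≤ n * n, ∀ v, (∑ i ∈ Finset.range j, if i / n = v then a i else 0) ≤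
      ∑ i ∈ Finset.range j, a i := fun j _ v => Finset.sum_le_sum fun i _ => by
    split_ifs <;> simp
  have hle2 : ∀ j, ∑ i ∈ Finset.range j, a i ≤ j := fun j =>
    (Finset.sum_le_card_nsmul _ _ 1 fun i _ => ha1 i).trans (by simp)
  refine Runs.for (n := 1 + 1) (by omega) (fun j s' => Agree [aI, aDeg, aSum] s s' ∧
      s'.store (aI, 0) = j ∧
      (∀ v, s'.store (aDeg, v) = ∑ i ∈ Finset.range j, if i / n = v then a i else 0) ∧
      s'.store (aSum, 0) = ∑ i ∈ Finset.range j, a i) (by omega)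
      (N := n * n) (lt_two_pow_of_le (by omega)) ?_ ?_ ?_ ?_
  · exact ⟨(Agree.refl _ s).upd (by decide) _ _, by simp, by simp [hd], by simp [hs]⟩
  · rintro j - s' ⟨hag, hj, -⟩
    simp [hj, hag.2 aN (by decide), hn]
  · rintro j hjn s' ⟨hag, hj, h3, h5⟩
    have e0 : s'.store (aN, 0) = n := by rw [hag.2 aN (by decide), hn]
    have e1 : s'.store (aAdj, j) = a j := by rw [hag.2 aAdj (by decide), ha]
    have hjle := ha1 j
    have h1 := hle j hjn.le (j / n)
    have h2 := hle2 j
    have h4 := Nat.div_le_self j n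
    refine Runs.seq (Runs.set_eq (by omega) (by omega) (i₀ := j / n)
      (v := (∑ i ∈ Finset.range j, if i / n = j / n then a i else 0) + a j)
      (by simp [hj, e0]) (by simp [hj, e0, e1, h3]) (by omega) (lt_two_pow_of_le (by omega)) ?_)
    refine Runs.set_eq (by omega) (by omega) (i₀ := 0) (v := (∑ i ∈ Finset.range j, a i) + a j)
      (by simp) (by simp [hj, e1, h5]) (by omega) (lt_two_pow_of_le (by omega)) ?_
    refine ⟨by simp [hj], ((hag.upd (by decide) _ _).upd (by decide) _ _).upd (by decide) _ _,
      by simp, fun v => ?_, by simp [Finset.sum_range_succ]⟩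
    rw [Finset.sum_range_succ]
    by_cases hv : v = j / n
    · subst hv
      simp
    · simp [hv, Ne.symm hv, h3]
  · rintro s' ⟨hag, -, h3, h5⟩
    exact ⟨hag, h3, h5⟩

theorem runs_maxProg {n : ℕ} {d : ℕ → ℕ} (hA : 32 ≤ E.A) (hM : n * n + n + 2 ≤ E.M)
    (hn : s.store (aN, 0) = n) (hd : ∀ v < n, s.store (aDeg, v) = d v) (hdn : ∀ v < n, d v ≤ n)
    (hk : s.store (aMax, 0) = 0) :
    Runs E maxProg (n * 3 + 2) (fun s' => Agree [aI, aMax] s s' ∧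
      s'.store (aMax, 0) = (Finset.range n).sup d) s := by
  refine Runs.for (by omega) (fun j s' => Agree [aI, aMax] s s' ∧ s'.store (aI, 0) = j ∧
      s'.store (aMax, 0) = (Finset.range j).sup d) (by omega)
      (N := n) (lt_two_pow_of_le (by omega)) ?_ ?_ ?_ ?_
  · exact ⟨(Agree.refl _ s).upd (by decide) _ _, by simp, by simp [hk]⟩
  · rintro j - s' ⟨hag, hj, -⟩
    simp [hj, hag.2 aN (by decide), hn]
  · rintro j hjn s' ⟨hag, hj, h4⟩
    have e3 : s'.store (aDeg, j) = d j := by rw [hag.2 aDeg (by decide), hd j hjn]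
    have hsup : (Finset.range (j + 1)).sup d = (Finset.range j).sup d +
        (d j - (Finset.range j).sup d) := by
      rw [Finset.range_add_one, Finset.sup_insert]
      omega
    have hle : (Finset.range (j + 1)).sup d ≤ n := Finset.sup_le fun v hv =>
      hdn v (by have := Finset.mem_range.1 hv; omega)
    refine Runs.set_eq (by omega) (by omega) (i₀ := 0) (v := (Finset.range (j + 1)).sup d)
      (by simp) (by simp [hj, e3, h4, hsup]) (by omega) (lt_two_pow_of_le (by omega)) ?_
    exact ⟨by simp [hj], (hag.upd (by decide) _ _).upd (by decide) _ _, by simp, by simp⟩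
  · rintro s' ⟨hag, -, h4⟩
    exact ⟨hag, h4⟩

/-- `parent n a dom j v` is one plus the last `u` such that `n * v + u < j`, the vertices `v` and
`u` are adjacent, `v` lies outside and `u` lies inside the dominating set, and `0` if there is no
such `u`. -/
def parent (n : ℕ) (a dom : ℕ → ℕ) : ℕ → ℕ → ℕ
  | 0, _ => 0
  | j + 1, v => if v = j / n ∧ a j = 1 ∧ dom (j % n) = 1 ∧ dom v = 0 then j % n + 1 else
      parent n a dom j v

theorem parent_spec {n : ℕ} (hn : 0 < n) (a dom : ℕ → ℕ) (j v : ℕ) : parent n a dom j v = 0 ∨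
    ∃ u < n, parent n a dom j v = u + 1 ∧ a (n * v + u) = 1 ∧ dom u = 1 ∧ dom v = 0 := by
  induction j with
  | zero => exact .inl rfl
  | succ j ih =>
    rw [parent]
    split_ifs with h
    · obtain ⟨rfl, h1, h2, h3⟩ := h
      exact .inr ⟨j % n, Nat.mod_lt _ hn, rfl, by rwa [Nat.div_add_mod], h2, h3⟩
    · exact ih

theorem parent_ne_zero {n : ℕ} {a dom : ℕ → ℕ} {v u : ℕ} (hv : v < n) (hu : u < n)
    (h1 : a (n * v + u) = 1) (h2 : dom u = 1) (h3 : dom v = 0) :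
    parent n a dom (n * n) v ≠ 0 := by
  have hdiv : (n * v + u) / n = v := by
    rw [Nat.mul_add_div (by omega), Nat.div_eq_of_lt hu, add_zero]
  have hmod : (n * v + u) % n = u := by
    rw [Nat.mul_add_mod, Nat.mod_eq_of_lt hu]
  have : ∀ j, n * v + u < j → parent n a dom j v ≠ 0 := by
    intro j hj
    induction j with
    | zero => omega
    | succ j ih =>
      rw [parent]
      split_ifs with h
      · exact Nat.succ_ne_zero _
      · refine ih (lt_of_le_of_ne (by omega) ?_)
        rintro rfl
        exact h ⟨hdiv.symm, h1, by rwa [hmod], h3⟩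
  exact this _ (by nlinarith)

theorem runs_parProg {n : ℕ} {a dom : ℕ → ℕ} (hA : 32 ≤ E.A) (hM : n * n + n + 2 ≤ E.M)
    (hn : s.store (aN, 0) = n) (ha : ∀ i, s.store (aAdj, i) = a i)
    (hdom : ∀ i, s.store (aDom, i) = dom i) (ha1 : ∀ i, a i ≤ 1) (hdom1 : ∀ i, dom i ≤ 1)
    (hp : ∀ i, s.store (aPar, i) = 0) :
    Runs E parProg (n * n * 3 + 2) (fun s' => Agree [aI, aPar] s s' ∧
      ∀ v, s'.store (aPar, v) = parent n a dom (n * n) v) s := by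
  refine Runs.for (by omega) (fun j s' => Agree [aI, aPar] s s' ∧ s'.store (aI, 0) = j ∧
      ∀ v, s'.store (aPar, v) = parent n a dom j v) (by omega)
      (N := n * n) (lt_two_pow_of_le (by omega)) ?_ ?_ ?_ ?_
  · exact ⟨(Agree.refl _ s).upd (by decide) _ _, by simp, by simp [hp, parent]⟩
  · rintro j - s' ⟨hag, hj, -⟩
    simp [hj, hag.2 aN (by decide), hn]
  · rintro j hjn s' ⟨hag, hj, h6⟩
    have hn0 : 0 < n := Nat.pos_of_mul_pos_right (Nat.zero_lt_of_lt hjn)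
    have e0 : s'.store (aN, 0) = n := by rw [hag.2 aN (by decide), hn]
    have e1 : s'.store (aAdj, j) = a j := by rw [hag.2 aAdj (by decide), ha]
    have e2 : ∀ i, s'.store (aDom, i) = dom i := fun i => by rw [hag.2 aDom (by decide), hdom]
    have hdiv := Nat.div_le_self j n
    have hple : parent n a dom (j + 1) (j / n) ≤ n := by
      rcases parent_spec hn0 a dom (j + 1) (j / n) with h | ⟨u, hu, h, -⟩ <;> omega
    refine Runs.set_eq (by omega) (by omega) (i₀ := j / n)
      (v := parent n a dom (j + 1) (j / n)) (by simp [hj, e0]) ?_ (by omega)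
      (lt_two_pow_of_le (by omega)) ?_
    · simp only [parCond, eval_add, eval_mul, eval_sub, eval_mod, eval_div, eval_get, eval_lit,
        eval_one, hj, e0, e1, e2, h6, parent]
      have h1 := ha1 j
      have h2 := hdom1 (j % n)
      have h3 := hdom1 (j / n)
      interval_cases a j <;> interval_cases dom (j % n) <;> interval_cases dom (j / n) <;> simp
    · refine ⟨by simp [hj], (hag.upd (by decide) _ _).upd (by decide) _ _, by simp, fun v => ?_⟩
      by_cases hv : v = j / n
      · subst hv
        simp
      · simp [hv, h6, parent]
  · rintro s' ⟨hag, -, h6⟩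
    exact ⟨hag, h6⟩

theorem runs_selProg {n : ℕ} {a p : ℕ → ℕ} {c : ℕ → ℕ} (hA : 32 ≤ E.A)
    (hM : n * n + n + 2 ≤ E.M)
    (hn : s.store (aN, 0) = n) (ha : ∀ i, s.store (aAdj, i) = a i)
    (hp : ∀ i, s.store (aPar, i) = p i)
    (hc : ∀ i, c i = a i * (if i / n < i % n then 1 else 0) *
      (1 - ((if p (i / n) = i % n + 1 then 1 else 0) + if p (i % n) = i / n + 1 then 1 else 0)))
    (hc1 : ∀ i, c i ≤ 1) (hr : s.store (aCnt, 0) = 0) (hsel : ∀ i, s.store (aSel, i) = 0) :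
    Runs E selProg (n * n * 5 + 3) (fun s' => Agree [aI, aSel, aPow, aCnt] s s' ∧
      (∀ i, s'.store (aSel, i) =
        if i < n * n then c i * 2 ^ ∑ j ∈ Finset.range i, c j else 0) ∧
      s'.store (aCnt, 0) = ∑ j ∈ Finset.range (n * n), c j ∧
      s'.store (aPow, 0) = 2 ^ ∑ j ∈ Finset.range (n * n), c j) s := by
  have hle : ∀ j, ∑ i ∈ Finset.range j, c i ≤ j := fun j =>
    (Finset.sum_le_card_nsmul _ _ 1 fun i _ => hc1 i).trans (by simp)
  rw [show n * n * 5 + 3 = 1 + (n * n * 5 + 2) by ring]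
  refine Runs.seq (Runs.set_eq (by omega) (by omega) (i₀ := 0) (v := 1) (by simp) (by simp)
    (by omega) (lt_two_pow_of_le (by omega)) ?_)
  refine Runs.for (n := 1 + (1 + 1)) (by omega) (fun j s' => Agree [aI, aSel, aPow, aCnt] s s' ∧
      s'.store (aI, 0) = j ∧
      (∀ i, s'.store (aSel, i) =
        if i < j then c i * 2 ^ ∑ j ∈ Finset.range i, c j else 0) ∧
      s'.store (aCnt, 0) = ∑ i ∈ Finset.range j, c i ∧
      s'.store (aPow, 0) = 2 ^ ∑ i ∈ Finset.range j, c i) (by omega)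
      (N := n * n) (lt_two_pow_of_le (by omega)) ?_ ?_ ?_ ?_
  · exact ⟨((Agree.refl _ s).upd (by decide) _ _).upd (by decide) _ _, by simp, by simp [hsel],
      by simp [hr], by simp⟩
  · rintro j - s' ⟨hag, hj, -⟩
    simp [hj, hag.2 aN (by decide), hn]
  · rintro j hjn s' ⟨hag, hj, h7, h8, h9⟩
    have e0 : s'.store (aN, 0) = n := by rw [hag.2 aN (by decide), hn]
    have e1 : s'.store (aAdj, j) = a j := by rw [hag.2 aAdj (by decide), ha]
    have e6 : ∀ i, s'.store (aPar, i) = p i := fun i => by rw [hag.2 aPar (by decide), hp]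
    have hcj : selCond.eval s'.store = c j := by
      simp [selCond, hj, e0, e1, e6, hc]
    have hcj' : ∀ v, selCond.eval (s'.upd aSel j v).store = c j := by
      intro v
      simp [selCond, hj, e0, e1, e6, hc]
    have hcj'' : ∀ v w, selCond.eval ((s'.upd aSel j v).upd aPow 0 w).store = c j := by
      intro v w
      simp [selCond, hj, e0, e1, e6, hc]
    have hlej := hle j
    have hcle := hc1 j
    have hpow : 2 ^ ∑ i ∈ Finset.range j, c i < 2 ^ E.M :=
      Nat.pow_lt_pow_right one_lt_two (by omega)
    have hpow2 : 2 ^ ∑ i ∈ Finset.range (j + 1), c i < 2 ^ E.M :=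
      Nat.pow_lt_pow_right one_lt_two (by have := hle (j + 1); omega)
    have hstep : 2 ^ ∑ i ∈ Finset.range (j + 1), c i =
        2 ^ (∑ i ∈ Finset.range j, c i) + c j * 2 ^ ∑ i ∈ Finset.range j, c i := by
      rw [Finset.sum_range_succ, pow_add]
      obtain h | h : c j = 0 ∨ c j = 1 := by omega
      · simp [h]
      · rw [h]
        ring
    refine Runs.seq (Runs.set_eq (by omega) (by omega) (i₀ := j)
      (v := c j * 2 ^ ∑ i ∈ Finset.range j, c i) (by simp [hj])
      (by rw [eval_mul, hcj]; simp [h9]) (by omega) ?_ ?_)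
    · exact (Nat.mul_le_mul_right _ hcle).trans_lt (by rwa [one_mul])
    refine Runs.seq (Runs.set_eq (by omega) (by omega) (i₀ := 0)
      (v := 2 ^ ∑ i ∈ Finset.range (j + 1), c i) (by simp)
      (by rw [eval_add, eval_mul, hcj', hstep]; simp [h9]) (by omega) hpow2 ?_)
    refine Runs.set_eq (by omega) (by omega) (i₀ := 0)
      (v := ∑ i ∈ Finset.range (j + 1), c i) (by simp)
      (by rw [eval_add, hcj'', Finset.sum_range_succ]; simp [h8]) (by omega)
      (lt_two_pow_of_le (by have := hle (j + 1); omega)) ?_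
    refine ⟨by simp [hj], (((hag.upd (by decide) _ _).upd (by decide) _ _).upd (by decide) _ _).upd
      (by decide) _ _, by simp, fun i => ?_, by simp, by simp⟩
    by_cases hi : i = j
    · subst hi
      simp
    · have : i < j + 1 ↔ i < j := by omega
      simp [hi, h7, this]
  · rintro s' ⟨hag, -, h7, h8, h9⟩
    exact ⟨hag, h7, h8, h9⟩

end RAM

/-! ### The program: parameters, random bits and weights -/

namespace RAM

open RAM.Expr

/-- The numbers on which the parameters of the algorithm depend: the number `n` of vertices, the
maximum degree `k`, the number `r` of sieved edges, the sum `d` of the degrees, and the constant `c`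
of the error bound. -/
structure Params where
  n : ℕ
  k : ℕ
  r : ℕ
  d : ℕ
  c : ℕ

namespace Params

variable (q : Params)

/-- The number of indices of the blow-up. -/
def N : ℕ := 2 * q.k * q.n
/-- The number of random bits of a weight. -/
def b : ℕ := (q.c + 3) * (q.n + 1)
/-- Exponents count in units of `L`, beyond the degrees of all products of weights. -/
def L : ℕ := q.N * q.b + 1
/-- The extra exponent of sieved edges. -/
def Z : ℕ := q.N + 1
/-- The critical exponent. -/
def T : ℕ := 2 * q.Z * q.r + (q.N - q.d)
/-- Polynomials are truncated at degree `Nt`, which is also the length in bits of the digits that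
hold their coefficients. -/
def Nt : ℕ := q.L * (q.T + q.Z + 2)
/-- A bound on all indices and bit lengths that occur. -/
def bound : ℕ :=
  q.Nt * q.Nt + q.Nt + q.N * q.N * q.b + q.N * q.N + q.b + q.n * q.n + q.n + q.r + 10

theorem b_pos : 0 < q.b := Nat.mul_pos (by omega) (by omega)

theorem L_pos : 0 < q.L := Nat.succ_pos _

theorem le_Nt : q.L * (q.T + q.Z + 2) ≤ q.Nt := le_rfl

theorem Nt_pos : 0 < q.Nt := Nat.mul_pos q.L_pos (by omega)

theorem T_le : q.T ≤ q.Nt :=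
  le_trans (by omega) (Nat.le_mul_of_pos_left (q.T + q.Z + 2) q.L_pos)

theorem Z_lt : q.Z < q.Nt :=
  lt_of_lt_of_le (by omega) (Nat.le_mul_of_pos_left (q.T + q.Z + 2) q.L_pos)

theorem N_lt : q.N < q.Nt := (Nat.lt_succ_self _).trans q.Z_lt

theorem L_le : q.L ≤ q.Nt := Nat.le_mul_of_pos_right _ (by omega)

theorem b_le (h : 0 < q.N) : q.b ≤ q.Nt :=
  (Nat.le_mul_of_pos_left q.b h).trans ((Nat.le_succ _).trans q.L_le)

end Params

/-- Compute the parameters. -/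
def paramProg (c : ℕ) : Prog :=
  .seq (.set aSize 0 (2 * var aMax * var aN)) (.seq
  (.set aBits 0 (.lit (c + 3) * (var aN + 1))) (.seq
  (.set aL 0 (var aSize * var aBits + 1)) (.seq
  (.set aZ 0 (var aSize + 1)) (.seq
  (.set aT 0 (2 * var aZ * var aCnt + (var aSize - var aSum)))
  (.set aNt 0 (var aL * (var aT + var aZ + 2)))))))

/-- `dst := base ^ cnt`. -/
def powProg (dst : ℕ) (base cnt : Expr) : Prog :=
  .seq (.set dst 0 1) (forLoop aI cnt (.set dst 0 (var dst * base)))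

/-- The powers of two by which polynomials are shifted, and the mask of their digits. -/
def shiftProg : Prog :=
  .seq (powProg aW 2 (var aNt)) (.seq
  (powProg aXL (var aW) (var aL)) (.seq
  (powProg aXZ (var aXL) (var aZ + 1)) (.seq
  (powProg aP (var aXL) (var aT)) (.seq
  (powProg aMask (var aW) (var aNt))
  (.set aMask 0 ((var aMask - 1) / (var aW - 1)))))))

/-- Toss the coins for the weights. -/
def coinProg : Prog :=
  forLoop aI (var aSize * var aSize * var aBits) (.seq (.flip aCoin)
    (.set aY (var aI / var aBits) (get aY (var aI / var aBits) * var aW + var aCoin)))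

variable {E : Env} {s : Config}

theorem runs_paramProg (q : Params) (hA : 32 ≤ E.A) (hM : q.bound ≤ E.M)
    (hn : s.store (aN, 0) = q.n) (hk : s.store (aMax, 0) = q.k) (hr : s.store (aCnt, 0) = q.r)
    (hd : s.store (aSum, 0) = q.d) :
    Runs E (paramProg q.c) 6 (fun s' => Agree [aSize, aBits, aL, aZ, aT, aNt] s s' ∧
      s'.store (aSize, 0) = q.N ∧ s'.store (aBits, 0) = q.b ∧ s'.store (aL, 0) = q.L ∧
      s'.store (aZ, 0) = q.Z ∧ s'.store (aT, 0) = q.T ∧ s'.store (aNt, 0) = q.Nt) s := by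
  have hbd : q.bound = q.Nt * q.Nt + q.Nt + q.N * q.N * q.b + q.N * q.N + q.b + q.n * q.n + q.n +
    q.r + 10 := rfl
  have h1 := q.N_lt
  have h2 := q.L_le
  have h3 := q.Z_lt
  have h4 := q.T_le
  have hag := Agree.refl [aSize, aBits, aL, aZ, aT, aNt] s
  refine Runs.seq (n₁ := 1) (n₂ := 5) (Runs.set_eq (v := q.N) (i₀ := 0) (by omega) (by omega)
    (by simp) (by simp [hk, hn, Params.N]) (by omega) (lt_two_pow_of_le (by omega)) ?_)
  refine Runs.seq (n₁ := 1) (n₂ := 4) (Runs.set_eq (v := q.b) (i₀ := 0) (by omega) (by omega)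
    (by simp) (by simp [hn, Params.b]) (by omega) (lt_two_pow_of_le (by omega)) ?_)
  refine Runs.seq (n₁ := 1) (n₂ := 3) (Runs.set_eq (v := q.L) (i₀ := 0) (by omega) (by omega)
    (by simp) (by simp [Params.L]) (by omega) (lt_two_pow_of_le (by omega)) ?_)
  refine Runs.seq (n₁ := 1) (n₂ := 2) (Runs.set_eq (v := q.Z) (i₀ := 0) (by omega) (by omega)
    (by simp) (by simp [Params.Z]) (by omega) (lt_two_pow_of_le (by omega)) ?_)
  refine Runs.seq (n₁ := 1) (n₂ := 1) (Runs.set_eq (v := q.T) (i₀ := 0) (by omega) (by omega)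
    (by simp) (by simp [hr, hd, Params.T]) (by omega) (lt_two_pow_of_le (by omega)) ?_)
  refine Runs.set_eq (v := q.Nt) (i₀ := 0) (by omega) (by omega)
    (by simp) (by simp [Params.Nt]) (by omega) (lt_two_pow_of_le (by omega)) ?_
  exact ⟨(((((hag.upd (by decide) _ _).upd (by decide) _ _).upd (by decide) _ _).upd
    (by decide) _ _).upd (by decide) _ _).upd (by decide) _ _, by simp, by simp, by simp, by simp,
    by simp, by simp⟩

theorem runs_powProg {dst B m : ℕ} {base cnt : Expr} (hA : 32 ≤ E.A) (hM : 0 < E.M)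
    (hdst : dst < 32) (hne : dst ≠ aI) (hB : 0 < B) (hm : m ≤ E.M) (hpow : B ^ m < 2 ^ E.M)
    (hbase : ∀ s', Agree [aI, dst] s s' → base.eval s'.store = B)
    (hcnt : ∀ s', Agree [aI, dst] s s' → cnt.eval s'.store = m) :
    Runs E (powProg dst base cnt) (m * 3 + 3) (fun s' => Agree [aI, dst] s s' ∧
      s'.store (dst, 0) = B ^ m) s := by
  have hpow' : ∀ j ≤ m, B ^ j < 2 ^ E.M := fun j hj =>
    (Nat.pow_le_pow_right hB hj).trans_lt hpow
  rw [show m * 3 + 3 = 1 + (m * 3 + 2) by ring]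
  refine Runs.seq (Runs.set_eq (v := 1) (i₀ := 0) (by omega) (by omega) (by simp) (by simp)
    (by omega) (by simpa using hpow' 0 (Nat.zero_le _)) ?_)
  refine Runs.for (n := 1) (by omega) (fun j s' => Agree [aI, dst] s s' ∧ s'.store (aI, 0) = j ∧
      s'.store (dst, 0) = B ^ j) (by omega)
      (N := m) (lt_two_pow_of_le (by omega)) ?_ ?_ ?_ ?_
  · exact ⟨((Agree.refl _ s).upd (by simp) _ _).upd (by simp) _ _, by simp, by simp [hne]⟩
  · rintro j - s' ⟨hag, hj, -⟩
    exact ⟨hj, hcnt s' hag⟩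
  · rintro j hjm s' ⟨hag, hj, hd⟩
    refine Runs.set_eq (v := B ^ (j + 1)) (i₀ := 0) (by omega) (by omega) (by simp)
      (by simp [hd, hbase s' hag, pow_succ]) (by omega) (hpow' _ hjm) ?_
    exact ⟨by simp [hne.symm, hj], (hag.upd (by simp) _ _).upd (by simp) _ _, by simp,
      by simp [hne]⟩
  · rintro s' ⟨hag, -, hd⟩
    exact ⟨hag, hd⟩

theorem runs_shiftProg (q : Params) (hA : 32 ≤ E.A) (hM : q.bound ≤ E.M)
    (hL : s.store (aL, 0) = q.L) (hZ : s.store (aZ, 0) = q.Z) (hT : s.store (aT, 0) = q.T)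
    (hNt : s.store (aNt, 0) = q.Nt) :
    Runs E shiftProg (q.Nt * 15 + 20)
      (fun s' => Agree [aI, aW, aXL, aXZ, aP, aMask] s s' ∧
      s'.store (aW, 0) = 2 ^ q.Nt ∧ s'.store (aXL, 0) = 2 ^ (q.Nt * q.L) ∧
      s'.store (aXZ, 0) = 2 ^ (q.Nt * (q.L * (q.Z + 1))) ∧
      s'.store (aP, 0) = 2 ^ (q.Nt * (q.L * q.T)) ∧
      s'.store (aMask, 0) = digitMask q.Nt q.Nt) s := by
  have hbd : q.bound = q.Nt * q.Nt + q.Nt + q.N * q.N * q.b + q.N * q.N + q.b + q.n * q.n + q.n +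
    q.r + 10 := rfl
  have h2 := q.L_le
  have h3 := q.Z_lt
  have h4 := q.T_le
  have h5 := q.Nt_pos
  have hlt : ∀ x ≤ q.Nt, 2 ^ (q.Nt * x) < 2 ^ E.M := fun x hx =>
    Nat.pow_lt_pow_right one_lt_two (by have := Nat.mul_le_mul_left q.Nt hx; omega)
  have h6 : q.L * (q.Z + 1) ≤ q.Nt := (Nat.mul_le_mul_left q.L (by omega)).trans q.le_Nt
  have h7 : q.L * q.T ≤ q.Nt := (Nat.mul_le_mul_left q.L (by omega)).trans q.le_Nt
  refine Runs.mono (n := (q.Nt * 3 + 3) + ((q.L * 3 + 3) + (((q.Z + 1) * 3 + 3) +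
    ((q.T * 3 + 3) + ((q.Nt * 3 + 3) + 1))))) ?_ (by omega) fun s' h => h
  refine Runs.seq ((runs_powProg (B := 2) (m := q.Nt) hA (by omega) (by omega) (by omega)
    (by omega) (by omega) (by simpa using hlt 1 (by omega)) (fun s' h => by simp)
    (fun s' h => by simp [h.2 aNt (by decide), hNt])).mono le_rfl ?_)
  rintro s₁ ⟨hag₁, hW⟩
  refine Runs.seq ((runs_powProg (B := 2 ^ q.Nt) (m := q.L) hA (by omega) (by omega) (by omega)
    (by positivity) (by omega) (by rw [← pow_mul]; exact hlt _ (by omega))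
    (fun s' h => by simp [h.2 aW (by decide), hW])
    (fun s' h => by simp [h.2 aL (by decide), hag₁.2 aL (by decide), hL])).mono le_rfl ?_)
  rintro s₂ ⟨hag₂, hXL⟩
  rw [← pow_mul] at hXL
  refine Runs.seq ((runs_powProg (B := 2 ^ (q.Nt * q.L)) (m := q.Z + 1) hA (by omega) (by omega)
    (by omega) (by positivity) (by omega)
    (by rw [← pow_mul, mul_assoc]; exact hlt _ (by omega))
    (fun s' h => by simp [h.2 aXL (by decide), hXL])
    (fun s' h => by simp [h.2 aZ (by decide), hag₂.2 aZ (by decide), hag₁.2 aZ (by decide),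
      hZ])).mono le_rfl ?_)
  rintro s₃ ⟨hag₃, hXZ⟩
  rw [← pow_mul, mul_assoc] at hXZ
  refine Runs.seq ((runs_powProg (B := 2 ^ (q.Nt * q.L)) (m := q.T) hA (by omega) (by omega)
    (by omega) (by positivity) (by omega)
    (by rw [← pow_mul, mul_assoc]; exact hlt _ (by omega))
    (fun s' h => by simp [h.2 aXL (by decide), hag₃.2 aXL (by decide), hXL])
    (fun s' h => by simp [h.2 aT (by decide), hag₃.2 aT (by decide), hag₂.2 aT (by decide),
      hag₁.2 aT (by decide), hT])).mono le_rfl ?_)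
  rintro s₄ ⟨hag₄, hP⟩
  rw [← pow_mul, mul_assoc] at hP
  have hW₄ : s₄.store (aW, 0) = 2 ^ q.Nt := by
    rw [hag₄.2 aW (by decide), hag₃.2 aW (by decide), hag₂.2 aW (by decide), hW]
  refine Runs.seq ((runs_powProg (B := 2 ^ q.Nt) (m := q.Nt) hA (by omega) (by omega)
    (by omega) (by positivity) (by omega) (by rw [← pow_mul]; exact hlt _ (by omega))
    (fun s' h => by simp [h.2 aW (by decide), hW₄])
    (fun s' h => by simp [h.2 aNt (by decide), hag₄.2 aNt (by decide), hag₃.2 aNt (by decide),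
      hag₂.2 aNt (by decide), hag₁.2 aNt (by decide), hNt])).mono le_rfl ?_)
  rintro s₅ ⟨hag₅, hm⟩
  have hW₅ : s₅.store (aW, 0) = 2 ^ q.Nt := by rw [hag₅.2 aW (by decide), hW₄]
  refine Runs.set_eq (v := digitMask q.Nt q.Nt) (i₀ := 0) (by omega) (by omega) (by simp)
    (by simp [hm, hW₅, digitMask_eq h5]) (by omega)
    ((digitMask_lt h5 _).trans (hlt _ le_rfl)) ?_
  refine ⟨((((hag₁.mono (by simp)).trans (hag₂.mono (by simp))).trans (hag₃.mono (by simp))).trans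
    (hag₄.mono (by simp))).trans (hag₅.mono (by simp)) |>.upd (by decide) _ _, ?_, ?_, ?_, ?_, ?_⟩
  · simp [hW₅]
  · simp [hag₅.2 aXL (by decide), hag₄.2 aXL (by decide), hag₃.2 aXL (by decide), hXL]
  · simp [hag₅.2 aXZ (by decide), hag₄.2 aXZ (by decide), hXZ]
  · simp [hag₅.2 aP (by decide), hP]
  · simp

/-- The `b` coins of each weight are read from the leading coefficient on: multiplying by `2 ^ Nt`
and adding the next coin is the scheme of Horner, so the `i`-th weight encodes a polynomial whose
coefficients are the coins from `b * i` on. -/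
theorem runs_coinProg (q : Params) (hA : 32 ≤ E.A) (hM : q.bound ≤ E.M)
    (hN : s.store (aSize, 0) = q.N) (hb : s.store (aBits, 0) = q.b)
    (hW : s.store (aW, 0) = 2 ^ q.Nt) (hy : ∀ i, s.store (aY, i) = 0) (hc : s.coins = 0) :
    Runs E coinProg (q.N * q.N * q.b * 4 + 2) (fun s' =>
      (∀ x, x ∉ [aI, aCoin, aY] → ∀ i, s'.store (x, i) = s.store (x, i)) ∧
      ∀ i < q.N * q.N, s'.store (aY, i) =
        hornerBits q.Nt (fun j => E.bits (q.b * i + j)) q.b) s := by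
  have hbd : q.bound = q.Nt * q.Nt + q.Nt + q.N * q.N * q.b + q.N * q.N + q.b + q.n * q.n + q.n +
    q.r + 10 := rfl
  have hb0 := q.b_pos
  have hNt0 := q.Nt_pos
  refine Runs.for (n := 1 + 1) (by omega) (fun j s' =>
      (∀ x, x ∉ [aI, aCoin, aY] → ∀ i, s'.store (x, i) = s.store (x, i)) ∧ s'.coins = j ∧
      s'.store (aI, 0) = j ∧ ∀ i, s'.store (aY, i) =
        hornerBits q.Nt (fun j => E.bits (q.b * i + j)) (min q.b (j - q.b * i))) (by omega)
      (N := q.N * q.N * q.b) (lt_two_pow_of_le (by omega)) ?_ ?_ ?_ ?_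
  · refine ⟨fun x hx i => ?_, by simp [hc], by simp, fun i => ?_⟩
    · have : x ≠ aI := fun h => hx (by simp [h])
      simp [this]
    · simp [hy, hornerBits]
  · rintro j - s' ⟨hag, -, hj, -⟩
    simp [hj, hag aSize (by decide), hag aBits (by decide), hN, hb]
  · rintro j hjN s' ⟨hag, hcj, hj, hyj⟩
    have hNpos : 0 < q.N := by
      by_contra h
      have : q.N = 0 := by omega
      simp [this] at hjN
    have hbNt := q.b_le hNpos
    have hjb := Nat.div_add_mod j q.b
    have hmod := Nat.mod_lt j hb0
    have hdiv := Nat.div_le_self j q.b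
    have e24 : s'.store (aBits, 0) = q.b := by rw [hag aBits (by decide), hb]
    have e12 : s'.store (aW, 0) = 2 ^ q.Nt := by rw [hag aW (by decide), hW]
    have hyv : s'.store (aY, j / q.b) =
        hornerBits q.Nt (fun l => E.bits (q.b * (j / q.b) + l)) (j % q.b) := by
      rw [hyj]
      congr 1
      omega
    have hnew : hornerBits q.Nt (fun l => E.bits (q.b * (j / q.b) + l)) (j % q.b) * 2 ^ q.Nt +
        (E.bits j).toNat =
          hornerBits q.Nt (fun l => E.bits (q.b * (j / q.b) + l)) (j % q.b + 1) := by
      rw [hornerBits, hjb]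
    have hlt : hornerBits q.Nt (fun l => E.bits (q.b * (j / q.b) + l)) (j % q.b + 1) <
        2 ^ E.M := by
      refine (hornerBits_lt hNt0 _ _).trans_le (Nat.pow_le_pow_right two_pos ?_)
      have := Nat.mul_le_mul_left q.Nt (show j % q.b + 1 ≤ q.Nt by omega)
      omega
    refine Runs.seq (Runs.flip (by omega) (by omega) ?_)
    refine Runs.set_eq (i₀ := j / q.b)
      (v := hornerBits q.Nt (fun l => E.bits (q.b * (j / q.b) + l)) (j % q.b + 1))
      (by omega) (by omega) (by simp [hj, e24]) ?_ (by omega) hlt ?_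
    · simp [hj, e24, hyv, e12, hcj, hnew]
    · refine ⟨by simp [hj], fun x hx i => ?_, by simp [hcj], by simp, fun i => ?_⟩
      · have h1 : x ≠ aI := fun h => hx (by simp [h])
        have h2 : x ≠ aCoin := fun h => hx (by simp [h])
        have h3 : x ≠ aY := fun h => hx (by simp [h])
        simp [h1, h2, h3, hag x hx]
      · by_cases hi : i = j / q.b
        · subst hi
          have : min q.b (j + 1 - q.b * (j / q.b)) = j % q.b + 1 := by omega
          simp [this]
        · have : min q.b (j + 1 - q.b * i) = min q.b (j - q.b * i) := by
            rcases Nat.lt_or_gt_of_ne hi with h | h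
            · have : q.b * (i + 1) ≤ q.b * (j / q.b) := Nat.mul_le_mul_left _ h
              rw [mul_add, mul_one] at this
              omega
            · have : q.b * (j / q.b + 1) ≤ q.b * i := Nat.mul_le_mul_left _ h
              rw [mul_add, mul_one] at this
              omega
          simp [hi, this, hyj]
  · rintro s' ⟨hag, -, -, hyj⟩
    refine ⟨hag, fun i hi => ?_⟩
    rw [hyj]
    congr 1
    have : q.b * (i + 1) ≤ q.b * (q.N * q.N) := Nat.mul_le_mul_left _ hi
    rw [mul_add, mul_one, mul_comm q.b (q.N * q.N)] at this
    omega

end RAM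

/-! ### The program: the weights of the links -/

namespace RAM

open RAM.Expr

/-- The layer of the row of the matrix entry with number `aI`. -/
def rowLayer : Expr := var aI / var aSize / var aN
/-- The vertex of the row of the matrix entry with number `aI`. -/
def rowVertex : Expr := var aI / var aSize % var aN
/-- The layer of the column of the matrix entry with number `aI`. -/
def colLayer : Expr := var aI % var aSize / var aN
/-- The vertex of the column of the matrix entry with number `aI`. -/
def colVertex : Expr := var aI % var aSize % var aN

/-- `1` if the two indices lie in the same colour layer and their vertices are adjacent. -/
def colourLink : Expr :=
  eq rowLayer colLayer * lt rowLayer (var aMax) * get aAdj (var aN * rowVertex + colVertex)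

/-- `1` if the two indices are a vertex in a colour layer and an available dummy of this vertex:
vertex `v` has the dummies in the layers `k + j` with `j < k - deg v`. -/
def dummyLink : Expr :=
  eq rowVertex colVertex * (lt rowLayer (var aMax) * (1 - lt colLayer (var aMax)) *
    lt (colLayer + get aDeg rowVertex) (2 * var aMax) +
  lt colLayer (var aMax) * (1 - lt rowLayer (var aMax)) *
    lt (rowLayer + get aDeg rowVertex) (2 * var aMax))

/-- The mask of the edge between the two vertices, if it is sieved, and `0` otherwise. -/
def edgeMask : Expr :=
  get aSel (var aN * rowVertex + colVertex) + get aSel (var aN * colVertex + rowVertex)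

/-- The random weight of the unordered pair of the two indices. -/
def pairWeight : Expr :=
  get aY (lt (var aI / var aSize) (var aI % var aSize) * var aI +
    (1 - lt (var aI / var aSize) (var aI % var aSize)) *
      (var aI % var aSize * var aSize + var aI / var aSize))

/-- The weights of all links, and the masks that decide when they are switched on. -/
def wtProg : Prog :=
  forLoop aI (var aSize * var aSize) (.seq
    (.set aWt (var aI) (((colourLink * (eq edgeMask 0 * var aXL + (1 - eq edgeMask 0) * var aXZ) +
      dummyLink * var aXL) * pairWeight) &&& var aMask))
    (.set aSb (var aI) (colourLink * edgeMask)))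

/-- The weight and the mask of the link between the indices `p` and `q`: `c₁` and `c₂` tell whether
it is a copy of an edge or a link to a dummy, `sl` is the mask of the underlying edge, and `yv` the
random weight of the pair. -/
def HoldsWeight (n k N xl xz mask : ℕ) (a deg sel y : ℕ → ℕ) (p q : ℕ) (s : Config) : Prop :=
  ∀ c₁ c₂ sl yv : ℕ,
    c₁ = (if p / n = q / n then 1 else 0) * (if p / n < k then 1 else 0) *
      a (n * (p % n) + q % n) →
    c₂ = (if p % n = q % n then 1 else 0) * ((if p / n < k then 1 else 0) *
        (1 - if q / n < k then 1 else 0) * (if q / n + deg (p % n) < 2 * k then 1 else 0) +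
      (if q / n < k then 1 else 0) * (1 - if p / n < k then 1 else 0) *
        (if p / n + deg (p % n) < 2 * k then 1 else 0)) →
    sl = sel (n * (p % n) + q % n) + sel (n * (q % n) + p % n) →
    yv = y (if p < q then p * N + q else q * N + p) →
    s.store (aWt, p * N + q) =
      ((c₁ * (if sl = 0 then xl else xz) + c₂ * xl) * yv) &&& mask ∧
    s.store (aSb, p * N + q) = c₁ * sl

variable {E : Env} {s : Config}

theorem runs_wtProg {n k N r xl xz mask : ℕ} {a deg sel y : ℕ → ℕ} (hA : 32 ≤ E.A)
    (hMN : N * N + 2 ≤ E.M) (hMr : r + 2 ≤ E.M) (hmask : mask < 2 ^ E.M)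
    (hn : s.store (aN, 0) = n) (hk : s.store (aMax, 0) = k) (hN : s.store (aSize, 0) = N)
    (hxl : s.store (aXL, 0) = xl) (hxz : s.store (aXZ, 0) = xz)
    (hm : s.store (aMask, 0) = mask)
    (ha : ∀ i, s.store (aAdj, i) = a i) (ha1 : ∀ i, a i ≤ 1)
    (hdeg : ∀ v, s.store (aDeg, v) = deg v)
    (hsel : ∀ i, s.store (aSel, i) = sel i) (hsel1 : ∀ i, sel i ≤ 2 ^ r)
    (hy : ∀ i, s.store (aY, i) = y i) :
    Runs E wtProg (N * N * 4 + 2) (fun s' => Agree [aI, aWt, aSb] s s' ∧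
      ∀ p < N, ∀ q < N, HoldsWeight n k N xl xz mask a deg sel y p q s') s := by
  let I := fun (j : ℕ) (s' : Config) => Agree [aI, aWt, aSb] s s' ∧ s'.store (aI, 0) = j ∧
    ∀ p < N, ∀ q < N, p * N + q < j → HoldsWeight n k N xl xz mask a deg sel y p q s'
  refine Runs.for (n := 1 + 1) (by omega) I (by omega) (N := N * N)
    (lt_two_pow_of_le (by omega)) ?_ ?_ ?_ ?_
  · exact ⟨(Agree.refl _ s).upd (by decide) _ _, by simp, fun p _ q _ h => absurd h (by omega)⟩
  · rintro j - s' ⟨hag, hj, -⟩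
    simp [hj, hag.2 aSize (by decide), hN]
  · rintro j hjN s' ⟨hag, hj, hprev⟩
    have hN0 : 0 < N := Nat.pos_of_ne_zero fun h => by simp [h] at hjN
    obtain ⟨p, q, hp, hq, hjpq⟩ : ∃ p q, j / N = p ∧ j % N = q ∧ p * N + q = j :=
      ⟨_, _, rfl, rfl, by rw [mul_comm]; exact Nat.div_add_mod j N⟩
    have hqN : q < N := hq ▸ Nat.mod_lt j hN0
    obtain ⟨c₁, hc₁⟩ : ∃ c, c = (if p / n = q / n then 1 else 0) * (if p / n < k then 1 else 0) *
          a (n * (p % n) + q % n) := ⟨_, rfl⟩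
    obtain ⟨c₂, hc₂⟩ : ∃ c, c = (if p % n = q % n then 1 else 0) * ((if p / n < k then 1 else 0) *
            (1 - if q / n < k then 1 else 0) * (if q / n + deg (p % n) < 2 * k then 1 else 0) +
          (if q / n < k then 1 else 0) * (1 - if p / n < k then 1 else 0) *
            (if p / n + deg (p % n) < 2 * k then 1 else 0)) := ⟨_, rfl⟩
    obtain ⟨sl, hsl⟩ : ∃ c, c = sel (n * (p % n) + q % n) + sel (n * (q % n) + p % n) := ⟨_, rfl⟩
    obtain ⟨yv, hyv⟩ : ∃ c, c = y (if p < q then p * N + q else q * N + p) := ⟨_, rfl⟩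
    have hc₁1 : c₁ ≤ 1 := by
      rw [hc₁]
      have := ha1 (n * (p % n) + q % n)
      split_ifs <;> omega
    have hslM : c₁ * sl < 2 ^ E.M := by
      have h1 := hsel1 (n * (p % n) + q % n)
      have h2 := hsel1 (n * (q % n) + p % n)
      have h3 : 2 ^ (r + 2) ≤ 2 ^ E.M := Nat.pow_le_pow_right two_pos hMr
      have h4 : c₁ * sl ≤ 1 * sl := Nat.mul_le_mul_right _ hc₁1
      have h5 : 0 < 2 ^ r := by positivity
      rw [pow_add] at h3
      omega
    have ev : ∀ s'' : Config, Agree [aI, aWt, aSb] s s'' → s''.store (aI, 0) = j →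
        colourLink.eval s''.store = c₁ ∧ dummyLink.eval s''.store = c₂ ∧
        edgeMask.eval s''.store = sl ∧ pairWeight.eval s''.store = yv := by
      intro s'' hag hj
      have e1 : ∀ i, s''.store (aAdj, i) = a i := fun i => by rw [hag.2 aAdj (by decide), ha]
      have e2 : ∀ i, s''.store (aDeg, i) = deg i := fun i => by rw [hag.2 aDeg (by decide), hdeg]
      have e3 : ∀ i, s''.store (aSel, i) = sel i := fun i => by rw [hag.2 aSel (by decide), hsel]
      have e4 : ∀ i, s''.store (aY, i) = y i := fun i => by rw [hag.2 aY (by decide), hy]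
      have e5 : s''.store (aN, 0) = n := by rw [hag.2 aN (by decide), hn]
      have e6 : s''.store (aMax, 0) = k := by rw [hag.2 aMax (by decide), hk]
      have e7 : s''.store (aSize, 0) = N := by rw [hag.2 aSize (by decide), hN]
      refine ⟨?_, ?_, ?_, ?_⟩
      · simp [colourLink, rowLayer, colLayer, rowVertex, colVertex, e1, e5, e6, e7, hj, hp, hq, hc₁]
      · simp only [dummyLink, rowLayer, colLayer, rowVertex, colVertex, eval_mul, eval_eq, eval_lt,
          eval_add, eval_sub, eval_one, eval_two, eval_div, eval_mod, eval_get, eval_lit, e2, e5,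
          e6, e7, hj, hp, hq, hc₂]
      · simp [edgeMask, rowVertex, colVertex, e3, e5, e7, hj, hp, hq, hsl]
      · simp only [pairWeight, eval_mul, eval_lt, eval_add, eval_sub, eval_one, eval_div, eval_mod,
          eval_get, eval_lit, e4, e7, hj, hp, hq, hyv]
        split_ifs <;> simp [hjpq]
    have hag' : ∀ v, Agree [aI, aWt, aSb] s (s'.upd aWt j v) := fun v => hag.upd (by decide) _ _
    refine Runs.seq (Runs.set_eq (i₀ := j)
      (v := ((c₁ * (if sl = 0 then xl else xz) + c₂ * xl) * yv) &&& mask) (by omega) (by omega)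
      (by simp [hj]) ?_ (by omega) (Nat.and_le_right.trans_lt hmask) ?_)
    · obtain ⟨h1, h2, h3, h4⟩ := ev s' hag hj
      have e8 : s'.store (aXL, 0) = xl := by rw [hag.2 aXL (by decide), hxl]
      have e9 : s'.store (aXZ, 0) = xz := by rw [hag.2 aXZ (by decide), hxz]
      have e10 : s'.store (aMask, 0) = mask := by rw [hag.2 aMask (by decide), hm]
      simp only [eval_and, eval_mul, eval_add, eval_sub, eval_eq, eval_one, eval_zero, eval_get,
        eval_lit, h1, h2, h3, h4, e8, e9, e10]
      split_ifs <;> simp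
    refine Runs.set_eq (i₀ := j) (v := c₁ * sl) (by omega) (by omega) (by simp [hj]) ?_ (by omega)
      hslM ?_
    · obtain ⟨h1, h2, h3, h4⟩ := ev _ (hag' _) (by simp [hj])
      rw [eval_mul, h1, h3]
    refine ⟨by simp [hj], ((hag' _).upd (by decide) _ _).upd (by decide) _ _, by simp, ?_⟩
    intro p' hp' q' hq' hlt d₁ d₂ tl zv hd₁ hd₂ htl hzv
    by_cases heq : p' * N + q' = j
    · obtain rfl : p' = p := by
        rw [← hp, ← heq, mul_comm, Nat.mul_add_div hN0, Nat.div_eq_of_lt hq', add_zero]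
      obtain rfl : q' = q := by
        rw [← hq, ← heq, mul_comm, Nat.mul_add_mod, Nat.mod_eq_of_lt hq']
      subst hd₁ hd₂ htl hzv hc₁ hc₂ hsl hyv
      simp [heq]
    · simpa [heq] using hprev p' hp' q' hq' (by omega) d₁ d₂ tl zv hd₁ hd₂ htl hzv
  · rintro s' ⟨hag, -, h⟩
    refine ⟨hag, fun p hp q hq => h p hp q hq ?_⟩
    have : (p + 1) * N ≤ N * N := Nat.mul_le_mul_right _ hp
    rw [add_mul, one_mul] at this
    omega

end RAM

/-! ### The program: sieving and determinants -/

namespace RAM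

open RAM.Expr PowerSeries

/-- The blow-up matrix for the set of sieved edges with mask `aA`. -/
def buildProg : Prog :=
  forLoop aI (var aSize * var aSize) (.set aB (var aI)
    (eq (var aI / var aSize) (var aI % var aSize) +
      (eq (get aSb (var aI)) 0 + var aA / get aSb (var aI) % 2) * get aWt (var aI)))

/-- The inverse of the pivot in row `aG`. -/
def invProg : Prog :=
  .seq (.set aInv 0 1) (forLoop aI (var aNt) (.set aInv 0
    (1 ^^^ (((get aB (var aG * var aSize + var aG) ^^^ 1) * var aInv) &&& var aMask))))

/-- One elimination step, with the pivot in row `aG`. -/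
def stepProg : Prog :=
  forLoop aI (var aSize * var aSize) (.set aB (var aI) (get aB (var aI) ^^^
    (lt (var aG) (var aI / var aSize) * lt (var aG) (var aI % var aSize) *
      ((((get aB (var aI / var aSize * var aSize + var aG) * var aInv) &&& var aMask) *
        get aB (var aG * var aSize + var aI % var aSize)) &&& var aMask))))

/-- The determinant of the matrix. -/
def detProg : Prog :=
  .seq (.set aDet 0 1) (forLoop aG (var aSize) (.seq
    (.set aDet 0 ((var aDet * get aB (var aG * var aSize + var aG)) &&& var aMask)) (.seq
    invProg stepProg)))

/-- The sum of the determinants over all sets of sieved edges. -/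
def sieveProg : Prog :=
  forLoop aA (var aPow) (.seq buildProg (.seq detProg (.set aAcc 0 (var aAcc ^^^ var aDet))))

/-- Decide whether the block of coefficients belonging to the critical exponent vanishes, and write
the output. -/
def outProg : Prog :=
  .set aN 0 (eq (var aMax) 0 + var aMax +
    lt 0 (var aMax) * lt (var aAcc % (var aP * var aXL)) (var aP))

variable {E : Env} {s : Config} {N w : ℕ}

/-- The bounds on which the analysis of the arithmetic with encoded power series rests: `N` is the
size of the matrices and `w` the precision. -/
structure Env.Fits (E : Env) (N w : ℕ) : Prop where
  arrays : 32 ≤ E.A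
  size : N * N < E.M
  precision_pos : 0 < w
  precision : w * w < E.M

namespace Env.Fits

variable (h : E.Fits N w)
include h

theorem pos : 0 < E.M := (Nat.zero_le _).trans_lt h.size

theorem index_lt {p q : ℕ} (hp : p < N) (hq : q < N) : p * N + q < E.M := by
  have : (p + 1) * N ≤ N * N := Nat.mul_le_mul_right _ hp
  rw [add_mul, one_mul] at this
  have := h.size
  omega

theorem enc_lt (f : (ZMod 2)⟦X⟧) : enc w w f < 2 ^ E.M :=
  (_root_.enc_lt h.precision_pos w f).trans (Nat.pow_lt_pow_right one_lt_two h.precision)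

theorem enc_mul (f g : (ZMod 2)⟦X⟧) :
    enc w w f * enc w w g &&& digitMask w w = enc w w (f * g) :=
  (_root_.enc_mul h.precision_pos Nat.lt_two_pow_self f g).symm

theorem enc_add (f g : (ZMod 2)⟦X⟧) : enc w w f ^^^ enc w w g = enc w w (f + g) :=
  (_root_.enc_add h.precision_pos f g).symm

theorem enc_one : enc w w 1 = 1 := _root_.enc_one h.precision_pos

theorem precision_lt : w < E.M := (Nat.le_mul_self w).trans_lt h.precision

theorem size_lt : N < E.M := (Nat.le_mul_self N).trans_lt h.size

end Env.Fits

/-- Array `aB` holds the matrix `B`. -/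
def Holds (N w : ℕ) (B : ℕ → ℕ → (ZMod 2)⟦X⟧) (s : Config) : Prop :=
  ∀ p < N, ∀ q < N, s.store (aB, p * N + q) = enc w w (B p q)

theorem divMod_of_lt {p q : ℕ} (hq : q < N) : (p * N + q) / N = p ∧ (p * N + q) % N = q := by
  constructor
  · rw [mul_comm, Nat.mul_add_div (by omega), Nat.div_eq_of_lt hq, add_zero]
  · rw [mul_comm, Nat.mul_add_mod, Nat.mod_eq_of_lt hq]

/-- A loop that fills the array `aB` entry by entry: `B` is the matrix before and `B'` the matrix
after the loop. -/
theorem runs_fill (h : E.Fits N w) (hN : s.store (aSize, 0) = N) {e : Expr}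
    {B' : ℕ → ℕ → (ZMod 2)⟦X⟧}
    (he : ∀ p < N, ∀ q < N, ∀ s', Agree [aI, aB] s s' → s'.store (aI, 0) = p * N + q →
      (∀ p' < N, ∀ q' < N, s'.store (aB, p' * N + q') = if p' * N + q' < p * N + q then
        enc w w (B' p' q') else s.store (aB, p' * N + q')) →
      e.eval s'.store = enc w w (B' p q)) :
    Runs E (forLoop aI (var aSize * var aSize) (.set aB (var aI) e)) (N * N * 3 + 2)
      (fun s' => Agree [aI, aB] s s' ∧ Holds N w B' s') s := by
  have hA := h.arrays
  have hM := h.pos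
  refine Runs.for (n := 1) hM (fun j s' => Agree [aI, aB] s s' ∧ s'.store (aI, 0) = j ∧
    ∀ p' < N, ∀ q' < N, s'.store (aB, p' * N + q') = if p' * N + q' < j then
        enc w w (B' p' q') else s.store (aB, p' * N + q')) (by omega) (N := N * N)
    (lt_two_pow_of_le h.size.le) ?_ ?_ ?_ ?_
  · exact ⟨(Agree.refl _ s).upd (by decide) _ _, by simp, by simp⟩
  · rintro j - s' ⟨hag, hj, -⟩
    simp [hj, hag.2 aSize (by decide), hN]
  · rintro j hjN s' ⟨hag, hj, hprev⟩
    have hN0 : 0 < N := Nat.pos_of_ne_zero fun h => by simp [h] at hjN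
    obtain ⟨p, q, hp, hq, rfl⟩ : ∃ p q, p < N ∧ q < N ∧ p * N + q = j :=
      ⟨j / N, j % N, Nat.div_lt_of_lt_mul hjN, Nat.mod_lt _ hN0, by
        rw [mul_comm]; exact Nat.div_add_mod j N⟩
    have hi := h.index_lt hp hq
    refine Runs.set_eq (i₀ := p * N + q) (v := enc w w (B' p q)) hM (by omega) (by simp [hj])
      (he p hp q hq s' hag hj hprev) hi (h.enc_lt _) ?_
    refine ⟨by simp [hj], (hag.upd (by decide) _ _).upd (by decide) _ _, by simp, ?_⟩
    intro p' hp' q' hq'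
    by_cases heq : p' * N + q' = p * N + q
    · have h1 := divMod_of_lt (N := N) (p := p') hq'
      have h2 := divMod_of_lt (N := N) (p := p) hq
      rw [heq] at h1
      obtain rfl : p' = p := h1.1.symm.trans h2.1
      obtain rfl : q' = q := h1.2.symm.trans h2.2
      simp
    · have : p' * N + q' < p * N + q + 1 ↔ p' * N + q' < p * N + q := by omega
      simp only [Config.upd_store]
      rw [if_neg (by simp), if_neg (by simp [heq]), hprev p' hp' q' hq']
      simp only [this]
  · rintro s' ⟨hag, -, hprev⟩
    refine ⟨hag, fun p hp q hq => ?_⟩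
    rw [hprev p hp q hq, if_pos]
    have : (p + 1) * N ≤ N * N := Nat.mul_le_mul_right _ hp
    rw [add_mul, one_mul] at this
    omega

theorem runs_buildProg (h : E.Fits N w) (hN : s.store (aSize, 0) = N) {a : ℕ}
    (ha : s.store (aA, 0) = a) {B : ℕ → ℕ → (ZMod 2)⟦X⟧}
    (hB : ∀ p < N, ∀ q < N, (if p = q then 1 else 0) +
      ((if s.store (aSb, p * N + q) = 0 then 1 else 0) + a / s.store (aSb, p * N + q) % 2) *
        s.store (aWt, p * N + q) = enc w w (B p q)) :
    Runs E buildProg (N * N * 3 + 2) (fun s' => Agree [aI, aB] s s' ∧ Holds N w B s') s := by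
  refine runs_fill h hN fun p hp q hq s' hag hj _ => ?_
  obtain ⟨h1, h2⟩ := divMod_of_lt (N := N) (p := p) hq
  simp [hj, hag.2 aSize (by decide), hN, hag.2 aA (by decide), ha, h1, h2,
    hag.2 aSb (by decide), hag.2 aWt (by decide), hB p hp q hq]

/-- The inverse of the pivot, by `w` steps of the geometric series. -/
theorem runs_invProg (h : E.Fits N w) (hN : s.store (aSize, 0) = N)
    (hw : s.store (aNt, 0) = w) (hm : s.store (aMask, 0) = digitMask w w) {g : ℕ}
    (hg : s.store (aG, 0) = g) {f : (ZMod 2)⟦X⟧} (hf : s.store (aB, g * N + g) = enc w w f)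
    (hf1 : constantCoeff f = 1) :
    Runs E invProg (w * 3 + 3) (fun s' => Agree [aI, aInv] s s' ∧
      s'.store (aInv, 0) = enc w w f⁻¹) s := by
  have hA := h.arrays
  have hM := h.pos
  have hwM := h.precision_lt
  have hone : 1 = enc w w 1 := h.enc_one.symm
  rw [show w * 3 + 3 = 1 + (w * 3 + 2) by ring]
  refine Runs.seq (Runs.set_eq (i₀ := 0) (v := enc w w 1) hM (by omega) (by simp)
    (by simpa using hone) hM (h.enc_lt _) ?_)
  refine Runs.for (n := 1) hM (fun j s' => Agree [aI, aInv] s s' ∧ s'.store (aI, 0) = j ∧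
    s'.store (aInv, 0) = enc w w (invIter f j)) (by omega) (N := w)
    (lt_two_pow_of_le hwM.le) ?_ ?_ ?_ ?_
  · exact ⟨((Agree.refl _ s).upd (by decide) _ _).upd (by decide) _ _, by simp,
      by simp [invIter]⟩
  · rintro j - s' ⟨hag, hj, -⟩
    simp [hj, hag.2 aNt (by decide), hw]
  · rintro j hjw s' ⟨hag, hj, hinv⟩
    refine Runs.set_eq (i₀ := 0) (v := enc w w (invIter f (j + 1))) hM (by omega) (by simp)
      ?_ hM (h.enc_lt _) ?_
    · rw [invIter, ← h.enc_add, ← h.enc_mul, ← h.enc_add, h.enc_one]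
      simp [hag.2 aSize (by decide), hN, hag.2 aG (by decide), hg, hag.2 aB (by decide), hf,
        hag.2 aMask (by decide), hm, hinv]
    · exact ⟨by simp [hj], (hag.upd (by decide) _ _).upd (by decide) _ _, by simp, by simp⟩
  · rintro s' ⟨hag, -, hinv⟩
    exact ⟨hag, hinv.trans (enc_congr fun i hi => coeff_invIter hf1 hi.le)⟩

/-- One step of the elimination, done in place: as entry `(p, q)` is only updated for `p, q > g`,
the pivot row and column that the update reads are still the old ones. -/
theorem runs_stepProg (h : E.Fits N w) (hN : s.store (aSize, 0) = N)
    (hm : s.store (aMask, 0) = digitMask w w) {g : ℕ} (hgN : g < N)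
    (hg : s.store (aG, 0) = g) {B : ℕ → ℕ → (ZMod 2)⟦X⟧} (hB : Holds N w B s)
    (hinv : s.store (aInv, 0) = enc w w (B g g)⁻¹) :
    Runs E stepProg (N * N * 3 + 2) (fun s' => Agree [aI, aB] s s' ∧
      Holds N w (gaussStep g B) s') s := by
  refine runs_fill h hN fun p hp q hq s' hag hj hprev => ?_
  obtain ⟨h1, h2⟩ := divMod_of_lt (N := N) (p := p) hq
  have e1 : s'.store (aB, p * N + q) = enc w w (B p q) := by
    rw [hprev p hp q hq, if_neg (by omega), hB p hp q hq]
  -- The pivot row and the pivot column do not change.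
  have e2 : s'.store (aB, p * N + g) = enc w w (B p g) := by
    rw [hprev p hp g hgN, hB p hp g hgN]
    simp [gaussStep]
  have e3 : s'.store (aB, g * N + q) = enc w w (B g q) := by
    rw [hprev g hgN q hq, hB g hgN q hq]
    simp [gaussStep]
  have e4 : s'.store (aMask, 0) = digitMask w w := by rw [hag.2 aMask (by decide), hm]
  have e5 : s'.store (aInv, 0) = enc w w (B g g)⁻¹ := by rw [hag.2 aInv (by decide), hinv]
  have e6 : s'.store (aG, 0) = g := by rw [hag.2 aG (by decide), hg]
  have e7 : s'.store (aSize, 0) = N := by rw [hag.2 aSize (by decide), hN]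
  simp only [eval_xor, eval_and, eval_mul, eval_lt, eval_add, eval_div, eval_mod, eval_get,
    eval_lit, hj, e7, e6, e5, e4, e3, e2, e1, h1, h2, h.enc_mul]
  unfold gaussStep
  by_cases hgp : g < p
  · by_cases hgq : g < q
    · simp [hgp, hgq, h.enc_add]
    · simp [hgq]
  · simp [hgp]

/-- The number of steps of the computation of a determinant. -/
def detSteps (N w : ℕ) : ℕ := N * (1 + ((w * 3 + 3) + (N * N * 3 + 2)) + 2) + 3

theorem runs_detProg (h : E.Fits N w) (hN : s.store (aSize, 0) = N)
    (hw : s.store (aNt, 0) = w) (hm : s.store (aMask, 0) = digitMask w w)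
    {B : ℕ → ℕ → (ZMod 2)⟦X⟧} (hB : Holds N w B s) (hB1 : IsUnipotentMod N B) :
    Runs E detProg (detSteps N w) (fun s' => Agree [aI, aG, aB, aInv, aDet] s s' ∧
      s'.store (aDet, 0) = enc w w (Matrix.of fun j l : Fin N => B j l).det) s := by
  have hA := h.arrays
  have hM := h.pos
  have hNM := h.size_lt
  rw [detSteps, show ∀ x, x + 3 = 1 + (x + 2) by omega]
  refine Runs.seq (Runs.set_eq (i₀ := 0) (v := enc w w 1) hM (by omega) (by simp)
    (by simpa using h.enc_one.symm) hM (h.enc_lt _) ?_)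
  refine Runs.for hM (fun g s' => Agree [aI, aG, aB, aInv, aDet] s s' ∧ s'.store (aG, 0) = g ∧
    Holds N w (gaussIter B g) s' ∧
    s'.store (aDet, 0) = enc w w (∏ i ∈ Finset.range g, gaussIter B i i i)) (by omega) (N := N)
    (lt_two_pow_of_le hNM.le) ?_ ?_ ?_ ?_
  · exact ⟨((Agree.refl _ s).upd (by decide) _ _).upd (by decide) _ _, by simp,
      fun p hp q hq => by simpa [gaussIter] using hB p hp q hq, by simp⟩
  · rintro g - s' ⟨hag, hg, -⟩
    simp [hg, hag.2 aSize (by decide), hN]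
  · rintro g hgN s' ⟨hag, hg, hBg, hdet⟩
    have f1 : s'.store (aSize, 0) = N := by rw [hag.2 aSize (by decide), hN]
    have f2 : s'.store (aMask, 0) = digitMask w w := by rw [hag.2 aMask (by decide), hm]
    have f3 : s'.store (aNt, 0) = w := by rw [hag.2 aNt (by decide), hw]
    have f4 := hBg g hgN g hgN
    refine Runs.seq (Runs.set_eq (i₀ := 0)
      (v := enc w w (∏ i ∈ Finset.range (g + 1), gaussIter B i i i)) hM (by omega) (by simp)
      ?_ hM (h.enc_lt _) ?_)
    · rw [Finset.prod_range_succ, ← h.enc_mul]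
      simp [hdet, hg, f1, f2, f4]
    have hpiv : constantCoeff (gaussIter B g g g) = 1 := by
      simpa using hB1.gaussIter hgN.le g hgN g hgN
    refine Runs.seq ((runs_invProg h (by simpa using f1) (by simpa using f3) (by simpa using f2)
      (g := g) (by simpa using hg) (f := gaussIter B g g g) (by simpa using f4) hpiv).mono
      le_rfl ?_)
    rintro s₁ ⟨hag₁, hinv⟩
    refine (runs_stepProg h (B := gaussIter B g) (by simp [hag₁.2 aSize (by decide), f1])
      (by simp [hag₁.2 aMask (by decide), f2]) hgN (by simp [hag₁.2 aG (by decide), hg]) ?_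
      hinv).mono le_rfl ?_
    · intro p hp q hq
      simpa [hag₁.2 aB (by decide)] using hBg p hp q hq
    rintro s₂ ⟨hag₂, hB₂⟩
    refine ⟨by simp [hag₂.2 aG (by decide), hag₁.2 aG (by decide), hg], ?_, by simp,
      fun p hp q hq => by simpa [gaussIter] using hB₂ p hp q hq, ?_⟩
    · exact (((hag.upd (by decide) _ _).trans (hag₁.mono (by simp))).trans
        (hag₂.mono (by simp))).upd (by decide) _ _
    · simp [hag₂.2 aDet (by decide), hag₁.2 aDet (by decide)]
  · rintro s' ⟨hag, -, -, hdet⟩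
    exact ⟨hag, by rw [hdet, prod_gaussIter_eq_det hB1]⟩

/-- The number of steps per set of sieved edges. -/
def sieveSteps (N w : ℕ) : ℕ := (N * N * 3 + 2) + (detSteps N w + 1)

/-- The sum of the determinants over all sets `a < 2 ^ r` of sieved edges; `aSb` holds `0` for a
link that is not sieved, and `2 ^ j` for a link along the `j`-th sieved edge. -/
theorem runs_sieveProg (h : E.Fits N w) (hN : s.store (aSize, 0) = N)
    (hw : s.store (aNt, 0) = w) (hm : s.store (aMask, 0) = digitMask w w) {r : ℕ}
    (hr : r < E.M) (hP : s.store (aPow, 0) = 2 ^ r) (hacc : s.store (aAcc, 0) = 0)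
    {B : ℕ → ℕ → ℕ → (ZMod 2)⟦X⟧} (hB1 : ∀ a, IsUnipotentMod N (B a))
    (hB : ∀ a < 2 ^ r, ∀ p < N, ∀ q < N, (if p = q then 1 else 0) +
      ((if s.store (aSb, p * N + q) = 0 then 1 else 0) + a / s.store (aSb, p * N + q) % 2) *
        s.store (aWt, p * N + q) = enc w w (B a p q)) :
    Runs E sieveProg (2 ^ r * (sieveSteps N w + 2) + 2) (fun s' =>
      Agree [aI, aG, aB, aInv, aDet, aA, aAcc] s s' ∧
      s'.store (aAcc, 0) =
        enc w w (∑ a ∈ Finset.range (2 ^ r), (Matrix.of fun j l : Fin N => B a j l).det)) s := by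
  have hA := h.arrays
  have hM := h.pos
  have hrM : 2 ^ r < 2 ^ E.M := Nat.pow_lt_pow_right one_lt_two hr
  refine Runs.for hM (fun a s' => Agree [aI, aG, aB, aInv, aDet, aA, aAcc] s s' ∧
    s'.store (aA, 0) = a ∧ s'.store (aAcc, 0) =
      enc w w (∑ a ∈ Finset.range a, (Matrix.of fun j l : Fin N => B a j l).det)) (by omega)
    hrM ?_ ?_ ?_ ?_
  · exact ⟨(Agree.refl _ s).upd (by decide) _ _, by simp, by simp [hacc, enc_zero]⟩
  · rintro a - s' ⟨hag, ha, -⟩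
    simp [ha, hag.2 aPow (by decide), hP]
  · rintro a har s' ⟨hag, ha, hs'⟩
    have f1 : s'.store (aSize, 0) = N := by rw [hag.2 aSize (by decide), hN]
    have f2 : s'.store (aMask, 0) = digitMask w w := by rw [hag.2 aMask (by decide), hm]
    have f3 : s'.store (aNt, 0) = w := by rw [hag.2 aNt (by decide), hw]
    refine Runs.seq ((runs_buildProg h f1 ha (B := B a) fun p hp q hq => ?_).mono le_rfl ?_)
    · rw [hag.2 aSb (by decide), hag.2 aWt (by decide), hB a har p hp q hq]
    rintro s₁ ⟨hag₁, hB₁⟩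
    refine Runs.seq ((runs_detProg h (by rw [hag₁.2 aSize (by decide), f1])
      (by rw [hag₁.2 aNt (by decide), f3]) (by rw [hag₁.2 aMask (by decide), f2]) hB₁
      (hB1 a)).mono le_rfl ?_)
    rintro s₂ ⟨hag₂, hdet⟩
    refine Runs.set_eq (i₀ := 0) (v := enc w w
      (∑ a ∈ Finset.range (a + 1), (Matrix.of fun j l : Fin N => B a j l).det)) hM (by omega)
      (by simp) ?_ hM (h.enc_lt _) ?_
    · rw [Finset.sum_range_succ, ← h.enc_add]
      simp [hdet, hag₂.2 aAcc (by decide), hag₁.2 aAcc (by decide), hs']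
    · exact ⟨by simp [hag₂.2 aA (by decide), hag₁.2 aA (by decide), ha],
        (((hag.trans (hag₁.mono (by simp))).trans (hag₂.mono (by simp))).upd
          (by decide) _ _).upd (by decide) _ _, by simp, by simp⟩
  · rintro s' ⟨hag, -, hs'⟩
    exact ⟨hag, hs'⟩

theorem runs_outProg (h : E.Fits N w) {k u l : ℕ} (hk : s.store (aMax, 0) = k) (hkM : k < E.M)
    (hP : s.store (aP, 0) = 2 ^ (w * u)) (hXL : s.store (aXL, 0) = 2 ^ (w * l)) (hul : u + l ≤ w)
    {f : (ZMod 2)⟦X⟧} (hf : s.store (aAcc, 0) = enc w w f) :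
    Runs E outProg 1 (fun s' => s'.output =
      if k = 0 then 1 else if ∃ j < l, coeff (u + j) f ≠ 0 then k else k + 1) s := by
  have hA := h.arrays
  have hM := h.pos
  refine Runs.set_eq (i₀ := 0)
    (v := if k = 0 then 1 else if ∃ j < l, coeff (u + j) f ≠ 0 then k else k + 1) hM (by omega)
    (by simp) ?_ hM (lt_two_pow_of_le (by split_ifs <;> omega)) (by simp [Config.output])
  have hiff := enc_mod_lt_iff h.precision_pos f hul
  simp only [eval_add, eval_eq, eval_mul, eval_lt, eval_mod, eval_get, eval_lit, eval_zero, hk, hP,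
    hXL, hf, ← pow_add, ← mul_add, hiff]
  rcases Nat.eq_zero_or_pos k with rfl | hk0
  · simp
  · by_cases hex : ∃ j < l, coeff (u + j) f ≠ 0
    · rw [if_neg (show ¬ ∀ j < l, coeff (u + j) f = 0 by
        push Not
        exact hex)]
      simp [hk0.ne', hex]
    · rw [if_pos (show ∀ j < l, coeff (u + j) f = 0 by
        push Not at hex
        exact hex)]
      simp [hk0.ne', hk0, hex]

end RAM

/-! ### The sieved edges -/

section Sieved

variable {n : ℕ} (G : SimpleGraph (Fin n)) [DecidableRel G.Adj] (D : Finset (Fin n))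

open Classical in
/-- The adjacency matrix, row by row. -/
noncomputable def adjFn (i : ℕ) : ℕ := if ∃ u v : Fin n, G.Adj u v ∧ n * u + v = i then 1 else 0

open Classical in
/-- The characteristic vector of the dominating set. -/
noncomputable def domFn (i : ℕ) : ℕ := if ∃ v ∈ D, (v : ℕ) = i then 1 else 0

theorem divMod_fin (u v : Fin n) : (n * (u : ℕ) + v) / n = u ∧ (n * (u : ℕ) + v) % n = v := by
  constructor
  · rw [Nat.mul_add_div u.pos, Nat.div_eq_of_lt v.2, add_zero]
  · rw [Nat.mul_add_mod, Nat.mod_eq_of_lt v.2]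

theorem mul_add_fin_inj {u v u' v' : Fin n} (h : n * (u : ℕ) + v = n * (u' : ℕ) + v') :
    u = u' ∧ v = v' := by
  have h1 := divMod_fin u v
  have h2 := divMod_fin u' v'
  rw [h] at h1
  exact ⟨Fin.ext (h1.1.symm.trans h2.1), Fin.ext (h1.2.symm.trans h2.2)⟩

theorem mul_add_fin_lt (u v : Fin n) : n * (u : ℕ) + v < n * n := by
  have := Nat.mul_le_mul_left n (show (u : ℕ) + 1 ≤ n from u.2)
  rw [mul_add, mul_one] at this
  omega

theorem exists_fin_mul_add {i : ℕ} (hi : i < n * n) : ∃ u v : Fin n, n * (u : ℕ) + v = i := by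
  have hn : 0 < n := Nat.pos_of_ne_zero fun h => by simp [h] at hi
  exact ⟨⟨i / n, Nat.div_lt_of_lt_mul hi⟩, ⟨i % n, Nat.mod_lt _ hn⟩, Nat.div_add_mod i n⟩

theorem sum_range_mul_self (f : ℕ → ℕ) :
    ∑ i ∈ Finset.range (n * n), f i = ∑ u : Fin n, ∑ v : Fin n, f (n * u + v) := by
  rw [Finset.sum_range, ← Fintype.sum_prod_type' (f := fun u v : Fin n => f (n * u + v)),
    ← finProdFinEquiv.sum_comp]
  refine Finset.sum_congr rfl fun x _ => ?_
  rw [finProdFinEquiv_apply_val, add_comm]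

theorem adjFn_le_one (i : ℕ) : adjFn G i ≤ 1 := by
  unfold adjFn
  split_ifs <;> simp

theorem adjFn_apply (u v : Fin n) : adjFn G (n * u + v) = if G.Adj u v then 1 else 0 := by
  unfold adjFn
  refine if_congr ⟨?_, fun h => ⟨u, v, h, rfl⟩⟩ rfl rfl
  rintro ⟨u', v', h, heq⟩
  obtain ⟨rfl, rfl⟩ := mul_add_fin_inj heq
  exact h

theorem domFn_le_one (i : ℕ) : domFn D i ≤ 1 := by
  unfold domFn
  split_ifs <;> simp

theorem domFn_apply (v : Fin n) : domFn D v = if v ∈ D then 1 else 0 := by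
  unfold domFn
  refine if_congr ⟨?_, fun h => ⟨v, h, rfl⟩⟩ rfl rfl
  rintro ⟨v', h, heq⟩
  obtain rfl := Fin.ext heq
  exact h

theorem sum_adjFn_row (v : ℕ) (hv : v < n) :
    (∑ i ∈ Finset.range (n * n), if i / n = v then adjFn G i else 0) = G.degree ⟨v, hv⟩ := by
  rw [sum_range_mul_self, Finset.sum_eq_single ⟨v, hv⟩]
  · rw [← G.card_neighborFinset_eq_degree, G.neighborFinset_eq_filter, Finset.card_filter]
    refine Finset.sum_congr rfl fun w _ => ?_
    rw [if_pos (divMod_fin ⟨v, hv⟩ w).1, adjFn_apply]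
  · intro u _ hu
    refine Finset.sum_eq_zero fun w _ => if_neg ?_
    rw [(divMod_fin u w).1]
    exact fun h => hu (Fin.ext h)
  · simp

theorem sum_adjFn : ∑ i ∈ Finset.range (n * n), adjFn G i = ∑ v, G.degree v := by
  rw [sum_range_mul_self]
  refine Finset.sum_congr rfl fun u _ => ?_
  rw [← G.card_neighborFinset_eq_degree, G.neighborFinset_eq_filter, Finset.card_filter]
  exact Finset.sum_congr rfl fun w _ => adjFn_apply G u w

/-- One plus the chosen neighbour of `v` in `D`, for `v` outside `D`, and `0` otherwise. -/
noncomputable def par (v : ℕ) : ℕ := RAM.parent n (adjFn G) (domFn D) (n * n) v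

/-- The edges to be sieved are those that do not join a vertex outside `D` to its chosen neighbour
in `D`. -/
def Sieved (u v : Fin n) : Prop := G.Adj u v ∧ par G D u ≠ v + 1 ∧ par G D v ≠ u + 1

variable {G D}

theorem Sieved.symm {u v : Fin n} (h : Sieved G D u v) : Sieved G D v u :=
  ⟨h.1.symm, h.2.2, h.2.1⟩

theorem par_eq_succ {u v : Fin n} (h : par G D u = v + 1) : G.Adj u v ∧ v ∈ D ∧ u ∉ D := by
  rcases RAM.parent_spec u.pos (adjFn G) (domFn D) (n * n) u with h' | ⟨w, hw, h', h1, h2, h3⟩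
  · have : par G D u = 0 := h'
    omega
  · have hw' : par G D u = w + 1 := h'
    obtain rfl : w = v := by omega
    rw [adjFn_apply] at h1
    rw [domFn_apply] at h2 h3
    simp only [ite_eq_left_iff, zero_ne_one, imp_false, not_not, ite_eq_right_iff,
      one_ne_zero] at h1 h2 h3
    exact ⟨h1, h2, h3⟩

theorem exists_par_eq_succ (hD : IsDominatingSet G D) {u : Fin n} (hu : u ∉ D) :
    ∃ v : Fin n, par G D u = v + 1 := by
  rcases RAM.parent_spec u.pos (adjFn G) (domFn D) (n * n) u with h' | ⟨w, hw, h', -⟩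
  · obtain ⟨v, hv, huv⟩ := (hD u).resolve_left hu
    refine absurd h' (RAM.parent_ne_zero u.2 v.2 ?_ ?_ ?_)
    · rw [adjFn_apply, if_pos huv]
    · rw [domFn_apply, if_pos hv]
    · rw [domFn_apply, if_neg hu]
  · exact ⟨⟨w, hw⟩, h'⟩

/-- The edges that are not sieved form stars with centres in `D` whose leaves are incident with
sieved edges otherwise. -/
theorem sieved_of_adj_of_not_sieved {u v : Fin n} (h : G.Adj u v) (hs : ¬ Sieved G D u v) :
    (∀ w, G.Adj v w → w ≠ u → Sieved G D v w) ∨ (∀ w, G.Adj u w → w ≠ v → Sieved G D u w) := by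
  have key : ∀ u v : Fin n, par G D u = v + 1 → ∀ w, G.Adj u w → w ≠ v → Sieved G D u w := by
    intro u v hp w huw hw
    refine ⟨huw, fun h => hw (Fin.ext (by omega)), fun h => ?_⟩
    exact (par_eq_succ hp).2.2 (par_eq_succ h).2.1
  by_cases h1 : par G D u = v + 1
  · exact .inr (key u v h1)
  by_cases h2 : par G D v = u + 1
  · exact .inl (key v u h2)
  · exact absurd ⟨h, h1, h2⟩ hs

variable (G D)

/-- `1` if the entry with number `i` of the upper triangle of the adjacency matrix belongs to a
sieved edge, and `0` otherwise. -/
noncomputable def selFn (i : ℕ) : ℕ :=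
  adjFn G i * (if i / n < i % n then 1 else 0) *
    (1 - ((if par G D (i / n) = i % n + 1 then 1 else 0) +
      if par G D (i % n) = i / n + 1 then 1 else 0))

/-- The number of sieved edges before entry number `i` of the adjacency matrix. -/
noncomputable def selRank (i : ℕ) : ℕ := ∑ j ∈ Finset.range i, selFn G D j

/-- The number of sieved edges. -/
noncomputable def sieveCount : ℕ := selRank G D (n * n)

/-- The number of the sieved edge between `u` and `v`. -/
noncomputable def edgeRank (u v : Fin n) : ℕ :=
  selRank G D (n * (min u v : Fin n) + (max u v : Fin n))

theorem selFn_le_one (i : ℕ) : selFn G D i ≤ 1 := by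
  refine (Nat.mul_le_mul (Nat.mul_le_mul (adjFn_le_one G i) ?_) (Nat.sub_le _ _)).trans_eq
    (by norm_num : 1 * 1 * 1 = 1)
  split_ifs <;> simp

open Classical in
theorem selFn_apply (u v : Fin n) :
    selFn G D (n * u + v) = if Sieved G D u v ∧ u < v then 1 else 0 := by
  obtain ⟨h1, h2⟩ := divMod_fin u v
  rw [selFn, h1, h2, adjFn_apply]
  simp only [Fin.val_fin_lt, Sieved]
  by_cases h3 : G.Adj u v <;> by_cases h4 : u < v <;> by_cases h5 : par G D u = v + 1 <;>
    by_cases h6 : par G D v = u + 1 <;> simp [h3, h4, h5, h6]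

variable {G D}

theorem edgeRank_comm (u v : Fin n) : edgeRank G D u v = edgeRank G D v u := by
  rw [edgeRank, edgeRank, min_comm, max_comm]

theorem edgeRank_of_lt {u v : Fin n} (h : u < v) : edgeRank G D u v = selRank G D (n * u + v) := by
  rw [edgeRank, min_eq_left h.le, max_eq_right h.le]

theorem selRank_mono : Monotone (selRank G D) := fun _ _ h =>
  Finset.sum_le_sum_of_subset (Finset.range_mono h)

theorem selRank_lt {i j : ℕ} (hi : selFn G D i = 1) (hij : i < j) :
    selRank G D i < selRank G D j := by
  refine lt_of_lt_of_le ?_ (selRank_mono (show i + 1 ≤ j from hij))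
  rw [selRank, selRank, Finset.sum_range_succ, hi]
  exact Nat.lt_succ_self _

theorem Sieved.selFn_eq_one {u v : Fin n} (h : Sieved G D u v) (huv : u < v) :
    selFn G D (n * u + v) = 1 := by
  rw [selFn_apply, if_pos ⟨h, huv⟩]

theorem Sieved.edgeRank_lt {u v : Fin n} (h : Sieved G D u v) :
    edgeRank G D u v < sieveCount G D := by
  rcases lt_or_gt_of_ne h.1.ne with huv | huv
  · rw [edgeRank_of_lt huv]
    exact selRank_lt (h.selFn_eq_one huv) (mul_add_fin_lt u v)
  · rw [edgeRank_comm, edgeRank_of_lt huv]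
    exact selRank_lt (h.symm.selFn_eq_one huv) (mul_add_fin_lt v u)

theorem Sieved.edgeRank_inj {u v u' v' : Fin n} (h : Sieved G D u v) (h' : Sieved G D u' v')
    (heq : edgeRank G D u v = edgeRank G D u' v') : s(u, v) = s(u', v') := by
  wlog huv : u < v generalizing u v
  · rw [Sym2.eq_swap]
    exact this h.symm (by rwa [edgeRank_comm])
      (lt_of_le_of_ne (not_lt.1 huv) fun e => h.1.ne e.symm)
  wlog huv' : u' < v' generalizing u' v'
  · rw [this h'.symm (by rwa [edgeRank_comm v' u'])
      (lt_of_le_of_ne (not_lt.1 huv') fun e => h'.1.ne e.symm), Sym2.eq_swap]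
  rw [edgeRank_of_lt huv, edgeRank_of_lt huv'] at heq
  have hne : n * (u : ℕ) + v = n * (u' : ℕ) + v' := by
    rcases lt_trichotomy (n * (u : ℕ) + v) (n * (u' : ℕ) + v') with hlt | he | hlt
    · exact absurd heq (selRank_lt (h.selFn_eq_one huv) hlt).ne
    · exact he
    · exact absurd heq (selRank_lt (h'.selFn_eq_one huv') hlt).ne'
  obtain ⟨rfl, rfl⟩ := mul_add_fin_inj hne
  rfl

theorem exists_edgeRank_eq {j : ℕ} (hj : j < sieveCount G D) :
    ∃ u v, Sieved G D u v ∧ edgeRank G D u v = j := by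
  have key : ∀ m, j < selRank G D m → ∃ i < m, selFn G D i = 1 ∧ selRank G D i = j := by
    intro m
    induction m with
    | zero => simp [selRank]
    | succ m ih =>
      intro h
      by_cases hlt : j < selRank G D m
      · obtain ⟨i, hi, h'⟩ := ih hlt
        exact ⟨i, hi.trans (Nat.lt_succ_self m), h'⟩
      · have h1 := selFn_le_one G D m
        have h2 : selRank G D (m + 1) = selRank G D m + selFn G D m :=
          Finset.sum_range_succ _ _
        exact ⟨m, Nat.lt_succ_self m, by omega, by omega⟩
  obtain ⟨i, hi, h1, h2⟩ := key _ hj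
  obtain ⟨u, v, rfl⟩ := exists_fin_mul_add hi
  rw [selFn_apply] at h1
  simp only [ite_eq_left_iff, zero_ne_one, imp_false, not_not] at h1
  exact ⟨u, v, h1.1, by rw [edgeRank_of_lt h1.2, h2]⟩

open Classical in
theorem card_sieved :
    (Finset.univ.filter fun x : Fin n × Fin n => Sieved G D x.1 x.2).card =
      2 * sieveCount G D := by
  have h : sieveCount G D = ∑ u : Fin n, ∑ v, if Sieved G D u v ∧ u < v then 1 else 0 := by
    rw [sieveCount, selRank, sum_range_mul_self]
    exact Finset.sum_congr rfl fun u _ => Finset.sum_congr rfl fun v _ => selFn_apply G D u v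
  have h' : sieveCount G D = ∑ u : Fin n, ∑ v, if Sieved G D u v ∧ v < u then 1 else 0 := by
    rw [h, Finset.sum_comm]
    refine Finset.sum_congr rfl fun u _ => Finset.sum_congr rfl fun v _ => ?_
    refine if_congr (and_congr_left' ⟨Sieved.symm, Sieved.symm⟩) rfl rfl
  rw [two_mul]
  nth_rw 1 [h]
  rw [h', Finset.card_filter, Fintype.sum_prod_type, ← Finset.sum_add_distrib]
  refine Finset.sum_congr rfl fun u _ => ?_
  rw [← Finset.sum_add_distrib]
  refine Finset.sum_congr rfl fun v _ => ?_
  by_cases hs : Sieved G D u v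
  · rcases lt_or_gt_of_ne hs.1.ne with huv | huv <;> simp [hs, huv, huv.not_gt]
  · simp [hs]

/-- The exponent of the running time. -/
theorem sieveCount_eq (hD : IsDominatingSet G D) :
    (sieveCount G D : ℤ) = (G.edgeFinset.card : ℤ) - n + D.card := by
  classical
  have h1 := G.sum_degrees_eq_twice_card_edges
  have h2 := card_sieved (G := G) (D := D)
  have hout : ∑ u : Fin n, ∑ v : Fin n, (if par G D u = v + 1 then 1 else 0) = n - D.card := by
    have hrow : ∀ u : Fin n, ∑ v : Fin n, (if par G D u = v + 1 then 1 else 0) =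
        if u ∈ D then 0 else 1 := by
      intro u
      split_ifs with hu
      · exact Finset.sum_eq_zero fun v _ => if_neg fun h => (par_eq_succ h).2.2 hu
      · obtain ⟨v, hv⟩ := exists_par_eq_succ hD hu
        rw [Finset.sum_eq_single v, if_pos hv]
        · intro w _ hw
          exact if_neg fun h => hw (Fin.ext (by omega))
        · simp
    rw [Finset.sum_congr rfl fun u _ => hrow u]
    have := Finset.card_compl D
    rw [Fintype.card_fin] at this
    rw [← this, show Dᶜ = Finset.univ.filter (· ∉ D) by ext; simp, Finset.card_filter]
    exact Finset.sum_congr rfl fun u _ => by split_ifs <;> rfl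
  have hout' : ∑ u : Fin n, ∑ v : Fin n, (if par G D v = u + 1 then 1 else 0) = n - D.card := by
    rw [← hout, Finset.sum_comm]
  have hsum : ∑ v, G.degree v = 2 * sieveCount G D +
      (∑ u : Fin n, ∑ v : Fin n, if par G D u = v + 1 then 1 else 0) +
      ∑ u : Fin n, ∑ v : Fin n, if par G D v = u + 1 then 1 else 0 := by
    rw [← h2, ← sum_adjFn, sum_range_mul_self, Finset.card_filter, Fintype.sum_prod_type,
      ← Finset.sum_add_distrib, ← Finset.sum_add_distrib]
    refine Finset.sum_congr rfl fun u _ => ?_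
    rw [← Finset.sum_add_distrib, ← Finset.sum_add_distrib]
    refine Finset.sum_congr rfl fun v _ => ?_
    rw [adjFn_apply]
    by_cases hp : par G D u = v + 1
    · have hq : par G D v ≠ u + 1 := fun hq => (par_eq_succ hp).2.2 (par_eq_succ hq).2.1
      simp [Sieved, hp, hq, (par_eq_succ hp).1]
    · by_cases hq : par G D v = u + 1
      · simp [Sieved, hp, hq, (par_eq_succ hq).1.symm]
      · simp [Sieved, hp, hq]
  rw [hout, hout'] at hsum
  have hDn : D.card ≤ n := by simpa using D.card_le_univ
  omega

end Sieved

/-! ### The encoded blow-up matrix -/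

section Encoded

open Polynomial

variable {n k : ℕ}

/-- The number of an index: layer `t` holds the numbers from `n * t` on, the colours come before the
dummies. -/
def idxNum : Idx k (Fin n) → ℕ
  | .inl (t, v) => n * t + v
  | .inr (j, v) => n * (k + j) + v

theorem idxNum_div_inl (t : Fin k) (v : Fin n) :
    idxNum (.inl (t, v) : Idx k (Fin n)) / n = t ∧
      idxNum (.inl (t, v) : Idx k (Fin n)) % n = v := by
  constructor
  · rw [idxNum, Nat.mul_add_div v.pos, Nat.div_eq_of_lt v.2, add_zero]
  · rw [idxNum, Nat.mul_add_mod, Nat.mod_eq_of_lt v.2]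

theorem idxNum_div_inr (j : Fin k) (v : Fin n) :
    idxNum (.inr (j, v) : Idx k (Fin n)) / n = k + j ∧
      idxNum (.inr (j, v) : Idx k (Fin n)) % n = v := by
  constructor
  · rw [idxNum, Nat.mul_add_div v.pos, Nat.div_eq_of_lt v.2, add_zero]
  · rw [idxNum, Nat.mul_add_mod, Nat.mod_eq_of_lt v.2]

theorem idxNum_injective : Function.Injective (idxNum (n := n) (k := k)) := by
  intro p q h
  rcases p with ⟨t, u⟩ | ⟨t, u⟩ <;> rcases q with ⟨s, v⟩ | ⟨s, v⟩
  · have h1 := idxNum_div_inl t u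
    have h2 := idxNum_div_inl s v
    rw [h] at h1
    simp only [Sum.inl.injEq, Prod.mk.injEq]
    exact ⟨Fin.ext (h1.1.symm.trans h2.1), Fin.ext (h1.2.symm.trans h2.2)⟩
  · have h1 := idxNum_div_inl t u
    have h2 := idxNum_div_inr s v
    rw [h] at h1
    omega
  · have h1 := idxNum_div_inr t u
    have h2 := idxNum_div_inl s v
    rw [h] at h1
    omega
  · have h1 := idxNum_div_inr t u
    have h2 := idxNum_div_inr s v
    rw [h] at h1
    simp only [Sum.inr.injEq, Prod.mk.injEq]
    exact ⟨Fin.ext (by omega), Fin.ext (h1.2.symm.trans h2.2)⟩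

theorem idxNum_lt (p : Idx k (Fin n)) : idxNum p < 2 * k * n := by
  have h : ∀ l < 2 * k, ∀ v : Fin n, n * l + v < 2 * k * n := by
    intro l hl v
    have := Nat.mul_le_mul_left n hl
    rw [Nat.succ_eq_add_one, mul_add, mul_one, mul_comm n (2 * k)] at this
    omega
  rcases p with ⟨t, u⟩ | ⟨t, u⟩
  · exact h t (by omega) u
  · exact h (k + t) (by omega) u

theorem card_idx : Fintype.card (Idx k (Fin n)) = 2 * k * n := by
  simp only [Fintype.card_sum, Fintype.card_prod, Fintype.card_fin]
  ring

/-- The numbering of the indices as a bijection. -/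
noncomputable def idxEquiv : Idx k (Fin n) ≃ Fin (2 * k * n) :=
  Equiv.ofBijective (fun p => ⟨idxNum p, idxNum_lt p⟩)
    ((Fintype.bijective_iff_injective_and_card _).2
      ⟨fun _ _ h => idxNum_injective (congrArg Fin.val h), by rw [card_idx, Fintype.card_fin]⟩)

/-- The number of an unordered pair of indices, which determines the random bits of its weight. -/
def pairNum (N : ℕ) : Sym2 (Idx k (Fin n)) → ℕ :=
  Sym2.lift ⟨fun p q => if idxNum p < idxNum q then idxNum p * N + idxNum q else
    idxNum q * N + idxNum p, fun p q => by
      dsimp only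
      rcases lt_trichotomy (idxNum p) (idxNum q) with h | h | h
      · rw [if_pos h, if_neg h.not_gt]
      · rw [h]
      · rw [if_neg h.not_gt, if_pos h]⟩

theorem pairNum_mk (N : ℕ) (p q : Idx k (Fin n)) : pairNum N s(p, q) =
    if idxNum p < idxNum q then idxNum p * N + idxNum q else idxNum q * N + idxNum p := rfl

theorem pairNum_injective : Function.Injective (pairNum (n := n) (k := k) (2 * k * n)) := by
  have key : ∀ p q p' q' : Idx k (Fin n), idxNum p * (2 * k * n) + idxNum q =
      idxNum p' * (2 * k * n) + idxNum q' → p = p' ∧ q = q' := by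
    intro p q p' q' h
    have h1 := RAM.divMod_of_lt (p := idxNum p) (idxNum_lt q)
    have h2 := RAM.divMod_of_lt (p := idxNum p') (idxNum_lt q')
    rw [h] at h1
    exact ⟨idxNum_injective (h1.1.symm.trans h2.1), idxNum_injective (h1.2.symm.trans h2.2)⟩
  intro x y
  induction x with | _ p q
  induction y with | _ p' q'
  intro h
  rw [pairNum_mk, pairNum_mk] at h
  split_ifs at h
  all_goals
    obtain ⟨rfl, rfl⟩ := key _ _ _ _ h
    first | rfl | exact Sym2.eq_swap

theorem pairNum_lt (x : Sym2 (Idx k (Fin n))) :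
    pairNum (2 * k * n) x < 2 * k * n * (2 * k * n) := by
  have key : ∀ p q : Idx k (Fin n), idxNum p * (2 * k * n) + idxNum q <
      2 * k * n * (2 * k * n) := by
    intro p q
    have h1 := idxNum_lt q
    have h2 := Nat.mul_le_mul_right (2 * k * n) (show idxNum p + 1 ≤ 2 * k * n from idxNum_lt p)
    rw [add_mul, one_mul] at h2
    omega
  induction x with | _ p q
  rw [pairNum_mk]
  split_ifs
  · exact key p q
  · exact key q p

variable (G : SimpleGraph (Fin n)) [DecidableRel G.Adj] (D : Finset (Fin n))

/-- The mask of the sieved edge that belongs to an entry of the adjacency matrix. -/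
noncomputable def selMask (i : ℕ) : ℕ :=
  if i < n * n then selFn G D i * 2 ^ selRank G D i else 0

theorem selMask_le (i : ℕ) : selMask G D i ≤ 2 ^ sieveCount G D := by
  unfold selMask
  split_ifs with h
  · refine (Nat.mul_le_mul_right _ (selFn_le_one G D i)).trans ?_
    rw [one_mul]
    exact Nat.pow_le_pow_right two_pos (selRank_mono h.le)
  · exact Nat.zero_le _

open Classical in
theorem selMask_add (u v : Fin n) : selMask G D (n * u + v) + selMask G D (n * v + u) =
    if Sieved G D u v then 2 ^ edgeRank G D u v else 0 := by
  rw [selMask, selMask, if_pos (mul_add_fin_lt u v), if_pos (mul_add_fin_lt v u), selFn_apply,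
    selFn_apply]
  by_cases h : Sieved G D u v
  · rcases lt_or_gt_of_ne h.1.ne with huv | huv
    · simp [h, huv, huv.not_gt, edgeRank_of_lt huv]
    · simp [h, h.symm, huv, huv.not_gt, edgeRank_comm u v, edgeRank_of_lt huv]
  · simp [h, mt Sieved.symm h]

/-- The entry of the matrix that the program computes from the weight and the mask of a link. -/
theorem enc_blowupMatrix {w Z L : ℕ} (hw : 0 < w) (deg : ℕ → ℕ)
    (hdeg : ∀ v : Fin n, deg v = G.degree v) (y : Sym2 (Idx k (Fin n)) → (ZMod 2)[X]) (a : ℕ)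
    (P Q : Idx k (Fin n)) {p q c₁ c₂ sl : ℕ} (hp : p = idxNum P) (hq : q = idxNum Q)
    (hc₁ : c₁ = (if p / n = q / n then 1 else 0) * (if p / n < k then 1 else 0) *
          adjFn G (n * (p % n) + q % n))
    (hc₂ : c₂ = (if p % n = q % n then 1 else 0) * ((if p / n < k then 1 else 0) *
            (1 - if q / n < k then 1 else 0) * (if q / n + deg (p % n) < 2 * k then 1 else 0) +
          (if q / n < k then 1 else 0) * (1 - if p / n < k then 1 else 0) *
            (if p / n + deg (p % n) < 2 * k then 1 else 0)))
    (hsl : sl = selMask G D (n * (p % n) + q % n) + selMask G D (n * (q % n) + p % n)) :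
    (if p = q then 1 else 0) + ((if c₁ * sl = 0 then 1 else 0) + a / (c₁ * sl) % 2) *
      (((c₁ * (if sl = 0 then 2 ^ (w * L) else 2 ^ (w * (L * (Z + 1)))) + c₂ * 2 ^ (w * L)) *
        enc w w (y s(P, Q) : (ZMod 2)[X])) &&& digitMask w w) =
    enc w w (blowupMatrix G (Sieved G D) (edgeRank G D) Z L y a P Q : (ZMod 2)[X]) := by
  classical
  have hpow : ∀ (f : PowerSeries (ZMod 2)) (j : ℕ), enc w w (f * PowerSeries.X ^ j) =
      2 ^ (w * j) * enc w w f &&& digitMask w w := by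
    intro f j
    rw [enc_mul_X_pow hw, mul_comm]
  have hpq : p = q ↔ P = Q := by
    rw [hp, hq]
    exact idxNum_injective.eq_iff
  have hbit : ∀ j, a / 2 ^ j % 2 = if a.testBit j then 1 else 0 := by
    intro j
    rw [Nat.testBit_eq_decide_div_mod_eq]
    have := Nat.mod_lt (a / 2 ^ j) two_pos
    by_cases h : a / 2 ^ j % 2 = 1
    · simp [h]
    · simp only [h, decide_false, Bool.false_eq_true, if_false]
      omega
  by_cases hPQ : P = Q
  · subst hPQ
    obtain rfl : p = q := hp.trans hq.symm
    have h1 : c₁ = 0 := by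
      rcases P with ⟨t, u⟩ | ⟨t, u⟩
      · rw [hc₁, hp, (idxNum_div_inl t u).2, adjFn_apply]
        simp
      · rw [hc₁, hp, (idxNum_div_inr t u).2, adjFn_apply]
        simp
    have h2 : c₂ = 0 := by
      rw [hc₂]
      by_cases h : p / n < k <;> simp [h]
    simp [h1, h2, blowupMatrix, enc_one hw]
  have hne : p ≠ q := mt hpq.1 hPQ
  rw [if_neg hne, zero_add, blowupMatrix, if_neg hPQ]
  rcases P with ⟨t, u⟩ | ⟨t, u⟩ <;> rcases Q with ⟨s, v⟩ | ⟨s, v⟩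
  · obtain ⟨h1, h2⟩ := idxNum_div_inl t u
    obtain ⟨h3, h4⟩ := idxNum_div_inl s v
    have h5 : c₁ = if t = s ∧ G.Adj u v then 1 else 0 := by
      rw [hc₁, hp, hq, h1, h2, h3, h4, adjFn_apply]
      by_cases hts : t = s <;> by_cases hA : G.Adj u v <;> simp [hts, hA, Fin.val_inj]
    have h6 : c₂ = 0 := by
      rw [hc₂, hp, hq, h1, h3]
      simp
    have h7 : sl = if Sieved G D u v then 2 ^ edgeRank G D u v else 0 := by
      rw [hsl, hp, hq, h2, h4, selMask_add]
    rw [h5, h6, h7]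
    by_cases hl : t = s ∧ G.Adj u v
    · by_cases hs : Sieved G D u v
      · by_cases hb : a.testBit (edgeRank G D u v)
        · simp [hl, hs, hbit, hb, link, sieveLink, linkWeight, Idx.vertex, hpow]
        · simp [hl, hs, hbit, hb, link, sieveLink, Idx.vertex, enc_zero]
      · simp [hl, hs, link, sieveLink, linkWeight, hpow]
    · simp [hl, link, enc_zero]
  · obtain ⟨h1, h2⟩ := idxNum_div_inl t u
    obtain ⟨h3, h4⟩ := idxNum_div_inr s v
    have h5 : c₁ = 0 := by
      rw [hc₁, hp, hq, h1, h3, if_neg (by omega)]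
      simp
    have h6 : c₂ = if u = v ∧ (s : ℕ) + G.degree u < k then 1 else 0 := by
      have : k + (s : ℕ) + G.degree u < 2 * k ↔ (s : ℕ) + G.degree u < k := by omega
      rw [hc₂, hp, hq, h1, h2, h3, h4, hdeg]
      by_cases huv : u = v <;> simp [huv, Fin.val_inj, this]
    rw [h5, h6]
    by_cases hl : u = v ∧ (s : ℕ) + G.degree u < k
    · simp [hl, link, sieveLink, linkWeight, hpow]
    · simp [hl, link, enc_zero]
  · obtain ⟨h1, h2⟩ := idxNum_div_inr t u
    obtain ⟨h3, h4⟩ := idxNum_div_inl s v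
    have h5 : c₁ = 0 := by
      rw [hc₁, hp, hq, h1, h3, if_neg (by omega)]
      simp
    have h6 : c₂ = if u = v ∧ (t : ℕ) + G.degree u < k then 1 else 0 := by
      have : k + (t : ℕ) + G.degree u < 2 * k ↔ (t : ℕ) + G.degree u < k := by omega
      rw [hc₂, hp, hq, h1, h2, h3, h4, hdeg]
      by_cases huv : u = v <;> simp [huv, Fin.val_inj, this]
    rw [h5, h6]
    have h7 : link G (.inr (t, u)) (.inl (s, v)) ↔ u = v ∧ (t : ℕ) + G.degree u < k := by
      constructor
      all_goals
        rintro ⟨rfl, h⟩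
        exact ⟨rfl, h⟩
    simp only [h7]
    by_cases hl : u = v ∧ (t : ℕ) + G.degree u < k
    · obtain ⟨rfl, hl⟩ := hl
      simp [hl, sieveLink, linkWeight, hpow]
    · simp [hl, enc_zero]
  · obtain ⟨h1, h2⟩ := idxNum_div_inr t u
    obtain ⟨h3, h4⟩ := idxNum_div_inr s v
    have h5 : c₁ = 0 := by
      rw [hc₁, hp, h1]
      simp
    have h6 : c₂ = 0 := by
      rw [hc₂, hp, hq, h1, h3]
      simp
    simp [h5, h6, link, enc_zero]

open Classical in
/-- The blow-up matrix over the numbers of its indices, with power series as entries. -/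
noncomputable def numMatrix {N : ℕ} (φ : Idx k (Fin n) ≃ Fin N)
    (M : Matrix (Idx k (Fin n)) (Idx k (Fin n)) (ZMod 2)[X]) (p q : ℕ) : PowerSeries (ZMod 2) :=
  if h : p < N ∧ q < N then
    (M (φ.symm ⟨p, h.1⟩) (φ.symm ⟨q, h.2⟩) : (ZMod 2)[X]) else 0

theorem det_numMatrix {N : ℕ} (φ : Idx k (Fin n) ≃ Fin N)
    (M : Matrix (Idx k (Fin n)) (Idx k (Fin n)) (ZMod 2)[X]) :
    (Matrix.of fun j l : Fin N => numMatrix φ M j l).det =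
      (M.det : (ZMod 2)[X]) := by
  have h : (Matrix.of fun j l : Fin N => numMatrix φ M j l) =
      ((Polynomial.coeToPowerSeries.ringHom (R := ZMod 2)).mapMatrix M).submatrix
        φ.symm φ.symm := by
    ext1 j l
    simp [numMatrix]
  rw [h, Matrix.det_submatrix_equiv_self, ← RingHom.map_det]
  rfl

theorem isUnipotentMod_numMatrix {N Z L : ℕ} (φ : Idx k (Fin n) ≃ Fin N)
    {S : Fin n → Fin n → Prop} {e : Fin n → Fin n → ℕ} (hL : 0 < L)
    (y : Sym2 (Idx k (Fin n)) → (ZMod 2)[X]) (a : ℕ) :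
    IsUnipotentMod N (numMatrix φ (blowupMatrix G S e Z L y a)) := by
  classical
  intro j hj l hl
  rw [numMatrix, dif_pos ⟨hj, hl⟩, blowupMatrix]
  have hinj : φ.symm ⟨j, hj⟩ = φ.symm ⟨l, hl⟩ ↔ j = l := by
    rw [φ.symm.injective.eq_iff, Fin.mk.injEq]
  have hpos : ∀ P Q : Idx k (Fin n), L * linkWeight S Z P Q ≠ 0 := by
    intro P Q
    unfold linkWeight
    split_ifs <;> simp [hL.ne']
  by_cases hjl : j = l
  · rw [if_pos (hinj.2 hjl), if_pos hjl]
    simp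
  · rw [if_neg (mt hinj.1 hjl), if_neg hjl, ← PowerSeries.coeff_zero_eq_constantCoeff_apply,
      Polynomial.coeff_coe]
    split_ifs
    · rw [Polynomial.mul_coeff_zero, Polynomial.coeff_X_pow, if_neg (hpos _ _).symm, mul_zero]
    · simp

end Encoded

/-! ### The whole program -/

namespace RAM

/-- The algorithm, for the error bound `(n + 1) ^ (-c)`. -/
def mainProg (c : ℕ) : Prog :=
  .seq degProg (.seq maxProg (.seq parProg (.seq selProg (.seq (paramProg c) (.seq shiftProg
    (.seq coinProg (.seq wtProg (.seq sieveProg outProg))))))))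

variable {n : ℕ} (G : SimpleGraph (Fin n)) [DecidableRel G.Adj] (D : Finset (Fin n))

theorem input_store (x i : ℕ) : (input G D).store (x, i) =
    if x = aN then if i = 0 then n else 0 else if x = aAdj then adjFn G i else
      if x = aDom then domFn D i else 0 := by
  classical
  have h1 : (∑ u : Fin n, ∑ v : Fin n,
      (if G.Adj u v then Finsupp.single (1, n * (u : ℕ) + (v : ℕ)) 1 else 0) : Store) (x, i) =
      if x = 1 then adjFn G i else 0 := by
    have h2 : ∀ u v : Fin n,
        (if G.Adj u v then Finsupp.single (1, n * (u : ℕ) + (v : ℕ)) 1 else 0 : Store) (x, i) =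
        if x = 1 ∧ G.Adj u v ∧ n * (u : ℕ) + v = i then 1 else 0 := by
      intro u v
      by_cases h : G.Adj u v
      · simp only [h, if_true, Finsupp.single_apply, Prod.mk.injEq, true_and]
        exact if_congr (and_congr_left' eq_comm) rfl rfl
      · simp [h]
    simp only [Finsupp.finsetSum_apply, h2]
    by_cases hx : x = 1
    · by_cases hi : ∃ u v : Fin n, G.Adj u v ∧ n * (u : ℕ) + v = i
      · obtain ⟨u, v, huv, rfl⟩ := hi
        rw [Finset.sum_eq_single u, Finset.sum_eq_single v]
        · simp [hx, huv, adjFn_apply]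
        · intro w _ hw
          exact if_neg fun h => hw (mul_add_fin_inj h.2.2).2
        · simp
        · intro w _ hw
          exact Finset.sum_eq_zero fun z _ => if_neg fun h => hw (mul_add_fin_inj h.2.2).1
        · simp
      · rw [if_pos hx, adjFn, if_neg hi]
        exact Finset.sum_eq_zero fun u _ => Finset.sum_eq_zero fun v _ =>
          if_neg fun h => hi ⟨u, v, h.2⟩
    · simp [hx]
  have h3 : (∑ v ∈ D, Finsupp.single (2, (v : ℕ)) 1 : Store) (x, i) =
      if x = 2 then domFn D i else 0 := by
    have h4 : ∀ v : Fin n, (Finsupp.single (2, (v : ℕ)) 1 : Store) (x, i) =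
        if x = 2 ∧ (v : ℕ) = i then 1 else 0 := by
      intro v
      simp only [Finsupp.single_apply, Prod.mk.injEq]
      exact if_congr (and_congr_left' eq_comm) rfl rfl
    simp only [Finsupp.finsetSum_apply, h4]
    by_cases hx : x = 2
    · by_cases hi : ∃ v ∈ D, (v : ℕ) = i
      · obtain ⟨v, hv, rfl⟩ := hi
        rw [Finset.sum_eq_single v]
        · simp [hx, hv, domFn_apply]
        · intro w _ hw
          exact if_neg fun h => hw (Fin.ext h.2)
        · exact fun h => absurd hv h
      · rw [if_pos hx, domFn, if_neg hi]
        exact Finset.sum_eq_zero fun v hv => if_neg fun h => hi ⟨v, hv, h.2⟩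
    · simp [hx]
  rw [input, Finsupp.add_apply, Finsupp.add_apply, h1, h3]
  simp only [Finsupp.single_apply, Prod.mk.injEq]
  by_cases h0 : x = 0
  · subst h0
    simp [eq_comm]
  · by_cases h1 : x = 1
    · simp [h1]
    · by_cases h2 : x = 2
      · simp [h2]
      · simp [h0, h1, h2, Ne.symm h0]

/-- The parameters for the given input. -/
noncomputable def params (c : ℕ) : Params where
  n := n
  k := G.maxDegree
  r := sieveCount G D
  d := ∑ v, G.degree v
  c := c

theorem params_N (c : ℕ) : (params G D c).N = 2 * G.maxDegree * n := rfl

theorem bounded_input {E : Env} (hA : 32 ≤ E.A) (hM : n * n + n + 2 ≤ E.M) :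
    (input G D).store.Bounded E.A E.M := by
  intro x i
  rw [input_store]
  split_ifs with h1 h2 h3 h4
  · exact fun _ => ⟨by omega, by omega, lt_two_pow_of_le (by omega)⟩
  · simp
  · intro hi
    refine ⟨by omega, ?_, lt_two_pow_of_le ((adjFn_le_one G i).trans (by omega))⟩
    rw [adjFn] at hi
    obtain ⟨u, v, -, rfl⟩ := (ne_eq _ _ ▸ ite_ne_right_iff.1 hi).1
    have := mul_add_fin_lt u v
    omega
  · intro hi
    refine ⟨by omega, ?_, lt_two_pow_of_le ((domFn_le_one D i).trans (by omega))⟩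
    rw [domFn] at hi
    obtain ⟨v, -, rfl⟩ := (ite_ne_right_iff.1 hi).1
    omega
  · simp

/-- The random weight of a pair of indices. -/
noncomputable def randWeight (q : Params) (ω : ℕ → Bool) {k n : ℕ}
    (x : Sym2 (Idx k (Fin n))) : Polynomial (ZMod 2) :=
  bitPoly q.b fun i => ω (q.b * pairNum q.N x + i)

open Classical in
/-- The output of the algorithm as a function of the random bits. -/
noncomputable def outFn (c : ℕ) (ω : ℕ → Bool) : ℕ :=
  if G.maxDegree = 0 then 1 else
    if MvPolynomial.eval (randWeight (params G D c) ω) (coverPoly G G.maxDegree (Sieved G D)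
      (edgeRank G D) (sieveCount G D) (params G D c).Z (params G D c).T) ≠ 0 then G.maxDegree
    else G.maxDegree + 1

/-- The number of steps of the algorithm per set of sieved edges. -/
def mainSteps (q : Params) : ℕ :=
  q.n * q.n * 12 + q.n * 3 + q.Nt * 15 + q.N * q.N * q.b * 4 + q.N * q.N * 4 +
    sieveSteps q.N q.Nt + 50

theorem sup_degree (d : ℕ → ℕ) (hd : ∀ v : Fin n, d v = G.degree v) :
    (Finset.range n).sup d = G.maxDegree := by
  apply le_antisymm
  · refine Finset.sup_le fun v hv => ?_
    rw [hd ⟨v, Finset.mem_range.1 hv⟩]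
    exact G.degree_le_maxDegree _
  · refine G.maxDegree_le_of_forall_degree_le _ fun v => ?_
    rw [← hd]
    exact Finset.le_sup (f := d) (Finset.mem_range.2 v.2)

theorem runs_mainProg (c : ℕ) {E : Env} (hA : 32 ≤ E.A) (hM : (params G D c).bound ≤ E.M) :
    Runs E (mainProg c) (2 ^ sieveCount G D * mainSteps (params G D c))
      (fun s => s.output = outFn G D c E.bits) (input G D) := by
  classical
  obtain ⟨q, hq⟩ : ∃ q, q = params G D c := ⟨_, rfl⟩
  have hqn : q.n = n := by rw [hq]; rfl
  have hqk : q.k = G.maxDegree := by rw [hq]; rfl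
  have hqr : q.r = sieveCount G D := by rw [hq]; rfl
  have hqd : q.d = ∑ v, G.degree v := by rw [hq]; rfl
  have hqc : q.c = c := by rw [hq]; rfl
  have hqN : q.N = 2 * G.maxDegree * n := by rw [hq]; rfl
  rw [← hq] at hM ⊢
  have hbd : q.bound = q.Nt * q.Nt + q.Nt + q.N * q.N * q.b + q.N * q.N + q.b + q.n * q.n + q.n +
    q.r + 10 := rfl
  have hM0 : n * n + n + 2 ≤ E.M := by
    rw [← hqn]
    omega
  have hfit : E.Fits q.N q.Nt := ⟨hA, by omega, q.Nt_pos, by omega⟩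
  have hadj1 := adjFn_le_one G
  have hdom1 := domFn_le_one D
  -- Degrees and the sieved edges.
  refine Runs.mono (n := (n * n * 4 + 2) + ((n * 3 + 2) + ((n * n * 3 + 2) + ((n * n * 5 + 3) +
    (6 + ((q.Nt * 15 + 20) + ((q.N * q.N * q.b * 4 + 2) + ((q.N * q.N * 4 + 2) +
    ((2 ^ q.r * (sieveSteps q.N q.Nt + 2) + 2) + 1))))))))) ?_ ?_ fun s h => h
  swap
  · have hpos : 1 ≤ 2 ^ sieveCount G D := Nat.one_le_two_pow
    rw [hqr, mainSteps, hqn]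
    generalize 2 ^ sieveCount G D = x at hpos
    generalize sieveSteps q.N q.Nt = y
    generalize n * n = z₁
    generalize q.N * q.N * q.b = z₂
    generalize q.N * q.N = z₃
    have h1 := Nat.mul_le_mul_right (z₁ * 12 + n * 3 + q.Nt * 15 + z₂ * 4 + z₃ * 4 + 48) hpos
    rw [show z₁ * 12 + n * 3 + q.Nt * 15 + z₂ * 4 + z₃ * 4 + y + 50 =
      (z₁ * 12 + n * 3 + q.Nt * 15 + z₂ * 4 + z₃ * 4 + 48) + (y + 2) by ring, mul_add x _ (y + 2)]
    omega
  refine Runs.seq ((runs_degProg (n := n) (a := adjFn G) hA hM0 (by simp [input_store])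
    (fun i => by simp [input_store]) hadj1 (fun i => by simp [input_store])
    (by simp [input_store])).mono le_rfl ?_)
  rintro s₁ ⟨ag₁, hdeg₁, hsum₁⟩
  obtain ⟨deg, hdeg⟩ : ∃ deg : ℕ → ℕ, ∀ v, s₁.store (aDeg, v) = deg v := ⟨_, fun _ => rfl⟩
  have hdegG : ∀ v : Fin n, deg v = G.degree v := by
    intro v
    rw [← hdeg, hdeg₁, sum_adjFn_row G v v.2]
  rw [sum_adjFn, ← hqd] at hsum₁
  have s₁N : s₁.store (aN, 0) = n := by simp [ag₁.2 aN (by decide), input_store]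
  have s₁adj : ∀ i, s₁.store (aAdj, i) = adjFn G i := fun i => by
    simp [ag₁.2 aAdj (by decide), input_store]
  have s₁dom : ∀ i, s₁.store (aDom, i) = domFn D i := fun i => by
    simp [ag₁.2 aDom (by decide), input_store]
  refine Runs.seq ((runs_maxProg (n := n) (d := deg) hA hM0 s₁N (fun v _ => hdeg v)
    (fun v hv => ?_) (by simp [ag₁.2 aMax (by decide), input_store])).mono le_rfl ?_)
  · rw [hdegG ⟨v, hv⟩]
    exact (G.degree_lt_card_verts _).le.trans_eq (Fintype.card_fin n)
  rintro s₂ ⟨ag₂, hmax₂⟩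
  rw [sup_degree G deg hdegG, ← hqk] at hmax₂
  refine Runs.seq ((runs_parProg (n := n) (a := adjFn G) (dom := domFn D) hA hM0
    (by rw [ag₂.2 aN (by decide), s₁N]) (fun i => by rw [ag₂.2 aAdj (by decide), s₁adj])
    (fun i => by rw [ag₂.2 aDom (by decide), s₁dom]) hadj1 hdom1
    (fun i => by simp [ag₂.2 aPar (by decide), ag₁.2 aPar (by decide), input_store])).mono
    le_rfl ?_)
  rintro s₃ ⟨ag₃, hpar₃⟩
  have s₃N : s₃.store (aN, 0) = n := by rw [ag₃.2 aN (by decide), ag₂.2 aN (by decide), s₁N]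
  have s₃adj : ∀ i, s₃.store (aAdj, i) = adjFn G i := fun i => by
    rw [ag₃.2 aAdj (by decide), ag₂.2 aAdj (by decide), s₁adj]
  have s₃0 : ∀ x, 7 ≤ x → x < 29 → ∀ i, s₃.store (x, i) = 0 := by
    intro x hx hx' i
    rw [ag₃.2 x (by simp; omega), ag₂.2 x (by simp; omega), ag₁.2 x (by simp; omega), input_store,
      if_neg (by omega), if_neg (by omega), if_neg (by omega)]
  refine Runs.seq ((runs_selProg (n := n) (a := adjFn G) (p := par G D) (c := selFn G D) hA hM0
    s₃N s₃adj hpar₃ (fun i => rfl) (selFn_le_one G D) (s₃0 _ (by omega) (by omega) _)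
    (s₃0 _ (by omega) (by omega))).mono le_rfl ?_)
  rintro s₄ ⟨ag₄, hsel₄, hcnt₄, hpow₄⟩
  have hsel₄' : ∀ i, s₄.store (aSel, i) = selMask G D i := hsel₄
  have hcnt₄' : s₄.store (aCnt, 0) = q.r := hcnt₄.trans hqr.symm
  have hpow₄' : s₄.store (aPow, 0) = 2 ^ q.r := by
    rw [hpow₄, hqr]
    rfl
  -- Parameters, powers of two and random bits.
  have s₄N : s₄.store (aN, 0) = n := by rw [ag₄.2 aN (by decide), s₃N]
  have s₄max : s₄.store (aMax, 0) = q.k := by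
    rw [ag₄.2 aMax (by decide), ag₃.2 aMax (by decide), hmax₂]
  have s₄sum : s₄.store (aSum, 0) = q.d := by
    rw [ag₄.2 aSum (by decide), ag₃.2 aSum (by decide), ag₂.2 aSum (by decide), hsum₁]
  have s₄deg : ∀ v, s₄.store (aDeg, v) = deg v := fun v => by
    rw [ag₄.2 aDeg (by decide), ag₃.2 aDeg (by decide), ag₂.2 aDeg (by decide), hdeg]
  have s₄adj : ∀ i, s₄.store (aAdj, i) = adjFn G i := fun i => by
    rw [ag₄.2 aAdj (by decide), s₃adj]
  have s₄0 : ∀ x, 10 ≤ x → x < 29 → ∀ i, s₄.store (x, i) = 0 := by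
    intro x hx hx' i
    rw [ag₄.2 x (by simp; omega), s₃0 x (by omega) hx']
  have s₄c : s₄.coins = 0 := by
    rw [ag₄.1, ag₃.1, ag₂.1, ag₁.1]
    rfl
  have hpp := runs_paramProg (E := E) (s := s₄) q hA hM (by rw [s₄N, hqn]) s₄max hcnt₄' s₄sum
  rw [hqc] at hpp
  refine Runs.seq (hpp.mono le_rfl ?_)
  rintro s₅ ⟨ag₅, hN₅, hb₅, hL₅, hZ₅, hT₅, hNt₅⟩
  refine Runs.seq ((runs_shiftProg q hA hM hL₅ hZ₅ hT₅ hNt₅).mono le_rfl ?_)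
  rintro s₆ ⟨ag₆, hW₆, hXL₆, hXZ₆, hP₆, hmask₆⟩
  refine Runs.seq ((runs_coinProg q hA hM (by rw [ag₆.2 aSize (by decide), hN₅])
    (by rw [ag₆.2 aBits (by decide), hb₅]) hW₆
    (fun i => by rw [ag₆.2 aY (by decide), ag₅.2 aY (by decide), s₄0 _ (by omega) (by omega)])
    (by rw [ag₆.1, ag₅.1, s₄c])).mono le_rfl ?_)
  rintro s₇ ⟨ag₇, hy₇⟩
  have t₇ : ∀ x, x ∉ [aSize, aBits, aL, aZ, aT, aNt, aI, aW, aXL, aXZ, aP, aMask, aCoin, aY] →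
      ∀ i, s₇.store (x, i) = s₄.store (x, i) := by
    intro x hx i
    simp only [List.mem_cons, List.not_mem_nil, or_false, not_or] at hx
    rw [ag₇ x (by simp; omega), ag₆.2 x (by simp; omega), ag₅.2 x (by simp; omega)]
  have s₇size : s₇.store (aSize, 0) = q.N := by
    rw [ag₇ aSize (by decide), ag₆.2 aSize (by decide), hN₅]
  have s₇mask : s₇.store (aMask, 0) = digitMask q.Nt q.Nt := by
    rw [ag₇ aMask (by decide), hmask₆]
  have s₇Nt : s₇.store (aNt, 0) = q.Nt := by
    rw [ag₇ aNt (by decide), ag₆.2 aNt (by decide), hNt₅]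
  -- The weights of the links.
  refine Runs.seq ((runs_wtProg (n := n) (k := G.maxDegree) (N := q.N) (r := q.r)
    (xl := 2 ^ (q.Nt * q.L)) (xz := 2 ^ (q.Nt * (q.L * (q.Z + 1))))
    (mask := digitMask q.Nt q.Nt) (a := adjFn G) (deg := deg) (sel := selMask G D)
    (y := fun i => s₇.store (aY, i)) hA (by omega) (by omega)
    ((digitMask_lt q.Nt_pos _).trans (Nat.pow_lt_pow_right one_lt_two hfit.precision))
    (by rw [t₇ aN (by decide), s₄N]) (by rw [t₇ aMax (by decide), s₄max, hqk]) s₇size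
    (by rw [ag₇ aXL (by decide), hXL₆]) (by rw [ag₇ aXZ (by decide), hXZ₆]) s₇mask
    (fun i => by rw [t₇ aAdj (by decide), s₄adj]) hadj1
    (fun i => by rw [t₇ aDeg (by decide), s₄deg])
    (fun i => by rw [t₇ aSel (by decide), hsel₄'])
    (fun i => by rw [hqr]; exact selMask_le G D i) (fun i => rfl)).mono le_rfl ?_)
  rintro s₈ ⟨ag₈, hwt₈⟩
  -- The determinants.
  let φ : Idx G.maxDegree (Fin n) ≃ Fin q.N := idxEquiv.trans (finCongr hqN.symm)
  have hφ : ∀ (i : ℕ) (hi : i < q.N), i = idxNum (φ.symm ⟨i, hi⟩) := by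
    intro i hi
    have h : ((φ (φ.symm ⟨i, hi⟩) : Fin q.N) : ℕ) = i := by rw [φ.apply_symm_apply]
    exact h.symm
  have hentry : ∀ a < 2 ^ q.r, ∀ p < q.N, ∀ p' < q.N, (if p = p' then 1 else 0) +
      ((if s₈.store (aSb, p * q.N + p') = 0 then 1 else 0) +
        a / s₈.store (aSb, p * q.N + p') % 2) * s₈.store (aWt, p * q.N + p') =
      enc q.Nt q.Nt (numMatrix φ (blowupMatrix G (Sieved G D) (edgeRank G D) q.Z q.L
        (randWeight q E.bits) a) p p') := by
    intro a _ p hp p' hp'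
    have hy : s₇.store (aY, if p < p' then p * q.N + p' else p' * q.N + p) =
        enc q.Nt q.Nt (randWeight q E.bits s(φ.symm ⟨p, hp⟩, φ.symm ⟨p', hp'⟩) :
          Polynomial (ZMod 2)) := by
      have hlt := pairNum_lt s(φ.symm ⟨p, hp⟩, φ.symm ⟨p', hp'⟩)
      have hpair := pairNum_mk q.N (φ.symm ⟨p, hp⟩) (φ.symm ⟨p', hp'⟩)
      rw [← hφ p hp, ← hφ p' hp'] at hpair
      rw [← hqN, hpair] at hlt
      rw [hy₇ _ hlt, hornerBits_eq_enc (q.b_le (Nat.zero_lt_of_lt hp)), randWeight, hpair]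
    obtain ⟨h1, h2⟩ := hwt₈ p hp p' hp' _ _ _ _ rfl rfl rfl hy.symm
    rw [h1, h2, enc_blowupMatrix G D q.Nt_pos deg hdegG _ a _ _ (hφ p hp) (hφ p' hp') rfl rfl
      rfl, numMatrix, dif_pos ⟨hp, hp'⟩]
  refine Runs.seq ((runs_sieveProg hfit (by rw [ag₈.2 aSize (by decide), s₇size])
    (by rw [ag₈.2 aNt (by decide), s₇Nt]) (by rw [ag₈.2 aMask (by decide), s₇mask]) (r := q.r)
    (by omega) (by rw [ag₈.2 aPow (by decide), t₇ aPow (by decide), hpow₄'])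
    (by rw [ag₈.2 aAcc (by decide), t₇ aAcc (by decide), s₄0 _ (by omega) (by omega)])
    (fun a => isUnipotentMod_numMatrix G φ q.L_pos _ a) hentry).mono le_rfl ?_)
  rintro s₉ ⟨ag₉, hacc₉⟩
  simp only [det_numMatrix] at hacc₉
  refine (runs_outProg hfit (k := q.k) (u := q.L * q.T) (l := q.L)
    (by rw [ag₉.2 aMax (by decide), ag₈.2 aMax (by decide), t₇ aMax (by decide), s₄max]) ?_
    (by rw [ag₉.2 aP (by decide), ag₈.2 aP (by decide), ag₇ aP (by decide), hP₆])
    (by rw [ag₉.2 aXL (by decide), ag₈.2 aXL (by decide), ag₇ aXL (by decide), hXL₆])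
    ?_ hacc₉).mono le_rfl ?_
  · rcases Nat.eq_zero_or_pos n with h | h
    · subst h
      have : G.maxDegree = 0 := by simp [SimpleGraph.maxDegree]
      omega
    · have : 2 * G.maxDegree * 1 ≤ 2 * G.maxDegree * n := Nat.mul_le_mul_left _ h
      have := q.N_lt
      omega
  · refine le_trans ?_ q.le_Nt
    rw [mul_add, mul_add]
    omega
  · intro s' hs'
    rw [hs', hqk, outFn, ← hqr, ← hq]
    have hcoe : (∑ a ∈ Finset.range (2 ^ q.r), ((blowupMatrix G (Sieved G D) (edgeRank G D) q.Z q.L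
        (randWeight (k := G.maxDegree) q E.bits) a).det : PowerSeries (ZMod 2))) =
        ((∑ a ∈ Finset.range (2 ^ q.r), (blowupMatrix G (Sieved G D) (edgeRank G D) q.Z q.L
        (randWeight (k := G.maxDegree) q E.bits) a).det : Polynomial (ZMod 2)) :
          PowerSeries (ZMod 2)) :=
      (map_sum Polynomial.coeToPowerSeries.ringHom _ _).symm
    have hiff := exists_coeff_ne_zero_iff (k := G.maxDegree) (S := Sieved G D) (r := q.r)
      (Z := q.Z) (L := q.L) (b := q.b)
      q.T (fun _ _ h => h.symm) (edgeRank_comm (G := G) (D := D))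
      (fun u v h => by rw [hqr]; exact h.edgeRank_lt)
      (fun u v h => h.1) (randWeight q E.bits) (fun x => natDegree_bitPoly_le _ _)
      (by rw [card_idx, ← hqN]; exact Nat.lt_succ_self _)
    rw [hcoe]
    simp only [Polynomial.coeff_coe]
    simp only [hiff]

end RAM

/-! ### Resources -/

namespace RAM

/-- Polynomial functions on the natural numbers. -/
def IsPolyFn (f : ℕ → ℕ) : Prop := ∃ p : Polynomial ℕ, ∀ n, p.eval n = f n

namespace IsPolyFn

theorem id : IsPolyFn fun n => n := ⟨.X, by simp⟩

theorem const (a : ℕ) : IsPolyFn fun _ => a := ⟨.C a, by simp⟩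

theorem add {f g : ℕ → ℕ} : IsPolyFn f → IsPolyFn g → IsPolyFn fun n => f n + g n := by
  rintro ⟨p, hp⟩ ⟨q, hq⟩
  exact ⟨p + q, fun n => by rw [Polynomial.eval_add, hp, hq]⟩

theorem mul {f g : ℕ → ℕ} : IsPolyFn f → IsPolyFn g → IsPolyFn fun n => f n * g n := by
  rintro ⟨p, hp⟩ ⟨q, hq⟩
  exact ⟨p * q, fun n => by rw [Polynomial.eval_mul, hp, hq]⟩

end IsPolyFn

/-- The largest parameters for graphs with `n` vertices. -/
def maxParams (c n : ℕ) : Params := ⟨n, n, n * n, 0, c⟩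

theorem isPolyFn_maxParams (c : ℕ) : IsPolyFn (fun n => (maxParams c n).bound) ∧
    IsPolyFn fun n => mainSteps (maxParams c n) := by
  have hn := IsPolyFn.id
  have hN : IsPolyFn fun n => (maxParams c n).N := ((IsPolyFn.const 2).mul hn).mul hn
  have hb : IsPolyFn fun n => (maxParams c n).b :=
    (IsPolyFn.const (c + 3)).mul (hn.add (.const 1))
  have hL : IsPolyFn fun n => (maxParams c n).L := (hN.mul hb).add (.const 1)
  have hZ : IsPolyFn fun n => (maxParams c n).Z := hN.add (.const 1)
  have hT : IsPolyFn fun n => (maxParams c n).T :=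
    (((IsPolyFn.const 2).mul hZ).mul (hn.mul hn)).add hN
  have hNt : IsPolyFn fun n => (maxParams c n).Nt := hL.mul ((hT.add hZ).add (.const 2))
  refine ⟨(((((((hNt.mul hNt).add hNt).add ((hN.mul hN).mul hb)).add (hN.mul hN)).add hb).add
    (hn.mul hn)).add hn).add (hn.mul hn) |>.add (.const 10), ?_⟩
  have hdet : IsPolyFn fun n => detSteps (maxParams c n).N (maxParams c n).Nt :=
    (hN.mul (((IsPolyFn.const 1).add (((hNt.mul (.const 3)).add (.const 3)).add
      (((hN.mul hN).mul (.const 3)).add (.const 2)))).add (.const 2))).add (.const 3)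
  have hsieve : IsPolyFn fun n => sieveSteps (maxParams c n).N (maxParams c n).Nt :=
    (((hN.mul hN).mul (.const 3)).add (.const 2)).add (hdet.add (.const 1))
  exact (((((((hn.mul hn).mul (.const 12)).add (hn.mul (.const 3))).add
    (hNt.mul (.const 15))).add (((hN.mul hN).mul hb).mul (.const 4))).add
    ((hN.mul hN).mul (.const 4))).add hsieve).add (.const 50)

theorem Params.le_maxParams (q : Params) (hk : q.k ≤ q.n) (hr : q.r ≤ q.n * q.n) :
    q.bound ≤ (maxParams q.c q.n).bound ∧ mainSteps q ≤ mainSteps (maxParams q.c q.n) := by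
  obtain ⟨q', hq'⟩ : ∃ q', q' = maxParams q.c q.n := ⟨_, rfl⟩
  rw [← hq']
  have h1 : q.n = q'.n := by rw [hq']; rfl
  have h2 : q.r ≤ q'.r := by rw [hq']; exact hr
  have h3 : q.N ≤ q'.N := by
    rw [hq']
    exact Nat.mul_le_mul_right _ (Nat.mul_le_mul_left _ hk)
  have h4 : q.b = q'.b := by rw [hq']; rfl
  have h5 : q.L ≤ q'.L := by
    unfold Params.L
    rw [h4]
    gcongr
  have h6 : q.Z ≤ q'.Z := Nat.succ_le_succ h3
  have h7 : q.T ≤ q'.T := by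
    have h : q.N - q.d ≤ q'.N - q'.d := by
      have : q'.d = 0 := by rw [hq']; rfl
      omega
    unfold Params.T
    gcongr
  have h8 : q.Nt ≤ q'.Nt := by
    unfold Params.Nt
    gcongr
  constructor
  · unfold Params.bound
    rw [h4, h1]
    gcongr
  · unfold mainSteps sieveSteps detSteps
    rw [h4, h1]
    gcongr

end RAM

/-! ### Correctness of the output -/

section Correctness

open RAM

variable {n : ℕ} (G : SimpleGraph (Fin n)) [DecidableRel G.Adj] (D : Finset (Fin n))

theorem coverWeight_eq_T_iff (c w : ℕ) : w = (params G D c).T ↔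
    w + ∑ v, G.degree v = 2 * (params G D c).Z * sieveCount G D +
      2 * (G.maxDegree * Fintype.card (Fin n)) := by
  have hd : ∑ v, G.degree v ≤ n * G.maxDegree :=
    (Finset.sum_le_card_nsmul _ _ _ fun v _ => G.degree_le_maxDegree v).trans (by simp)
  have hT : (params G D c).T = 2 * (params G D c).Z * sieveCount G D +
      (2 * G.maxDegree * n - ∑ v, G.degree v) := rfl
  have h : 2 * G.maxDegree * n = 2 * (n * G.maxDegree) := by ring
  rw [hT, h, Fintype.card_fin, mul_comm G.maxDegree n]
  omega

/-- The covering polynomial vanishes unless the graph has an edge colouring with maximum degree many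
colours. -/
theorem coverPoly_ne_zero_iff (c : ℕ) (hk : 0 < G.maxDegree) :
    coverPoly G G.maxDegree (Sieved G D) (edgeRank G D) (sieveCount G D) (params G D c).Z
      (params G D c).T ≠ 0 ↔ ∃ c : Sym2 (Fin n) → Fin G.maxDegree, ProperOn G c := by
  classical
  constructor
  · intro h
    obtain ⟨σ, hσ, -⟩ := Finset.exists_ne_zero_of_sum_ne_zero h
    obtain ⟨hσ, hw⟩ := (Finset.mem_filter.1 hσ).2
    refine hσ.exists_properOn G.degree_le_maxDegree hk (fun _ _ h => h.1)
      (fun _ _ h => h.edgeRank_lt) (fun _ _ _ _ h h' => h.edgeRank_inj h') ?_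
      (fun _ _ => sieved_of_adj_of_not_sieved) ?_ ((coverWeight_eq_T_iff G D c _).1 hw)
    · rw [← card_sieved]
    · rw [Fintype.card_fin, ← mul_assoc]
      exact Nat.lt_succ_self _
  · rintro ⟨col, hcol⟩
    obtain ⟨σ, hσ, hw⟩ := hcol.exists_isCover (e := edgeRank G D) (S := Sieved G D)
      (r := sieveCount G D) (Z := (params G D c).Z) G.degree_le_maxDegree (fun _ _ h => h.1)
      (fun _ => exists_edgeRank_eq) (by rw [← card_sieved])
    exact coverPoly_ne_zero hσ ((coverWeight_eq_T_iff G D c _).2 hw)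

theorem outFn_eq_or (c : ℕ) (ω : ℕ → Bool) : outFn G D c ω = chromaticIndex G ∨
    (chromaticIndex G = G.maxDegree ∧ outFn G D c ω = G.maxDegree + 1) := by
  unfold outFn
  rcases Nat.eq_zero_or_pos G.maxDegree with h | h
  · rw [if_pos h, chromaticIndex_eq_one_of_maxDegree_eq_zero G h]
    exact .inl rfl
  rw [if_neg h.ne']
  by_cases hc : ∃ c : Sym2 (Fin n) → Fin G.maxDegree, ProperOn G c
  · rw [chromaticIndex_eq_maxDegree G h hc]
    split_ifs
    · exact .inl rfl
    · exact .inr ⟨rfl, rfl⟩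
  · have h0 : coverPoly G G.maxDegree (Sieved G D) (edgeRank G D) (sieveCount G D)
        (params G D c).Z (params G D c).T = 0 := by
      by_contra h0
      exact hc ((coverPoly_ne_zero_iff G D c h).1 h0)
    rw [chromaticIndex_eq_maxDegree_add_one G hc h, h0, map_zero]
    exact .inl (if_neg fun h => h rfl)

/-- The number `b` of random bits per weight is `(n + 1) * (c + 3)`, and `N ≤ (n + 1) ^ 3`. -/
theorem size_div_two_pow_le (c : ℕ) :
    ((params G D c).N : ℝ) / 2 ^ (params G D c).b ≤ 1 / ((n : ℝ) + 1) ^ c := by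
  have hkn : G.maxDegree ≤ n :=
    G.maxDegree_le_of_forall_degree_le _ fun v =>
      (G.degree_lt_card_verts v).le.trans_eq (Fintype.card_fin n)
  have hN : (params G D c).N ≤ (n + 1) ^ 3 := by
    rw [params_N]
    have := Nat.mul_le_mul_right n (Nat.mul_le_mul_left 2 hkn)
    have h3 : (n + 1) ^ 3 = n * n * n + 3 * n * n + 3 * n + 1 := by ring
    nlinarith [Nat.zero_le (n * n * n)]
  have hb : (n + 1) ^ (c + 3) ≤ 2 ^ (params G D c).b := by
    have : (params G D c).b = (n + 1) * (c + 3) := mul_comm _ _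
    rw [this, pow_mul]
    exact Nat.pow_le_pow_left Nat.lt_two_pow_self.le _
  have hmul : (params G D c).N * (n + 1) ^ c ≤ 1 * 2 ^ (params G D c).b := by
    refine le_trans (Nat.mul_le_mul_right _ hN) ?_
    rw [one_mul, ← pow_add, add_comm 3 c]
    exact hb
  rw [div_le_div_iff₀ (by positivity) (by positivity)]
  exact_mod_cast hmul

theorem le_measure_outFn_eq (c : ℕ) : 1 - 1 / ((n : ℝ) + 1) ^ c ≤
    RAM.coinMeasure.real {ω | outFn G D c ω = chromaticIndex G} := by
  have hnn : (0 : ℝ) ≤ 1 / ((n : ℝ) + 1) ^ c := by positivity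
  have hsure : (∀ ω, outFn G D c ω = chromaticIndex G) → 1 - 1 / ((n : ℝ) + 1) ^ c ≤
      RAM.coinMeasure.real {ω | outFn G D c ω = chromaticIndex G} := by
    intro h
    simp only [h, Set.ofPred_true, MeasureTheory.probReal_univ]
    linarith
  by_cases hgood : 0 < G.maxDegree ∧ ∃ c : Sym2 (Fin n) → Fin G.maxDegree, ProperOn G c
  · obtain ⟨hk, hc⟩ := hgood
    have hQ := (coverPoly_ne_zero_iff G D c hk).2 hc
    have hz := coinMeasure_eval_eq_zero_le (b := (params G D c).b) hQ
      (totalDegree_coverPoly_le _ _ _ _ _ _) pairNum_injective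
    rw [card_idx, ← params_N G D c] at hz
    have hcover : (Set.univ : Set (ℕ → Bool)) ⊆ {ω | outFn G D c ω = chromaticIndex G} ∪
        {ω | MvPolynomial.eval (randWeight (params G D c) ω) (coverPoly G G.maxDegree (Sieved G D)
          (edgeRank G D) (sieveCount G D) (params G D c).Z (params G D c).T) = 0} := by
      intro ω _
      by_cases h : MvPolynomial.eval (randWeight (params G D c) ω) (coverPoly G G.maxDegree
        (Sieved G D) (edgeRank G D) (sieveCount G D) (params G D c).Z (params G D c).T) = 0
      · exact .inr h
      · refine .inl ?_
        rw [Set.mem_ofPred_eq, outFn, if_neg hk.ne', if_pos h, chromaticIndex_eq_maxDegree G hk hc]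
    have h1 := (MeasureTheory.measureReal_mono (μ := RAM.coinMeasure) hcover).trans
      (MeasureTheory.measureReal_union_le _ _)
    rw [MeasureTheory.probReal_univ] at h1
    have h2 := hz.trans (size_div_two_pow_le G D c)
    unfold randWeight at h1
    linarith
  · refine hsure fun ω => ?_
    rcases outFn_eq_or G D c ω with h | ⟨h, h'⟩
    · exact h
    · rcases Nat.eq_zero_or_pos G.maxDegree with h0 | h0
      · rw [chromaticIndex_eq_one_of_maxDegree_eq_zero G h0, outFn, if_pos h0]
      · rw [chromaticIndex_eq_maxDegree_add_one G (fun hc => hgood ⟨h0, hc⟩) h0] at h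
        omega

end Correctness

theorem lemma4 (c : ℕ) :
    ∃ (A : RAM.Prog) (T S : Polynomial ℕ),
      ∀ (n : ℕ) (G : SimpleGraph (Fin n)) [DecidableRel G.Adj] (D : Finset (Fin n)),
        IsDominatingSet G D →
          ∃ out : (ℕ → Bool) → ℕ,
            -- whatever the random bits are: running time and space
            (∀ ω : ℕ → Bool, ∃ t m : ℕ, RAM.Computes ω A (RAM.input G D) (out ω) t m ∧
              (t : ℝ) ≤ ((T.eval n : ℕ) : ℝ) * (2 : ℝ) ^ ((G.edgeFinset.card : ℤ) - n + D.card) ∧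
              m ≤ S.eval n) ∧
            -- one-sided error
            (∀ ω : ℕ → Bool, out ω = chromaticIndex G ∨
              (chromaticIndex G = G.maxDegree ∧ out ω = G.maxDegree + 1)) ∧
            -- success with high probability
            1 - 1 / ((n : ℝ) + 1) ^ c ≤ RAM.coinMeasure.real {ω | out ω = chromaticIndex G} := by
  obtain ⟨hM, hsteps⟩ := RAM.isPolyFn_maxParams c
  have hK := RAM.IsPolyFn.const (RAM.mainProg c).costFactor
  obtain ⟨T, hT⟩ := hsteps.mul (hK.mul hM)
  obtain ⟨S, hS⟩ := (((RAM.IsPolyFn.const 32).mul hM).mul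
    ((RAM.IsPolyFn.const 32).add ((RAM.IsPolyFn.const 2).mul hM))).add (hK.mul hM)
  refine ⟨RAM.mainProg c, T, S, fun n G _ D hD => ⟨RAM.outFn G D c, fun ω => ?_,
    outFn_eq_or G D c, le_measure_outFn_eq G D c⟩⟩
  have hk : G.maxDegree ≤ n :=
    G.maxDegree_le_of_forall_degree_le _ fun v =>
      (G.degree_lt_card_verts v).le.trans_eq (Fintype.card_fin n)
  have hr : sieveCount G D ≤ n * n := by
    unfold sieveCount selRank
    exact (Finset.sum_le_card_nsmul _ _ 1 fun i _ => selFn_le_one G D i).trans (by simp)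
  obtain ⟨hbound, hle⟩ := (RAM.params G D c).le_maxParams hk hr
  let E : RAM.Env := ⟨(RAM.mainProg c).costFactor, 32, (RAM.maxParams c n).bound, ω⟩
  have hnM : n * n + n + 2 ≤ (RAM.maxParams c n).bound := by
    have : (RAM.maxParams c n).bound = (RAM.maxParams c n).Nt * (RAM.maxParams c n).Nt +
      (RAM.maxParams c n).Nt + (RAM.maxParams c n).N * (RAM.maxParams c n).N *
      (RAM.maxParams c n).b + (RAM.maxParams c n).N * (RAM.maxParams c n).N +
      (RAM.maxParams c n).b + n * n + n + n * n + 10 := rfl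
    omega
  obtain ⟨s', t, m, hexec, ht, hm, -, hout⟩ := RAM.runs_mainProg G D c (E := E) le_rfl hbound
    le_rfl (RAM.bounded_input G D (E := E) le_rfl hnM)
  refine ⟨t, m, ⟨s', hexec, hout⟩, ?_, hm.trans_eq (hS n).symm⟩
  rw [← sieveCount_eq hD, zpow_natCast, hT]
  have ht' : t ≤ RAM.mainSteps (RAM.maxParams c n) * ((RAM.mainProg c).costFactor *
      (RAM.maxParams c n).bound) * 2 ^ sieveCount G D := by
    refine ht.trans ?_
    calc _ ≤ 2 ^ sieveCount G D * RAM.mainSteps (RAM.maxParams c n) *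
          ((RAM.mainProg c).costFactor * (RAM.maxParams c n).bound) :=
        Nat.mul_le_mul_right _ (Nat.mul_le_mul_left _ hle)
      _ = _ := by ring
  exact_mod_cast ht'
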